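/- **Setting.** Let $(X_i,\varepsilon_i)$, $i\ge 1$, be i.i.d. pairs of real random variables such that $X_1$ and $\varepsilon_1$ are independent, $E\varepsilon_1=0$, $\operatorname{Var}\varepsilon_1=1$, and $X_1$ has density $f$. Put $Y_i=m(X_i)+\sigma(X_i)\varepsilon_i$ with measurable $m,\sigma:\mathbb R\to\mathbb R$. Let $K$ be a kernel, $h=h_n>0$ a bandwidth, $K_h(t)=K(t/h)/h$, and $$S_{n,l}(z)=h\sum_{i=1}^n (z-X_i)^lK_h(z-X_i),\qquad T_{n,l}(z)=h\sum_{i=1}^n (z-X_i)^lK_h(z-X_i)Y_i .$$ The local linear estimator, in the version that admits unconditional moments, is $$\hat m(z)=\frac{S_{n,2}(z)T_{n,0}(z)-S_{n,1}(z)T_{n,1}(z)}{S_{n,0}(z)S_{n,2}(z)-S_{n,1}(z)^2+n^{-2}} .$$ With $A_0(r)=r(r-1)/2$, $A_1(r)=1-r^2$, $A_2(r)=r(r+1)/2$ and a constant $\delta>0$, let $$\tilde m_\pm(x)=\sum_{j=0}^{2}A_j(\pm 1/\sqrt2)\,\hat m\bigl(x-(\pm 1/\sqrt2+1-j)\,\delta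 h\bigr),\qquad \tilde m_a(x)=\tfrac12\{\tilde m_+(x)+\tilde m_-(x)\}.$$ Write $\nu_{ij}=\int s^iK(s)^j\,ds$, $C(a,\delta)=\int K(t-a\delta)K(t+a\delta)\,dt$, and $C(\delta)=\tfrac32C(0,\delta)-2C(\tfrac12,\delta)+\tfrac12C(1,\delta)$. **Assumptions.** $K$ is a symmetric probability density with compact support and $\nu_{02}=\int K^2<\infty$. At the fixed point $x$: $m$ is twice differentiable in a neighbourhood of $x$ and $m''$ is continuous at $x$ (hence bounded near $x$); $f(x)>0$ and, for some $c$ and some $0<\alpha<1$, $|f(x)-f(y)|\le c|x-y|^\alpha$ for all $y$; $\sigma^2$ is continuous at $x$ (hence bounded near $x$). Finally $h\to0$ and $nh\to\infty$ as $n\to\infty$. **Theorem.** For all sufficiently large $n$ the estimator $\tilde m_a(x)$ is square integrable, and, as $n\to\infty$, $$E\{\tilde m_a(x)\}-m(x)=\tfrac12m''(x)\nu_{20}h^2+o\{h^2+(nh)^{-1/2}\},$$ $$\operatorname{Var}\{\tilde m_a(x)\}=\frac{\sigma^2(x)}{nhf(x)}\Bigl\{\nu_{02}-\frac{C(\delta)}4-\frac{D(\delta)}2\Bigr\}+o\{h^4+(nh)^{-1}\},$$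 where $$\begin{aligned}D(\delta)=\nu_{02}-\tfrac14C(\delta)-\tfrac1{16}\bigl\{&4(1+\sqrt2)\,C(\sqrt2-1,\delta/2)+(3+2\sqrt2)\,C(2-\sqrt2,\delta/2)+2\,C(\sqrt2,\delta/2)\\&+4(1-\sqrt2)\,C(\sqrt2+1,\delta/2)+(3-2\sqrt2)\,C(\sqrt2+2,\delta/2)\bigr\}.\end{aligned}$$ -/

import Mathlib

open MeasureTheory ProbabilityTheory Filter Topology Asymptotics

namespace LocalLinear

noncomputable section

/-! ### The estimators, as functions of the data `X i, Y i`, `i < n` -/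

/-- The rescaled kernel `K_h(t) = K(t / h) / h`. -/
def scaledKernel (K : ℝ → ℝ) (h t : ℝ) : ℝ := K (t / h) / h

/-- `S_{n,l}(z) = h ∑ᵢ (z - Xᵢ)^l K_h(z - Xᵢ)`. -/
def S (K : ℝ → ℝ) (h : ℝ) (n : ℕ) (X : ℕ → ℝ) (l : ℕ) (z : ℝ) : ℝ :=
  h * ∑ i ∈ Finset.range n, (z - X i) ^ l * scaledKernel K h (z - X i)

/-- `T_{n,l}(z) = h ∑ᵢ (z - Xᵢ)^l K_h(z - Xᵢ) Yᵢ`. -/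
def T (K : ℝ → ℝ) (h : ℝ) (n : ℕ) (X Y : ℕ → ℝ) (l : ℕ) (z : ℝ) : ℝ :=
  h * ∑ i ∈ Finset.range n, (z - X i) ^ l * scaledKernel K h (z - X i) * Y i

/-- The local linear estimator of the regression function at `z`, in the version whose
denominator carries the additional summand `n⁻²`. -/
def estimator (K : ℝ → ℝ) (h : ℝ) (n : ℕ) (X Y : ℕ → ℝ) (z : ℝ) : ℝ :=
  (S K h n X 2 z * T K h n X Y 0 z - S K h n X 1 z * T K h n X Y 1 z) /
    (S K h n X 0 z * S K h n X 2 z - S K h n X 1 z * S K h n X 1 z + 1 / (n : ℝ) ^ 2)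

/-- The coefficients `A₀(r), A₁(r), A₂(r)` of quadratic interpolation. -/
def interpCoeff (r : ℝ) : Fin 3 → ℝ :=
  ![r * (r - 1) / 2, 1 - r ^ 2, r * (r + 1) / 2]

/-- The variance reduced estimator `m̃_q(x)` with shift `r` and spacing `ω = δ h`: the value at
`x` of the quadratic interpolation of the local linear estimators at `x - (r + 1 - j) ω`,
`j = 0, 1, 2`. -/
def quadEstimator (K : ℝ → ℝ) (δ r h : ℝ) (n : ℕ) (X Y : ℕ → ℝ) (x : ℝ) : ℝ :=
  ∑ j : Fin 3, interpCoeff r j *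
    estimator K h n X Y (x - (r + 1 - ((j : ℕ) : ℝ)) * (δ * h))

/-- The averaged estimator `m̃_a = (m̃₊ + m̃₋) / 2`, where `m̃_±` has shift `±1/√2`. -/
def avgEstimator (K : ℝ → ℝ) (δ h : ℝ) (n : ℕ) (X Y : ℕ → ℝ) (x : ℝ) : ℝ :=
  (quadEstimator K δ (1 / √2) h n X Y x + quadEstimator K δ (-(1 / √2)) h n X Y x) / 2

/-! ### Kernel constants -/

/-- `ν_{ij} = ∫ s^i K(s)^j ds`. -/
def nu (K : ℝ → ℝ) (i j : ℕ) : ℝ := ∫ s, s ^ i * K s ^ j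

/-- `C(a, δ) = ∫ K(t - a δ) K(t + a δ) dt`. -/
def crossC (K : ℝ → ℝ) (a δ : ℝ) : ℝ := ∫ t, K (t - a * δ) * K (t + a * δ)

/-- `C(δ) = (3/2) C(0, δ) - 2 C(1/2, δ) + (1/2) C(1, δ)`. -/
def constC (K : ℝ → ℝ) (δ : ℝ) : ℝ :=
  3 / 2 * crossC K 0 δ - 2 * crossC K (1 / 2) δ + 1 / 2 * crossC K 1 δ

/-- The constant `D(δ)`. -/
def constD (K : ℝ → ℝ) (δ : ℝ) : ℝ :=
  nu K 0 2 - 1 / 4 * constC K δ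
    - 1 / 16 * (4 * (1 + √2) * crossC K (√2 - 1) (δ / 2)
      + (3 + 2 * √2) * crossC K (2 - √2) (δ / 2)
      + 2 * crossC K (√2) (δ / 2)
      + 4 * (1 - √2) * crossC K (√2 + 1) (δ / 2)
      + (3 - 2 * √2) * crossC K (√2 + 2) (δ / 2))

/-! ### Model and conditions -/

/-- The pairs `(Xᵢ, εᵢ)` are independent and identically distributed, `ε` is independent of `X`
and has zero mean and unit variance, and `X` has density `f`. -/
structure IsSample {Ω : Type*} [MeasurableSpace Ω] (P : Measure Ω) (X ε : ℕ → Ω → ℝ)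
    (f : ℝ → ℝ) : Prop where
  measurable_X : ∀ i, Measurable (X i)
  measurable_ε : ∀ i, Measurable (ε i)
  indep : iIndepFun (fun i ω => (X i ω, ε i ω)) P
  identDistrib : ∀ i, IdentDistrib (fun ω => (X i ω, ε i ω)) (fun ω => (X 0 ω, ε 0 ω)) P P
  indep_noise : IndepFun (X 0) (ε 0) P
  mean_noise : P[ε 0] = 0
  variance_noise : Var[ε 0; P] = 1
  measurable_f : Measurable f
  f_nonneg : ∀ y, 0 ≤ f y
  law_X : P.map (X 0) = volume.withDensity (fun y => ENNReal.ofReal (f y))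

/-- The response `Yᵢ = m(Xᵢ) + σ(Xᵢ) εᵢ`. -/
def response {Ω : Type*} (m σ : ℝ → ℝ) (X ε : ℕ → Ω → ℝ) (i : ℕ) (ω : Ω) : ℝ :=
  m (X i ω) + σ (X i ω) * ε i ω

/-- `K` is a symmetric density with compact support (and finite `ν₀₂ = ∫ K²`). -/
structure KernelCondition (K : ℝ → ℝ) : Prop where
  measurable : Measurable K
  nonneg : ∀ t, 0 ≤ K t
  integral_eq_one : ∫ t, K t = 1
  symm : ∀ t, K (-t) = K t
  compactSupport : HasCompactSupport K
  memLp_two : MemLp K 2 volume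

/-- The condition on the regression function `m`, the design density `f` and the noise level `σ`
at the point `x`. Continuity of `m''` and `σ²` at `x` contains their boundedness near `x`;
nothing is required of them away from `x`. -/
structure PointCondition (m σ f : ℝ → ℝ) (x : ℝ) : Prop where
  measurable_m : Measurable m
  measurable_σ : Measurable σ
  twice_diff : ∀ᶠ y in 𝓝 x, DifferentiableAt ℝ m y ∧ DifferentiableAt ℝ (deriv m) y
  continuousAt_deriv2 : ContinuousAt (deriv (deriv m)) x
  f_pos : 0 < f x
  f_holder : ∃ c α : ℝ, 0 < α ∧ α < 1 ∧ ∀ y, |f x - f y| ≤ c * |x - y| ^ α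
  continuousAt_σ_sq : ContinuousAt (fun y => σ y ^ 2) x

/-- The averaged estimator at `x` from the first `n` observations, as a random variable. -/
def avgEstimatorRV {Ω : Type*} (K m σ : ℝ → ℝ) (X ε : ℕ → Ω → ℝ) (δ h : ℝ) (n : ℕ) (x : ℝ)
    (ω : Ω) : ℝ :=
  avgEstimator K δ h n (fun i => X i ω) (fun i => response m σ X ε i ω) x

end

end LocalLinear

/-!
Write `N = n h` and `t i = (z - X i) / h`. The local linear estimator at `z` is a weighted mean
`N⁻¹ ∑ i, weight i * Y i` (`estimator_eq`), where the weights are rational functions of the kernel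
moments `p_l = N⁻¹ ∑ i, (t i) ^ l * K (t i)`, with denominator `p₀ p₂ - p₁² + N⁻⁴`. All six
evaluation points have the form `z = x + s h`, so the averaged estimator is a combination
`∑ q, α q * m̂(x + s q * h)` whose coefficients satisfy `∑ α = 1`, `∑ α s = 0` and `∑ α s² = 0`,
because quadratic interpolation is exact on quadratic polynomials. The asymptotics are proved for
every such combination (`IsSample.linearCombination_asymptotics`).

Splitting `Y i = m (X i) + σ (X i) * ε i` gives a function of the design plus a noise term that is
centred and uncorrelated with all functions of the design (`IsSample.noise_sum`), so that bias and
variance separate (`mean_variance_add_noise`).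

* *Design part.* The weights reproduce constants and annihilate linear functions vanishing at `z`,
  up to the ridge, so by Taylor's formula the weighted mean of `m (X i)` is the second order Taylor
  polynomial of `m` at `z` plus `m''(x) ν₂₀ h² / 2`, with mean square error `o(h⁴ + N⁻¹)`
  (`IsSample.bias_isLittleO`). In the combination the Taylor polynomials collapse to `m x`.
* *Noise part.* The weights are close to `K (t i) / f x` in mean square
  (`IsSample.tendsto_sq_weight_sub`), hence `N` times the noise variance tends to
  `σ² / f · ∫ (∑ q, α q * K (u + s q))² du` (`IsSample.tendsto_noise_variance`). Expanding the
  square into autocorrelations of `K` yields the constant of the theorem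
  (`KernelCondition.integral_sq_avgCoeff`).

Both estimates rest on laws of large numbers for the kernel moments, and on the control of designs
with an almost singular denominator. On the event `Balanced`, where the design carries kernel mass
on both sides of `z`, the denominator is bounded below by a multiple of `p₀`. Off this event the
ridge bounds the weights by a power of `N`, while the event has probability smaller than every power
of `N⁻¹` (`IsSample.tendsto_pow_mul_lowerTail`). As `K` is merely square integrable and possibly
unbounded, this last estimate is made with the weight `p₀²` inside the expectation, by exponential
tilting and leaving two observations out (`integral_sq_sum_mul_exp_le`); for the same reason the law
of large numbers for `K²` is one in `L¹`.
-/

namespace LocalLinear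

/-! ### Algebra of the local linear weights -/

/-- The sum of `φ (t i)` over `i < n`, divided by the effective sample size `N`
(which is `n * h` in the applications). -/
noncomputable def localMean (n : ℕ) (N : ℝ) (t : ℕ → ℝ) (φ : ℝ → ℝ) : ℝ :=
  (∑ i ∈ Finset.range n, φ (t i)) / N

/-- The normalised kernel moment `p_l = N⁻¹ ∑ᵢ tᵢ^l K(tᵢ)`. -/
noncomputable def moment (K : ℝ → ℝ) (n : ℕ) (N : ℝ) (t : ℕ → ℝ) (l : ℕ) : ℝ :=
  localMean n N t (fun u => u ^ l * K u)

/-- The determinant `p₀ p₂ - p₁²` of the normalised normal equations. -/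
noncomputable def gap (K : ℝ → ℝ) (n : ℕ) (N : ℝ) (t : ℕ → ℝ) : ℝ :=
  moment K n N t 0 * moment K n N t 2 - moment K n N t 1 ^ 2

/-- The weights for which the local linear estimator is `N⁻¹ ∑ᵢ weight i * Yᵢ`. After the
normalisation the ridge term `n⁻²` of the denominator has become `N⁻⁴`. -/
noncomputable def weight (K : ℝ → ℝ) (n : ℕ) (N : ℝ) (t : ℕ → ℝ) (i : ℕ) : ℝ :=
  K (t i) * (moment K n N t 2 - t i * moment K n N t 1) / (gap K n N t + (N ^ 4)⁻¹)

lemma localMean_mono {n : ℕ} {N : ℝ} {t : ℕ → ℝ} {φ ψ : ℝ → ℝ} (hN : 0 ≤ N)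
    (h : ∀ u, φ u ≤ ψ u) : localMean n N t φ ≤ localMean n N t ψ :=
  div_le_div_of_nonneg_right (Finset.sum_le_sum fun _ _ => h _) hN

lemma localMean_nonneg {n : ℕ} {N : ℝ} {t : ℕ → ℝ} {φ : ℝ → ℝ} (hN : 0 ≤ N)
    (h : ∀ u, 0 ≤ φ u) : 0 ≤ localMean n N t φ :=
  div_nonneg (Finset.sum_nonneg fun _ _ => h _) hN

lemma localMean_sub (n : ℕ) (N : ℝ) (t : ℕ → ℝ) (φ ψ : ℝ → ℝ) :
    localMean n N t (fun u => φ u - ψ u) = localMean n N t φ - localMean n N t ψ := by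
  simp [localMean, Finset.sum_sub_distrib, sub_div]

lemma sq_add_five_le (u v w x z : ℝ) :
    (u + v + w + x + z) ^ 2 ≤ 5 * (u ^ 2 + v ^ 2 + w ^ 2 + x ^ 2 + z ^ 2) := by
  have : 5 * (u ^ 2 + v ^ 2 + w ^ 2 + x ^ 2 + z ^ 2) - (u + v + w + x + z) ^ 2 =
      (u - v) ^ 2 + (u - w) ^ 2 + (u - x) ^ 2 + (u - z) ^ 2 + (v - w) ^ 2 + (v - x) ^ 2
        + (v - z) ^ 2 + (w - x) ^ 2 + (w - z) ^ 2 + (x - z) ^ 2 := by ring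
  rw [← sub_nonneg, this]
  positivity

lemma sq_add_sub_le (u v w : ℝ) : (u + v - w) ^ 2 ≤ 3 * (u ^ 2 + v ^ 2 + w ^ 2) := by
  have : 3 * (u ^ 2 + v ^ 2 + w ^ 2) - (u + v - w) ^ 2 =
      (u - v) ^ 2 + (u + w) ^ 2 + (v + w) ^ 2 := by ring
  rw [← sub_nonneg, this]
  positivity

section Deterministic

variable {K : ℝ → ℝ} {n : ℕ} {N B : ℝ} {t : ℕ → ℝ}

lemma moment_zero : moment K n N t 0 = localMean n N t K := by simp [moment]

lemma moment_zero_nonneg (hK : ∀ u, 0 ≤ K u) (hN : 0 ≤ N) : 0 ≤ moment K n N t 0 :=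
  localMean_nonneg hN fun u => by simpa using hK u

lemma moment_two_nonneg (hK : ∀ u, 0 ≤ K u) (hN : 0 ≤ N) : 0 ≤ moment K n N t 2 :=
  localMean_nonneg hN fun u => mul_nonneg (sq_nonneg u) (hK u)

lemma abs_moment_le (hK : ∀ u, 0 ≤ K u) (hN : 0 < N) (hB : ∀ u, K u ≠ 0 → |u| ≤ B) (l : ℕ) :
    |moment K n N t l| ≤ B ^ l * moment K n N t 0 := by
  simp only [moment, localMean, abs_div, abs_of_pos hN, ← mul_div_assoc]
  refine div_le_div_of_nonneg_right ?_ hN.le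
  rw [Finset.mul_sum]
  refine (Finset.abs_sum_le_sum_abs _ _).trans (Finset.sum_le_sum fun i _ => ?_)
  rw [abs_mul, abs_pow, abs_of_nonneg (hK _), pow_zero, one_mul]
  by_cases h0 : K (t i) = 0
  · simp [h0]
  · exact mul_le_mul_of_nonneg_right (pow_le_pow_left₀ (abs_nonneg _) (hB _ h0) l) (hK _)

lemma sum_pow_mul (hN : N ≠ 0) (l : ℕ) :
    ∑ i ∈ Finset.range n, t i ^ l * K (t i) = N * moment K n N t l := by
  simp only [moment, localMean]; field_simp

/-- The weighted sum of squares `(α + β t)²` is a quadratic form in the kernel moments. -/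
lemma sum_sq_affine (hN : N ≠ 0) (α β : ℝ) :
    ∑ i ∈ Finset.range n, K (t i) * (α - t i * β) ^ 2 =
      N * (α ^ 2 * moment K n N t 0 - 2 * α * β * moment K n N t 1
        + β ^ 2 * moment K n N t 2) := by
  have e : ∀ i, K (t i) * (α - t i * β) ^ 2 = α ^ 2 * (t i ^ 0 * K (t i))
      - 2 * α * β * (t i ^ 1 * K (t i)) + β ^ 2 * (t i ^ 2 * K (t i)) := fun i => by ring
  simp only [e, Finset.sum_add_distrib, Finset.sum_sub_distrib, ← Finset.mul_sum,
    sum_pow_mul hN]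
  ring

lemma sum_sq_residual (hN : N ≠ 0) :
    ∑ i ∈ Finset.range n, K (t i) * (moment K n N t 2 - t i * moment K n N t 1) ^ 2 =
      N * (moment K n N t 2 * gap K n N t) := by
  rw [sum_sq_affine hN, gap]; ring

lemma gap_nonneg (hK : ∀ u, 0 ≤ K u) (hN : 0 < N) : 0 ≤ gap K n N t := by
  have h := Finset.sum_sq_le_sum_mul_sum_of_sq_le_mul (Finset.range n)
    (r := fun i => t i ^ 1 * K (t i)) (f := fun i => t i ^ 0 * K (t i))
    (g := fun i => t i ^ 2 * K (t i)) (fun i _ => by simpa using hK _)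
    (fun i _ => mul_nonneg (sq_nonneg _) (hK _)) (fun i _ => le_of_eq (by ring))
  simp only [sum_pow_mul hN.ne'] at h
  rw [gap]
  have : 0 ≤ N ^ 2 * (moment K n N t 0 * moment K n N t 2 - moment K n N t 1 ^ 2) := by
    nlinarith
  exact nonneg_of_mul_nonneg_right this (by positivity)

lemma ridge_pos (hN : 0 < N) : 0 < (N ^ 4)⁻¹ := by positivity

lemma gap_add_ridge_pos (hK : ∀ u, 0 ≤ K u) (hN : 0 < N) : 0 < gap K n N t + (N ^ 4)⁻¹ :=
  add_pos_of_nonneg_of_pos (gap_nonneg hK hN) (ridge_pos hN)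

/-- The ridge bounds `d / (d + κ)²` by `κ⁻¹ = N⁴`. -/
lemma gap_div_sq_le (hK : ∀ u, 0 ≤ K u) (hN : 0 < N) :
    gap K n N t / (gap K n N t + (N ^ 4)⁻¹) ^ 2 ≤ N ^ 4 := by
  have h1 := gap_nonneg (n := n) (t := t) hK hN
  have h2 := gap_add_ridge_pos (n := n) (t := t) hK hN
  have h3 : (N ^ 4)⁻¹ * N ^ 4 = 1 := by field_simp
  have h4 : 0 < N ^ 4 := by positivity
  rw [div_le_iff₀ (by positivity)]
  have h5 : 0 ≤ gap K n N t * N ^ 4 := by positivity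
  have h6 : N ^ 4 * (gap K n N t + (N ^ 4)⁻¹) ^ 2 =
      gap K n N t * (gap K n N t * N ^ 4) + 2 * gap K n N t * ((N ^ 4)⁻¹ * N ^ 4)
        + (N ^ 4)⁻¹ * ((N ^ 4)⁻¹ * N ^ 4) := by ring
  rw [h6, h3]
  have := ridge_pos hN
  nlinarith [mul_nonneg h1 h5]

/-- Moments of the weights; in particular the weights annihilate linear functions that vanish
at the estimation point. -/
lemma sum_weight_mul_pow (hN : N ≠ 0) (l : ℕ) :
    ∑ i ∈ Finset.range n, weight K n N t i * t i ^ l =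
      N * ((moment K n N t 2 * moment K n N t l - moment K n N t 1 * moment K n N t (l + 1)) /
        (gap K n N t + (N ^ 4)⁻¹)) := by
  have e : ∀ i, weight K n N t i * t i ^ l =
      (moment K n N t 2 * (t i ^ l * K (t i)) - moment K n N t 1 * (t i ^ (l + 1) * K (t i)))
        / (gap K n N t + (N ^ 4)⁻¹) := fun i => by rw [weight]; ring
  simp only [e, ← Finset.sum_div, Finset.sum_sub_distrib, ← Finset.mul_sum, sum_pow_mul hN]
  ring

/-- A bound on the weights that holds for every configuration of the design points. -/
lemma weight_sq_le (hK : ∀ u, 0 ≤ K u) (hN : 0 < N) (hB : ∀ u, K u ≠ 0 → |u| ≤ B)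
    {i : ℕ} (hi : i ∈ Finset.range n) :
    weight K n N t i ^ 2 ≤ N ^ 5 * B ^ 2 * moment K n N t 0 * K (t i) := by
  have h1 : K (t i) * (moment K n N t 2 - t i * moment K n N t 1) ^ 2 ≤
      N * (moment K n N t 2 * gap K n N t) := by
    rw [← sum_sq_residual hN.ne']
    exact Finset.single_le_sum
      (f := fun i => K (t i) * (moment K n N t 2 - t i * moment K n N t 1) ^ 2)
      (fun j _ => mul_nonneg (hK _) (sq_nonneg _)) hi
  have h2 := gap_div_sq_le (n := n) (t := t) hK hN
  have h3 := abs_moment_le (n := n) (t := t) hK hN hB 2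
  have h4 := moment_two_nonneg (n := n) (t := t) hK hN.le
  rw [abs_of_nonneg h4] at h3
  have h5 := gap_add_ridge_pos (n := n) (t := t) hK hN
  calc weight K n N t i ^ 2
      = K (t i) * (K (t i) * (moment K n N t 2 - t i * moment K n N t 1) ^ 2) /
        (gap K n N t + (N ^ 4)⁻¹) ^ 2 := by rw [weight, div_pow]; ring
    _ ≤ K (t i) * (N * (moment K n N t 2 * gap K n N t)) / (gap K n N t + (N ^ 4)⁻¹) ^ 2 := by
        have := hK (t i)
        gcongr
    _ = K (t i) * N * moment K n N t 2 *
        (gap K n N t / (gap K n N t + (N ^ 4)⁻¹) ^ 2) := by ring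
    _ ≤ K (t i) * N * (B ^ 2 * moment K n N t 0) * N ^ 4 := by
        have := hK (t i)
        have := moment_zero_nonneg (n := n) (t := t) hK hN.le
        gcongr
        exact div_nonneg (gap_nonneg hK hN) (sq_nonneg _)
    _ = _ := by ring

/-- A bound on the weighted mean of bounded responses, valid for every configuration of the
design points. -/
lemma sq_sum_weight_mul_le (hK : ∀ u, 0 ≤ K u) (hN : 0 < N) (hB : ∀ u, K u ≠ 0 → |u| ≤ B)
    {M : ℝ} {y : ℕ → ℝ} (hy : ∀ i, K (t i) ≠ 0 → |y i| ≤ M) :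
    ((∑ i ∈ Finset.range n, weight K n N t i * y i) / N) ^ 2 ≤
      N ^ 4 * B ^ 2 * M ^ 2 * moment K n N t 0 ^ 2 := by
  have h5 := gap_add_ridge_pos (n := n) (t := t) hK hN
  set d := gap K n N t + (N ^ 4)⁻¹ with hd
  have cs := Finset.sum_sq_le_sum_mul_sum_of_sq_le_mul (Finset.range n)
    (r := fun i => weight K n N t i * y i)
    (f := fun i => K (t i) * (moment K n N t 2 - t i * moment K n N t 1) ^ 2)
    (g := fun i => K (t i) * y i ^ 2 / d ^ 2)
    (fun i _ => mul_nonneg (hK _) (sq_nonneg _))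
    (fun i _ => div_nonneg (mul_nonneg (hK _) (sq_nonneg _)) (sq_nonneg _))
    (fun i _ => le_of_eq (by simp only [weight]; rw [← hd]; field_simp))
  rw [sum_sq_residual hN.ne', ← Finset.sum_div] at cs
  have h6 : ∑ i ∈ Finset.range n, K (t i) * y i ^ 2 ≤ M ^ 2 * (N * moment K n N t 0) := by
    rw [← sum_pow_mul hN.ne', Finset.mul_sum]
    refine Finset.sum_le_sum fun i _ => ?_
    by_cases h0 : K (t i) = 0
    · simp [h0]
    · have := sq_le_sq' (abs_le.1 (hy i h0)).1 (abs_le.1 (hy i h0)).2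
      rw [pow_zero, one_mul, mul_comm]
      exact mul_le_mul_of_nonneg_right this (hK _)
  have h2 := gap_div_sq_le (n := n) (t := t) hK hN
  rw [← hd] at h2
  have h3 := abs_moment_le (n := n) (t := t) hK hN hB 2
  have h4 := moment_two_nonneg (n := n) (t := t) hK hN.le
  have h7 := moment_zero_nonneg (n := n) (t := t) hK hN.le
  have h8 := gap_nonneg (n := n) (t := t) hK hN
  rw [abs_of_nonneg h4] at h3
  rw [div_pow, div_le_iff₀ (by positivity)]
  calc _ ≤ _ := cs
    _ ≤ N * (moment K n N t 2 * gap K n N t) * (M ^ 2 * (N * moment K n N t 0) / d ^ 2) := by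
        gcongr
    _ = N ^ 2 * moment K n N t 2 * M ^ 2 * moment K n N t 0 * (gap K n N t / d ^ 2) := by ring
    _ ≤ N ^ 2 * (B ^ 2 * moment K n N t 0) * M ^ 2 * moment K n N t 0 * N ^ 4 := by
        gcongr
    _ = _ := by ring

/-- The estimator in normalised form. Substituting `z - X i = h * t i` turns the ridge `n⁻²` of the
denominator into `h² N² · N⁻⁴` with `N = n h`. -/
lemma estimator_eq {h z : ℝ} {X Y : ℕ → ℝ} (hh : 0 < h) (hn : 0 < n) :
    estimator K h n X Y z =
      (∑ i ∈ Finset.range n, weight K n (n * h) (fun i => (z - X i) / h) i * Y i) / (n * h) := by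
  have hn' : (0 : ℝ) < n := by exact_mod_cast hn
  have hN : (n : ℝ) * h ≠ 0 := by positivity
  set t : ℕ → ℝ := fun i => (z - X i) / h with ht
  have hX : ∀ i, z - X i = h * t i := fun i => by simp only [ht]; field_simp
  have hS : ∀ l, S K h n X l z = h ^ l * ((n * h) * moment K n (n * h) t l) := fun l => by
    rw [← sum_pow_mul hN, S, Finset.mul_sum, Finset.mul_sum]
    refine Finset.sum_congr rfl fun i _ => ?_
    rw [scaledKernel, show (z - X i) / h = t i from rfl, hX, mul_pow]
    field_simp
  have hT : ∀ l, T K h n X Y l z =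
      h ^ l * ∑ i ∈ Finset.range n, t i ^ l * K (t i) * Y i := fun l => by
    rw [T, Finset.mul_sum, Finset.mul_sum]
    refine Finset.sum_congr rfl fun i _ => ?_
    rw [scaledKernel, show (z - X i) / h = t i from rfl, hX, mul_pow]
    field_simp
  have hsum : ∑ i ∈ Finset.range n, weight K n (n * h) t i * Y i =
      (moment K n (n * h) t 2 * (∑ i ∈ Finset.range n, t i ^ 0 * K (t i) * Y i)
        - moment K n (n * h) t 1 * (∑ i ∈ Finset.range n, t i ^ 1 * K (t i) * Y i)) /
        (gap K n (n * h) t + ((n * h) ^ 4)⁻¹) := by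
    rw [Finset.mul_sum, Finset.mul_sum, ← Finset.sum_sub_distrib, Finset.sum_div]
    refine Finset.sum_congr rfl fun i _ => ?_
    rw [weight]; ring
  rw [estimator, hS, hS, hS, hT, hT, hsum]
  have hden : h ^ 0 * (n * h * moment K n (n * h) t 0) * (h ^ 2 * (n * h * moment K n (n * h) t 2))
      - h ^ 1 * (n * h * moment K n (n * h) t 1) * (h ^ 1 * (n * h * moment K n (n * h) t 1))
      + 1 / (n : ℝ) ^ 2 =
      h ^ 2 * (n * h) ^ 2 * (gap K n (n * h) t + ((n * h) ^ 4)⁻¹) := by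
    rw [gap]; field_simp
  rw [hden]
  generalize ∑ i ∈ Finset.range n, t i ^ 0 * K (t i) * Y i = τ0
  generalize ∑ i ∈ Finset.range n, t i ^ 1 * K (t i) * Y i = τ1
  generalize gap K n (n * h) t + ((n * h) ^ 4)⁻¹ = d
  rcases eq_or_ne d 0 with rfl | hd
  · simp
  · field_simp

/-- The event on which the normal equations are well conditioned: the design points carry kernel
mass at least `θ` on both sides of the estimation point, at distance at least `a`. Only lower
bounds are required, so that the complement is exponentially unlikely even for an unbounded
kernel. -/
def Balanced (K : ℝ → ℝ) (a θ : ℝ) (n : ℕ) (N : ℝ) (t : ℕ → ℝ) : Prop :=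
  θ ≤ localMean n N t ((Set.Ici a).indicator K) ∧
    θ ≤ localMean n N t ((Set.Iic (-a)).indicator K)

lemma Balanced.le_moment_zero {a θ : ℝ} (hG : Balanced K a θ n N t) (hK : ∀ u, 0 ≤ K u)
    (hN : 0 < N) : θ ≤ moment K n N t 0 := by
  rw [moment_zero]
  exact hG.1.trans (localMean_mono hN.le fun u => Set.indicator_le_self' (fun _ _ => hK _) u)

lemma Balanced.le_gap {a θ : ℝ} (hG : Balanced K a θ n N t) (hK : ∀ u, 0 ≤ K u)
    (hN : 0 < N) (ha : 0 < a) (hθ : 0 < θ) : a ^ 2 * θ * moment K n N t 0 ≤ gap K n N t := by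
  have hp0 : 0 < moment K n N t 0 := hθ.trans_le (hG.le_moment_zero hK hN)
  have key : ∀ s : Set ℝ, θ ≤ localMean n N t (s.indicator K) →
      (∀ u ∈ s, (a * moment K n N t 0) ^ 2 ≤ (moment K n N t 1 - u * moment K n N t 0) ^ 2) →
      a ^ 2 * θ * moment K n N t 0 ≤ gap K n N t := by
    intro s hs hsq
    have h1 : ∑ i ∈ Finset.range n, s.indicator K (t i) * (a * moment K n N t 0) ^ 2 ≤
        ∑ i ∈ Finset.range n, K (t i) * (moment K n N t 1 - t i * moment K n N t 0) ^ 2 := by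
      refine Finset.sum_le_sum fun i _ => ?_
      by_cases hi : t i ∈ s
      · rw [Set.indicator_of_mem hi]
        exact mul_le_mul_of_nonneg_left (hsq _ hi) (hK _)
      · rw [Set.indicator_of_notMem hi, zero_mul]
        exact mul_nonneg (hK _) (sq_nonneg _)
    have h2 : ∑ i ∈ Finset.range n, s.indicator K (t i) =
        N * localMean n N t (s.indicator K) := by rw [localMean]; field_simp
    rw [sum_sq_affine hN.ne', ← Finset.sum_mul, h2] at h1
    have h3 : N * moment K n N t 0 * (a ^ 2 * θ * moment K n N t 0) ≤
        N * moment K n N t 0 * gap K n N t := by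
      calc N * moment K n N t 0 * (a ^ 2 * θ * moment K n N t 0)
          = N * θ * (a * moment K n N t 0) ^ 2 := by ring
        _ ≤ N * localMean n N t (s.indicator K) * (a * moment K n N t 0) ^ 2 := by gcongr
        _ ≤ _ := h1
        _ = _ := by rw [gap]; ring
    exact le_of_mul_le_mul_left h3 (by positivity)
  have hap : 0 < a * moment K n N t 0 := by positivity
  rcases le_total (moment K n N t 1) 0 with h | h
  · refine key _ hG.1 fun u hu => ?_
    have hu' : a * moment K n N t 0 ≤ u * moment K n N t 0 :=
      mul_le_mul_of_nonneg_right hu hp0.le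
    nlinarith
  · refine key _ hG.2 fun u hu => ?_
    have hu' : u * moment K n N t 0 ≤ -a * moment K n N t 0 :=
      mul_le_mul_of_nonneg_right hu hp0.le
    nlinarith

lemma abs_residual_le (hK : ∀ u, 0 ≤ K u) (hN : 0 < N) (hB : ∀ u, K u ≠ 0 → |u| ≤ B)
    {u : ℝ} (hu : |u| ≤ B) :
    |moment K n N t 2 - u * moment K n N t 1| ≤ 2 * B ^ 2 * moment K n N t 0 := by
  have h1 := abs_moment_le (n := n) (t := t) hK hN hB 1
  have h2 := abs_moment_le (n := n) (t := t) hK hN hB 2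
  have h3 : |u * moment K n N t 1| ≤ B * (B ^ 1 * moment K n N t 0) := by
    rw [abs_mul]; exact mul_le_mul hu h1 (abs_nonneg _) ((abs_nonneg u).trans hu)
  refine (abs_sub _ _).trans ?_
  linarith

/-- On a balanced design the weights are dominated by the kernel, with a constant that does not
depend on the size of the kernel mass. -/
lemma Balanced.abs_weight_le {a θ : ℝ} (hG : Balanced K a θ n N t) (hK : ∀ u, 0 ≤ K u)
    (hN : 0 < N) (hB : ∀ u, K u ≠ 0 → |u| ≤ B) (ha : 0 < a) (hθ : 0 < θ) (i : ℕ) :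
    |weight K n N t i| ≤ 2 * B ^ 2 / (a ^ 2 * θ) * K (t i) := by
  by_cases h0 : K (t i) = 0
  · simp [weight, h0]
  have hp0 : 0 < moment K n N t 0 := hθ.trans_le (hG.le_moment_zero hK hN)
  have hd := hG.le_gap hK hN ha hθ
  have hκ := ridge_pos hN
  have h1 := abs_residual_le (n := n) (t := t) hK hN hB (hB _ h0)
  have hd' : 0 < gap K n N t + (N ^ 4)⁻¹ := gap_add_ridge_pos hK hN
  rw [weight, abs_div, abs_mul, abs_of_nonneg (hK _), abs_of_pos hd', div_le_iff₀ hd']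
  calc K (t i) * |moment K n N t 2 - t i * moment K n N t 1|
      ≤ K (t i) * (2 * B ^ 2 * moment K n N t 0) := mul_le_mul_of_nonneg_left h1 (hK _)
    _ = 2 * B ^ 2 / (a ^ 2 * θ) * K (t i) * (a ^ 2 * θ * moment K n N t 0) := by field_simp
    _ ≤ _ := by
        have := hK (t i)
        gcongr
        linarith

/-- Bias of the weighted mean on a balanced design: a response which is quadratic in the design
point up to an error `ω` is reproduced up to the usual curvature term `b₂ ν`. -/
lemma exists_sq_bias_le {a θ : ℝ} (hK : ∀ u, 0 ≤ K u) (hB : ∀ u, K u ≠ 0 → |u| ≤ B)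
    (ha : 0 < a) (hθ : 0 < θ) (hB0 : 0 ≤ B) (ν : ℝ) :
    ∃ C, 0 ≤ C ∧ ∀ (n : ℕ) (N : ℝ) (t y : ℕ → ℝ) (s b₀ b₁ b₂ ω : ℝ), 0 < N →
      Balanced K a θ n N t → 0 ≤ ω →
      (∀ i, K (t i) ≠ 0 → |y i - (b₀ + b₁ * (s - t i) + b₂ * (s - t i) ^ 2)| ≤ ω) →
      ((∑ i ∈ Finset.range n, weight K n N t i * y i) / N - (b₀ + b₁ * s + b₂ * s ^ 2)
          - b₂ * ν) ^ 2 ≤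
        C * ((b₀ + b₁ * s + b₂ * s ^ 2) ^ 2 * ((N ^ 4)⁻¹) ^ 2
          + b₂ ^ 2 * ((moment K n N t 2 - ν * moment K n N t 0) ^ 2 + moment K n N t 1 ^ 2
            + ((N ^ 4)⁻¹) ^ 2)
          + ω ^ 2 * moment K n N t 0 ^ 2) := by
  set c := (a ^ 2 * θ)⁻¹ with hc
  have hc0 : 0 < c := by positivity
  -- `L` dominates every coefficient in the five-term decomposition of the bias.
  set L := c * (θ⁻¹ + B ^ 2 + (B ^ 3 + |ν| * B) + |ν| * θ⁻¹ + 2 * B ^ 2) with hL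
  have hL0 : 0 ≤ L := by positivity
  refine ⟨5 * L ^ 2, by positivity, fun n N t y s b₀ b₁ b₂ ω hN hG hω hy => ?_⟩
  have hp0 : 0 < moment K n N t 0 := hθ.trans_le (hG.le_moment_zero hK hN)
  have hθp := hG.le_moment_zero hK hN
  have hd := hG.le_gap hK hN ha hθ
  have hκ := ridge_pos hN
  have hd' : 0 < gap K n N t + (N ^ 4)⁻¹ := gap_add_ridge_pos hK hN
  have m1 := abs_moment_le (n := n) (t := t) hK hN hB 1
  have m2 := abs_moment_le (n := n) (t := t) hK hN hB 2
  have m3 := abs_moment_le (n := n) (t := t) hK hN hB 3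
  have w0 := sum_weight_mul_pow (K := K) (n := n) (t := t) hN.ne' 0
  have w1 := sum_weight_mul_pow (K := K) (n := n) (t := t) hN.ne' 1
  have w2 := sum_weight_mul_pow (K := K) (n := n) (t := t) hN.ne' 2
  have hw := fun i => hG.abs_weight_le hK hN hB ha hθ i
  have hsumK := sum_pow_mul (K := K) (n := n) (t := t) hN.ne' 0
  have hgap : gap K n N t = moment K n N t 0 * moment K n N t 2 - moment K n N t 1 ^ 2 := rfl
  norm_num only [pow_zero, mul_one, one_mul, pow_one] at w0 w1 w2 m1 hsumK
  set p0 := moment K n N t 0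
  set p1 := moment K n N t 1
  set p2 := moment K n N t 2
  set p3 := moment K n N t 3
  set κ := (N ^ 4)⁻¹
  set d := gap K n N t
  set S := b₀ + b₁ * s + b₂ * s ^ 2 with hS
  set ρ := (∑ i ∈ Finset.range n,
    weight K n N t i * (y i - (b₀ + b₁ * (s - t i) + b₂ * (s - t i) ^ 2))) / N with hρ
  have hinv : p0 / (d + κ) ≤ c := by
    rw [div_le_iff₀ hd', hc, inv_mul_eq_div, le_div_iff₀ (by positivity)]
    linarith
  have hinv' : 1 / (d + κ) ≤ c * θ⁻¹ := by
    have : 1 / (d + κ) = p0 / (d + κ) * p0⁻¹ := by field_simp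
    rw [this]
    exact mul_le_mul hinv (inv_anti₀ hθ hθp) (by positivity) hc0.le
  have hdecomp : (∑ i ∈ Finset.range n, weight K n N t i * y i) / N - S - b₂ * ν =
      -(S * κ) * (1 / (d + κ)) + b₂ * (p2 * (p2 - ν * p0)) / (d + κ)
        + b₂ * (-p1 * (p3 - ν * p1)) / (d + κ) + b₂ * (-(ν * κ)) * (1 / (d + κ)) + ρ := by
    have e : ∑ i ∈ Finset.range n, weight K n N t i * y i =
        S * (∑ i ∈ Finset.range n, weight K n N t i)
        - (b₁ + 2 * b₂ * s) * (∑ i ∈ Finset.range n, weight K n N t i * t i)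
        + b₂ * (∑ i ∈ Finset.range n, weight K n N t i * t i ^ 2) + N * ρ := by
      rw [hρ, mul_div_cancel₀ _ hN.ne']
      simp only [Finset.mul_sum, ← Finset.sum_sub_distrib, ← Finset.sum_add_distrib]
      refine Finset.sum_congr rfl fun i _ => ?_
      rw [hS]; ring
    rw [e, w0, w1, w2]
    have : p2 * p0 - p1 * p1 = d := by rw [hgap]; ring
    rw [this]
    field_simp
    rw [hgap]
    ring
  have hρ' : |ρ| ≤ L * (ω * p0) := by
    have : |ρ| ≤ 2 * B ^ 2 * c * (ω * p0) := by
      rw [hρ, abs_div, abs_of_pos hN, div_le_iff₀ hN]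
      calc _ ≤ ∑ i ∈ Finset.range n, |weight K n N t i *
              (y i - (b₀ + b₁ * (s - t i) + b₂ * (s - t i) ^ 2))| :=
            Finset.abs_sum_le_sum_abs _ _
        _ ≤ ∑ i ∈ Finset.range n, 2 * B ^ 2 * c * ω * K (t i) := by
            refine Finset.sum_le_sum fun i _ => ?_
            rw [abs_mul]
            by_cases h0 : K (t i) = 0
            · simp [weight, h0]
            · calc _ ≤ 2 * B ^ 2 / (a ^ 2 * θ) * K (t i) * ω :=
                    mul_le_mul (hw i) (hy i h0) (abs_nonneg _)
                      (mul_nonneg (by positivity) (hK _))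
                _ = _ := by rw [hc]; ring
        _ = _ := by rw [← Finset.mul_sum, hsumK]; ring
    refine this.trans (mul_le_mul_of_nonneg_right ?_ (by positivity))
    have : 0 ≤ c * (θ⁻¹ + B ^ 2 + (B ^ 3 + |ν| * B) + |ν| * θ⁻¹) := by positivity
    rw [hL]; linarith
  have ha1 : |-(S * κ) * (1 / (d + κ))| ≤ L * (|S| * κ) := by
    rw [abs_mul, abs_neg, abs_mul, abs_of_pos hκ, abs_of_pos (by positivity : 0 < 1 / (d + κ)),
      mul_comm]
    refine mul_le_mul_of_nonneg_right (hinv'.trans ?_) (by positivity)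
    have : 0 ≤ c * (B ^ 2 + (B ^ 3 + |ν| * B) + |ν| * θ⁻¹ + 2 * B ^ 2) := by positivity
    rw [hL]; linarith
  have ha2 : |b₂ * (p2 * (p2 - ν * p0)) / (d + κ)| ≤ L * (|b₂| * |p2 - ν * p0|) := by
    rw [abs_div, abs_mul, abs_mul, abs_of_pos hd']
    calc _ ≤ |b₂| * (B ^ 2 * p0 * |p2 - ν * p0|) / (d + κ) := by gcongr
      _ = B ^ 2 * (p0 / (d + κ)) * (|b₂| * |p2 - ν * p0|) := by ring
      _ ≤ B ^ 2 * c * (|b₂| * |p2 - ν * p0|) := by gcongr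
      _ ≤ _ := by
        refine mul_le_mul_of_nonneg_right ?_ (by positivity)
        have : 0 ≤ c * (θ⁻¹ + (B ^ 3 + |ν| * B) + |ν| * θ⁻¹ + 2 * B ^ 2) := by positivity
        rw [hL]; linarith
  have ha3 : |b₂ * (-p1 * (p3 - ν * p1)) / (d + κ)| ≤ L * (|b₂| * |p1|) := by
    have : |p3 - ν * p1| ≤ (B ^ 3 + |ν| * B) * p0 := by
      refine (abs_sub _ _).trans ?_
      rw [abs_mul]
      have := mul_le_mul_of_nonneg_left m1 (abs_nonneg ν)
      linarith
    rw [abs_div, abs_mul, abs_mul, abs_neg, abs_of_pos hd']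
    calc _ ≤ |b₂| * (|p1| * ((B ^ 3 + |ν| * B) * p0)) / (d + κ) := by gcongr
      _ = (B ^ 3 + |ν| * B) * (p0 / (d + κ)) * (|b₂| * |p1|) := by ring
      _ ≤ (B ^ 3 + |ν| * B) * c * (|b₂| * |p1|) := by gcongr
      _ ≤ _ := by
        refine mul_le_mul_of_nonneg_right ?_ (by positivity)
        have : 0 ≤ c * (θ⁻¹ + B ^ 2 + |ν| * θ⁻¹ + 2 * B ^ 2) := by positivity
        rw [hL]; linarith
  have ha4 : |b₂ * (-(ν * κ)) * (1 / (d + κ))| ≤ L * (|b₂| * κ) := by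
    rw [abs_mul, abs_mul, abs_neg, abs_mul, abs_of_pos hκ,
      abs_of_pos (by positivity : 0 < 1 / (d + κ))]
    calc _ ≤ |b₂| * (|ν| * κ) * (c * θ⁻¹) := by gcongr
      _ = c * (|ν| * θ⁻¹) * (|b₂| * κ) := by ring
      _ ≤ _ := by
        refine mul_le_mul_of_nonneg_right ?_ (by positivity)
        have : 0 ≤ c * (θ⁻¹ + B ^ 2 + (B ^ 3 + |ν| * B) + 2 * B ^ 2) := by positivity
        rw [hL]; linarith
  rw [hdecomp]
  have sqle : ∀ {u v : ℝ}, |u| ≤ v → u ^ 2 ≤ v ^ 2 := fun h =>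
    sq_le_sq' (abs_le.1 h).1 (abs_le.1 h).2
  have q1 := sqle ha1
  have q2 := sqle ha2
  have q3 := sqle ha3
  have q4 := sqle ha4
  have q5 := sqle hρ'
  simp only [mul_pow, sq_abs] at q1 q2 q3 q4 q5
  refine (sq_add_five_le _ _ _ _ _).trans ?_
  linarith only [q1, q2, q3, q4, q5]

/-- On a balanced design the weights are close to `K(tᵢ) / f`, in a form that stays bounded when
the moments are far from their limits. -/
lemma exists_sq_weight_sub_le {a θ f : ℝ} (hK : ∀ u, 0 ≤ K u) (hB : ∀ u, K u ≠ 0 → |u| ≤ B)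
    (ha : 0 < a) (hθ : 0 < θ) (hB0 : 0 ≤ B) (hf : 0 < f) :
    ∃ C, 0 ≤ C ∧ ∀ (n : ℕ) (N : ℝ) (t : ℕ → ℝ), 0 < N → Balanced K a θ n N t → ∀ i,
      (weight K n N t i - K (t i) / f) ^ 2 ≤ K (t i) ^ 2 *
        min C (C * ((moment K n N t 0 - f) ^ 2 + moment K n N t 1 ^ 2 + ((N ^ 4)⁻¹) ^ 2)) := by
  set c := (a ^ 2 * θ)⁻¹ with hc
  have hc0 : 0 < c := by positivity
  set L := c * (B ^ 2 * f⁻¹ + (B * θ⁻¹ + B * f⁻¹) + f⁻¹ * θ⁻¹) with hL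
  have hL0 : 0 ≤ L := by positivity
  set M := 2 * B ^ 2 / (a ^ 2 * θ) + f⁻¹ with hM
  have hM0 : 0 ≤ M := by positivity
  refine ⟨max (M ^ 2) (3 * L ^ 2), by positivity, fun n N t hN hG i => ?_⟩
  by_cases h0 : K (t i) = 0
  · simp [weight, h0]
  have hKi := hK (t i)
  have hti := hB _ h0
  have hw := hG.abs_weight_le hK hN hB ha hθ i
  have hp0 : 0 < moment K n N t 0 := hθ.trans_le (hG.le_moment_zero hK hN)
  have hθp := hG.le_moment_zero hK hN
  have hd := hG.le_gap hK hN ha hθ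
  have hκ := ridge_pos hN
  have hd' : 0 < gap K n N t + (N ^ 4)⁻¹ := gap_add_ridge_pos hK hN
  have m1 := abs_moment_le (n := n) (t := t) hK hN hB 1
  have m2 := abs_moment_le (n := n) (t := t) hK hN hB 2
  have hgap : gap K n N t = moment K n N t 0 * moment K n N t 2 - moment K n N t 1 ^ 2 := rfl
  have hwdef : weight K n N t i = K (t i) * (moment K n N t 2 - t i * moment K n N t 1) /
    (gap K n N t + (N ^ 4)⁻¹) := rfl
  rw [pow_one] at m1
  set p0 := moment K n N t 0
  set p1 := moment K n N t 1
  set p2 := moment K n N t 2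
  set κ := (N ^ 4)⁻¹
  set d := gap K n N t
  have hinv : p0 / (d + κ) ≤ c := by
    rw [div_le_iff₀ hd', hc, inv_mul_eq_div, le_div_iff₀ (by positivity)]
    linarith
  have hinv' : 1 / (d + κ) ≤ c * θ⁻¹ := by
    have : 1 / (d + κ) = p0 / (d + κ) * p0⁻¹ := by field_simp
    rw [this]
    exact mul_le_mul hinv (inv_anti₀ hθ hθp) (by positivity) hc0.le
  have sqle : ∀ {u v : ℝ}, |u| ≤ v → u ^ 2 ≤ v ^ 2 := fun h =>
    sq_le_sq' (abs_le.1 h).1 (abs_le.1 h).2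
  have b1 : |weight K n N t i - K (t i) / f| ≤ K (t i) * M := by
    refine (abs_sub _ _).trans ?_
    rw [abs_of_nonneg (by positivity : 0 ≤ K (t i) / f), hM, mul_add, div_eq_mul_inv (K (t i))]
    linarith
  have e : weight K n N t i - K (t i) / f = K (t i) * (-(p2 * f⁻¹ * (p0 - f)) / (d + κ)
      + (p1 * f⁻¹ * p1 / (d + κ) - t i * p1 * (1 / (d + κ))) - κ * f⁻¹ * (1 / (d + κ))) := by
    rw [hwdef]
    field_simp
    rw [hgap]
    ring
  have t1 : |-(p2 * f⁻¹ * (p0 - f)) / (d + κ)| ≤ L * |p0 - f| := by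
    rw [abs_div, abs_neg, abs_mul, abs_mul, abs_of_pos hd', abs_of_pos (inv_pos.2 hf)]
    calc _ ≤ B ^ 2 * p0 * f⁻¹ * |p0 - f| / (d + κ) := by gcongr
      _ = B ^ 2 * f⁻¹ * (p0 / (d + κ)) * |p0 - f| := by ring
      _ ≤ B ^ 2 * f⁻¹ * c * |p0 - f| := by gcongr
      _ ≤ _ := by
        refine mul_le_mul_of_nonneg_right ?_ (abs_nonneg _)
        have : 0 ≤ c * ((B * θ⁻¹ + B * f⁻¹) + f⁻¹ * θ⁻¹) := by positivity
        rw [hL]; linarith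
  have t2 : |p1 * f⁻¹ * p1 / (d + κ) - t i * p1 * (1 / (d + κ))| ≤ L * |p1| := by
    refine (abs_sub _ _).trans ?_
    rw [abs_div, abs_mul, abs_mul, abs_mul, abs_mul, abs_of_pos hd', abs_of_pos (inv_pos.2 hf),
      abs_of_pos (by positivity : 0 < 1 / (d + κ))]
    calc _ ≤ B * p0 * f⁻¹ * |p1| / (d + κ) + B * |p1| * (c * θ⁻¹) := by gcongr
      _ = B * f⁻¹ * (p0 / (d + κ)) * |p1| + B * |p1| * (c * θ⁻¹) := by ring
      _ ≤ B * f⁻¹ * c * |p1| + B * |p1| * (c * θ⁻¹) := by gcongr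
      _ = c * (B * θ⁻¹ + B * f⁻¹) * |p1| := by ring
      _ ≤ _ := by
        refine mul_le_mul_of_nonneg_right ?_ (abs_nonneg _)
        have : 0 ≤ c * (B ^ 2 * f⁻¹ + f⁻¹ * θ⁻¹) := by positivity
        rw [hL]; linarith
  have t3 : |κ * f⁻¹ * (1 / (d + κ))| ≤ L * κ := by
    rw [abs_of_pos (by positivity)]
    calc _ ≤ κ * f⁻¹ * (c * θ⁻¹) := by gcongr
      _ = c * (f⁻¹ * θ⁻¹) * κ := by ring
      _ ≤ _ := by
        refine mul_le_mul_of_nonneg_right ?_ hκ.le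
        have : 0 ≤ c * (B ^ 2 * f⁻¹ + (B * θ⁻¹ + B * f⁻¹)) := by positivity
        rw [hL]; linarith
  rw [mul_min_of_nonneg _ _ (sq_nonneg _)]
  refine le_min ?_ ?_
  · refine (sqle b1).trans ?_
    rw [mul_pow]
    exact mul_le_mul_of_nonneg_left (le_max_left _ _) (sq_nonneg _)
  · rw [e, mul_pow]
    refine mul_le_mul_of_nonneg_left ((sq_add_sub_le _ _ _).trans ?_) (sq_nonneg _)
    have q1 := sqle t1
    have q2 := sqle t2
    have q3 := sqle t3
    simp only [mul_pow, sq_abs] at q1 q2 q3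
    calc _ ≤ 3 * L ^ 2 * ((p0 - f) ^ 2 + p1 ^ 2 + κ ^ 2) := by linarith
      _ ≤ _ := mul_le_mul_of_nonneg_right (le_max_right _ _) (by positivity)

end Deterministic

/-! ### The sample: independence and change of variables -/

section Sample

variable {Ω : Type*} [MeasurableSpace Ω] {P : Measure Ω}
  {X ε : ℕ → Ω → ℝ} {f : ℝ → ℝ}

lemma IsSample.iIndepFun_X (hs : IsSample P X ε f) : iIndepFun X P :=
  hs.indep.comp (fun _ p => p.1) fun _ => measurable_fst

lemma IsSample.identDistrib_X (hs : IsSample P X ε f) (i : ℕ) :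
    IdentDistrib (X i) (X 0) P P :=
  (hs.identDistrib i).comp measurable_fst

lemma IsSample.identDistrib_noise (hs : IsSample P X ε f) (i : ℕ) :
    IdentDistrib (ε i) (ε 0) P P :=
  (hs.identDistrib i).comp measurable_snd

lemma IsSample.map_X (hs : IsSample P X ε f) (i : ℕ) :
    P.map (X i) = volume.withDensity (fun y => ENNReal.ofReal (f y)) :=
  (hs.identDistrib_X i).map_eq.trans hs.law_X

/-- The variance of a variable without second moment is `0` by convention, so unit variance implies
square integrability. -/
lemma IsSample.memLp_noise [IsProbabilityMeasure P] (hs : IsSample P X ε f) (i : ℕ) :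
    MemLp (ε i) 2 P := by
  refine (hs.identDistrib_noise i).symm.memLp_snd ?_
  by_contra hnot
  have := variance_of_not_memLp (hs.measurable_ε 0).aestronglyMeasurable hnot
  rw [hs.variance_noise] at this
  exact one_ne_zero this

lemma IsSample.integral_noise (hs : IsSample P X ε f) (i : ℕ) : ∫ ω, ε i ω ∂P = 0 :=
  (hs.identDistrib_noise i).integral_eq.trans hs.mean_noise

lemma IsSample.integral_noise_sq [IsProbabilityMeasure P] (hs : IsSample P X ε f) (i : ℕ) :
    ∫ ω, ε i ω ^ 2 ∂P = 1 := by
  have h := variance_eq_sub (hs.memLp_noise i)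
  rw [(hs.identDistrib_noise i).variance_eq, hs.variance_noise, hs.integral_noise] at h
  simpa using h.symm

/-- A pair of independent variables, indexed by `Bool`, is an independent family. -/
lemma iIndepFun_cond_of_indepFun [IsProbabilityMeasure P] {U V : Ω → ℝ} (h : IndepFun U V P) :
    iIndepFun (fun b : Bool => cond b U V) P := by
  rw [iIndepFun_iff_measure_inter_preimage_eq_mul]
  intro S s hs
  have h2 := h.measure_inter_preimage_eq_mul
  by_cases ht : true ∈ S <;> by_cases hf : false ∈ S
  · have : S = Finset.univ := by ext b; cases b <;> simp [ht, hf]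
    subst this
    have := h2 _ _ (hs true (by simp)) (hs false (by simp))
    have e : (⋂ i ∈ (Finset.univ : Finset Bool), (cond i U V) ⁻¹' s i) =
        U ⁻¹' s true ∩ V ⁻¹' s false := by
      ext ω; simp [and_comm]
    rw [e]
    simpa using this
  · have : S = {true} := by ext b; cases b <;> simp [ht, hf]
    subst this; simp
  · have : S = {false} := by ext b; cases b <;> simp [ht, hf]
    subst this; simp
  · have : S = ∅ := by ext b; cases b <;> simp [ht, hf]
    subst this; simp

/-- The sequence of design points is independent of the sequence of errors, and all errors are
independent: the whole array of the `Xᵢ` and `εᵢ` is an independent family. -/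
lemma IsSample.iIndepFun_array [IsProbabilityMeasure P] (hs : IsSample P X ε f) :
    iIndepFun (fun (p : ℕ × Bool) => cond p.2 (X p.1) (ε p.1)) P := by
  have h := iIndepFun_uncurry' (P := P) (X := fun (i : ℕ) (b : Bool) => cond b (X i) (ε i))
    (fun i b => by cases b; exacts [hs.measurable_ε i, hs.measurable_X i]) ?_
    (fun i => iIndepFun_cond_of_indepFun
      (indepFun_of_identDistrib_pair hs.indep_noise (hs.identDistrib i).symm))
  · exact h
  · have := hs.indep.comp (fun _ (p : ℝ × ℝ) (b : Bool) => cond b p.1 p.2) fun _ => by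
      refine measurable_pi_iff.2 fun b => ?_
      cases b
      exacts [measurable_snd, measurable_fst]
    convert this using 3 with i ω
    funext b
    cases b <;> rfl

lemma IsSample.indepFun_design_noise [IsProbabilityMeasure P] (hs : IsSample P X ε f) :
    IndepFun (fun ω i => X i ω) (fun ω i => ε i ω) P := by
  have h := indep_iSup_of_disjoint (fun p => by
      rcases p with ⟨i, _ | _⟩
      exacts [(hs.measurable_ε i).comap_le, (hs.measurable_X i).comap_le])
    hs.iIndepFun_array.iIndep
    (S := {p | p.2 = true}) (T := {p | p.2 = false})
    (Set.disjoint_left.2 fun p h1 h2 => by simp_all)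
  rw [IndepFun_iff_Indep]
  refine indep_of_indep_of_le_left (indep_of_indep_of_le_right h ?_) ?_
  · simp only [MeasurableSpace.pi, MeasurableSpace.comap_iSup, MeasurableSpace.comap_comp]
    exact iSup_le fun i => le_iSup₂_of_le (i, false) rfl le_rfl
  · simp only [MeasurableSpace.pi, MeasurableSpace.comap_iSup, MeasurableSpace.comap_comp]
    exact iSup_le fun i => le_iSup₂_of_le (i, true) rfl le_rfl

lemma IsSample.iIndepFun_noise (hs : IsSample P X ε f) : iIndepFun ε P :=
  hs.indep.comp (fun _ p => p.2) fun _ => measurable_snd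

/-- The scaled positions `(x - Xᵢ) / h` of the design points, seen from `x`. -/
noncomputable def scaledDesign (X : ℕ → Ω → ℝ) (x h : ℝ) (ω : Ω) (i : ℕ) : ℝ :=
  (x - X i ω) / h

lemma IsSample.measurable_scaledDesign (hs : IsSample P X ε f) (x h : ℝ) (i : ℕ) :
    Measurable fun ω => scaledDesign X x h ω i :=
  ((hs.measurable_X i).const_sub x).div_const h

lemma IsSample.iIndepFun_scaledDesign (hs : IsSample P X ε f) (x h : ℝ) :
    iIndepFun (fun i ω => scaledDesign X x h ω i) P :=
  hs.iIndepFun_X.comp (fun _ y => (x - y) / h) fun _ => by fun_prop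

/-- Change of variables: `(x - Xᵢ) / h` has density `t ↦ h f(x - h t)`. -/
lemma IsSample.integral_scaledDesign (hs : IsSample P X ε f) (i : ℕ) (x : ℝ) {h : ℝ}
    (hh : 0 < h) {ψ : ℝ → ℝ} (hψ : Measurable ψ) :
    ∫ ω, ψ (scaledDesign X x h ω i) ∂P = h * ∫ t, ψ t * f (x - h * t) := by
  have h1 : ∫ ω, ψ (scaledDesign X x h ω i) ∂P = ∫ y, ψ ((x - y) / h) ∂(P.map (X i)) := by
    rw [integral_map (hs.measurable_X i).aemeasurable]
    · rfl
    · exact (hψ.comp (by fun_prop)).aestronglyMeasurable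
  rw [h1, hs.map_X, integral_withDensity_eq_integral_toReal_smul
    hs.measurable_f.ennreal_ofReal (by simp)]
  have h2 : ∀ y, (ENNReal.ofReal (f y)).toReal • ψ ((x - y) / h) =
      (fun u => ψ (u / h) * f (x - u)) (x - y) := fun y => by
    simp only [ENNReal.toReal_ofReal (hs.f_nonneg y), smul_eq_mul, sub_sub_cancel, mul_comm]
  simp_rw [h2]
  rw [integral_sub_left_eq_self (fun u => ψ (u / h) * f (x - u)) volume x]
  have h3 := Measure.integral_comp_div (fun t => ψ t * f (x - h * t)) h
  rw [abs_of_pos hh, smul_eq_mul] at h3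
  rw [← h3]
  refine integral_congr_ae (ae_of_all _ fun u => ?_)
  simp only
  rw [mul_div_cancel₀ u hh.ne']

lemma IsSample.integrable_scaledDesign (hs : IsSample P X ε f) (i : ℕ) (x : ℝ) {h : ℝ}
    (hh : 0 < h) {ψ : ℝ → ℝ}
    (hint : Integrable fun t => ψ t * f (x - h * t)) :
    Integrable (fun ω => ψ (scaledDesign X x h ω i)) P := by
  have h1 : Integrable (fun y => ψ ((x - y) / h)) (P.map (X i)) := by
    rw [hs.map_X, integrable_withDensity_iff_integrable_smul'
      hs.measurable_f.ennreal_ofReal (by simp)]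
    have h2 : ∀ y, (ENNReal.ofReal (f y)).toReal • ψ ((x - y) / h) =
        (fun u => ψ (u / h) * f (x - u)) (x - y) := fun y => by
      simp only [ENNReal.toReal_ofReal (hs.f_nonneg y), smul_eq_mul, sub_sub_cancel, mul_comm]
    simp_rw [h2]
    refine Integrable.comp_sub_left (f := fun u => ψ (u / h) * f (x - u)) ?_ x
    have h3 := hint.comp_mul_left' (inv_ne_zero hh.ne')
    refine h3.congr (ae_of_all _ fun u => ?_)
    simp only
    rw [mul_inv_cancel_left₀ hh.ne', inv_mul_eq_div]
  exact h1.comp_measurable (hs.measurable_X i)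

end Sample

/-- The kernel localises: integrating `G` against the rescaled `φ` picks out `G x`. -/
lemma tendsto_integral_mul_comp {φ G : ℝ → ℝ} {x : ℝ} {h : ℕ → ℝ} (hφ : Integrable φ)
    (hc : HasCompactSupport φ) (hG : Measurable G) (hGx : ContinuousAt G x)
    (hh : Tendsto h atTop (𝓝 0)) :
    (∀ᶠ n in atTop, Integrable fun t => φ t * G (x - h n * t)) ∧
      Tendsto (fun n => ∫ t, φ t * G (x - h n * t)) atTop (𝓝 (G x * ∫ t, φ t)) := by
  obtain ⟨B, hB⟩ := hc.isCompact.isBounded.exists_norm_le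
  have hbd : ∀ᶠ n in atTop, ∀ t, ‖φ t * G (x - h n * t)‖ ≤ (|G x| + 1) * ‖φ t‖ := by
    obtain ⟨ρ, hρ, hball⟩ := Metric.eventually_nhds_iff.1
      (hGx.abs.eventually_lt continuousAt_const (lt_add_one _))
    have hhB : Tendsto (fun n => |h n| * |B|) atTop (𝓝 0) := by simpa using hh.abs.mul_const |B|
    filter_upwards [hhB.eventually_lt_const hρ] with n hn t
    by_cases ht : φ t = 0
    · simp [ht]
    · have ht' := hB t (subset_tsupport _ ht)
      have : |G (x - h n * t)| < |G x| + 1 := hball (by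
        rw [Real.dist_eq, sub_sub_cancel_left, abs_neg, abs_mul]
        refine lt_of_le_of_lt ?_ hn
        exact mul_le_mul_of_nonneg_left (ht'.trans (le_abs_self B)) (abs_nonneg _))
      rw [norm_mul, mul_comm]
      exact mul_le_mul_of_nonneg_right this.le (norm_nonneg _)
  have hmeas : ∀ n, AEStronglyMeasurable (fun t => φ t * G (x - h n * t)) := fun n =>
    hφ.aestronglyMeasurable.mul (hG.comp (by fun_prop)).aestronglyMeasurable
  refine ⟨hbd.mono fun n hn => (hφ.norm.const_mul _).mono' (hmeas n) (ae_of_all _ hn), ?_⟩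
  have := tendsto_integral_filter_of_dominated_convergence (μ := volume) (l := atTop)
    (F := fun n t => φ t * G (x - h n * t)) (f := fun t => φ t * G x)
    (fun t => (|G x| + 1) * ‖φ t‖) (Eventually.of_forall hmeas)
    (hbd.mono fun n hn => ae_of_all _ hn) (hφ.norm.const_mul _) (ae_of_all _ fun t => ?_)
  · simpa only [integral_mul_const, mul_comm] using this
  · refine Tendsto.const_mul _ (hGx.tendsto.comp ?_)
    simpa using (hh.mul_const t).const_sub x

/-! ### Laws of large numbers for localised means -/

/-- A sequence of bandwidths: `h > 0`, `h → 0` and `n h → ∞`. -/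
structure IsBandwidth (h : ℕ → ℝ) : Prop where
  pos : ∀ n, 0 < h n
  tendsto_zero : Tendsto h atTop (𝓝 0)
  tendsto_mul : Tendsto (fun n : ℕ => (n : ℝ) * h n) atTop atTop

lemma IsBandwidth.eventually_pos {h : ℕ → ℝ} (hb : IsBandwidth h) :
    ∀ᶠ n : ℕ in atTop, 0 < n ∧ 0 < (n : ℝ) * h n := by
  filter_upwards [eventually_gt_atTop 0] with n hn
  exact ⟨hn, mul_pos (by exact_mod_cast hn) (hb.pos n)⟩

/-- `|W| ≤ η + W² / η`, which turns second moments into first moments. -/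
lemma abs_le_add_sq_div {η : ℝ} (hη : 0 < η) (W : ℝ) : |W| ≤ η + W ^ 2 / η := by
  rw [← sq_abs, ← sub_nonneg]
  have : η + |W| ^ 2 / η - |W| = ((η - |W|) ^ 2 + η * |W|) / η := by field_simp; ring
  rw [this]
  positivity

section Limits

variable {Ω : Type*} [MeasurableSpace Ω] {P : Measure Ω} {X ε : ℕ → Ω → ℝ} {f : ℝ → ℝ}
  {x : ℝ} {h : ℕ → ℝ}

lemma sub_mul_scaledDesign {Ω : Type*} {X : ℕ → Ω → ℝ} {x h : ℝ} (hh : h ≠ 0) (ω : Ω) (i : ℕ) :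
    x - h * scaledDesign X x h ω i = X i ω := by
  rw [scaledDesign, mul_div_cancel₀ _ hh, sub_sub_cancel]

/-- Localised expectations, with a weight `g` that is continuous at `x`. -/
lemma IsSample.tendsto_integral_weighted (hs : IsSample P X ε f) (hb : IsBandwidth h)
    (hf : ContinuousAt f x) {φ g : ℝ → ℝ} (hφm : Measurable φ) (hφ : Integrable φ)
    (hc : HasCompactSupport φ) (hg : Measurable g) (hgx : ContinuousAt g x) :
    (∀ᶠ n in atTop, ∀ i,
      Integrable (fun ω => φ (scaledDesign X x (h n) ω i) * g (X i ω)) P) ∧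
    Tendsto (fun n : ℕ => ∫ ω, (∑ i ∈ Finset.range n,
        φ (scaledDesign X x (h n) ω i) * g (X i ω)) / (n * h n) ∂P) atTop
      (𝓝 (f x * g x * ∫ t, φ t)) := by
  obtain ⟨h1, h2⟩ := tendsto_integral_mul_comp hφ hc (hg.mul hs.measurable_f) (hgx.mul hf)
    hb.tendsto_zero
  have hrw : ∀ n i ω, φ (scaledDesign X x (h n) ω i) * g (X i ω) =
      (fun t => φ t * g (x - h n * t)) (scaledDesign X x (h n) ω i) := fun n i ω => by
    simp only [sub_mul_scaledDesign (hb.pos n).ne']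
  have hint : ∀ᶠ n in atTop, ∀ i,
      Integrable (fun ω => φ (scaledDesign X x (h n) ω i) * g (X i ω)) P := by
    filter_upwards [h1] with n hn i
    refine (hs.integrable_scaledDesign i x (hb.pos n) (ψ := fun t => φ t * g (x - h n * t))
      (hn.congr (ae_of_all _ fun t => ?_))).congr (ae_of_all _ fun ω => (hrw n i ω).symm)
    simp only [Pi.mul_apply]; ring
  refine ⟨hint, ?_⟩
  rw [mul_comm (f x)]
  refine h2.congr' ?_
  filter_upwards [hint, eventually_gt_atTop 0] with n hn hn0
  have hn0' : (0 : ℝ) < n := by exact_mod_cast hn0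
  rw [integral_div, integral_finsetSum _ fun i _ => hn i]
  have : ∀ i, ∫ ω, φ (scaledDesign X x (h n) ω i) * g (X i ω) ∂P =
      h n * ∫ t, φ t * (g * f) (x - h n * t) := fun i => by
    rw [integral_congr_ae (ae_of_all _ fun ω => hrw n i ω),
      hs.integral_scaledDesign i x (hb.pos n) (ψ := fun t => φ t * g (x - h n * t))
        (hφm.mul (hg.comp (by fun_prop)))]
    congr 1
    refine integral_congr_ae (ae_of_all _ fun t => ?_)
    simp only [Pi.mul_apply]; ring
  simp only [this, Finset.sum_const, Finset.card_range, nsmul_eq_mul]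
  have := hb.pos n
  field_simp

lemma IsSample.tendsto_integral_localMean [IsProbabilityMeasure P] (hs : IsSample P X ε f)
    (hb : IsBandwidth h)
    (hf : ContinuousAt f x) {φ : ℝ → ℝ} (hφm : Measurable φ) (hφ : Integrable φ)
    (hc : HasCompactSupport φ) :
    (∀ᶠ n in atTop, ∀ i, Integrable (fun ω => φ (scaledDesign X x (h n) ω i)) P) ∧
    Tendsto (fun n : ℕ => ∫ ω, localMean n (n * h n) (scaledDesign X x (h n) ω) φ ∂P) atTop
      (𝓝 (f x * ∫ t, φ t)) := by
  simpa [localMean] using hs.tendsto_integral_weighted hb hf hφm hφ hc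
    (measurable_const (a := (1 : ℝ))) continuousAt_const

lemma integrable_of_memLp_two_of_hasCompactSupport {φ : ℝ → ℝ} (hφ : MemLp φ 2)
    (hc : HasCompactSupport φ) : Integrable φ := by
  have hφ' := (hφ.restrict (tsupport φ))
  have : IsFiniteMeasure (volume.restrict (tsupport φ)) :=
    ⟨by simpa using hc.isCompact.measure_lt_top⟩
  exact (integrableOn_iff_integrable_of_support_subset (subset_tsupport φ)).1
    (hφ'.integrable one_le_two)

lemma memLp_two_scaledDesign (hs : IsSample P X ε f) {φ : ℝ → ℝ} (hφm : Measurable φ)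
    {n : ℕ} {i : ℕ} (h2 : Integrable (fun ω => φ (scaledDesign X x (h n) ω i) ^ 2) P) :
    MemLp (fun ω => φ (scaledDesign X x (h n) ω i)) 2 P :=
  (memLp_two_iff_integrable_sq
    (hφm.comp (hs.measurable_scaledDesign x (h n) i)).aestronglyMeasurable).2 h2

/-- The `L²` law of large numbers for localised means. -/
lemma IsSample.tendsto_sq_localMean_sub [IsProbabilityMeasure P] (hs : IsSample P X ε f)
    (hb : IsBandwidth h) (hf : ContinuousAt f x) {φ : ℝ → ℝ} (hφm : Measurable φ)
    (hφ : MemLp φ 2) (hc : HasCompactSupport φ) :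
    (∀ᶠ n : ℕ in atTop, MemLp (fun ω => localMean n (n * h n) (scaledDesign X x (h n) ω) φ) 2 P) ∧
    Tendsto (fun n : ℕ => ∫ ω, (localMean n (n * h n) (scaledDesign X x (h n) ω) φ
      - f x * ∫ t, φ t) ^ 2 ∂P) atTop (𝓝 0) := by
  have hφ1 := integrable_of_memLp_two_of_hasCompactSupport hφ hc
  have hc2 : HasCompactSupport (fun t => φ t ^ 2) :=
    hc.comp_left (g := fun y : ℝ => y ^ 2) (by simp)
  obtain ⟨i1, l1⟩ := hs.tendsto_integral_localMean hb hf hφm hφ1 hc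
  obtain ⟨i2, l2⟩ := hs.tendsto_integral_localMean hb hf (hφm.pow_const 2) hφ.integrable_sq hc2
  have hV : ∀ᶠ n in atTop, ∀ i, MemLp (fun ω => φ (scaledDesign X x (h n) ω i)) 2 P :=
    i2.mono fun n hn i => memLp_two_scaledDesign hs hφm (hn i)
  have hZ : ∀ᶠ n : ℕ in atTop,
      MemLp (fun ω => localMean n (n * h n) (scaledDesign X x (h n) ω) φ) 2 P := by
    filter_upwards [hV] with n hn
    simp only [localMean, div_eq_inv_mul]
    exact (memLp_finsetSum _ fun i _ => hn i).const_mul _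
  refine ⟨hZ, ?_⟩
  have hbound : Tendsto (fun n : ℕ =>
      (∫ ω, localMean n (n * h n) (scaledDesign X x (h n) ω) (fun t => φ t ^ 2) ∂P)
          * ((n : ℝ) * h n)⁻¹
        + ((∫ ω, localMean n (n * h n) (scaledDesign X x (h n) ω) φ ∂P) - f x * ∫ t, φ t) ^ 2)
      atTop (𝓝 0) := by
    have := (l2.mul hb.tendsto_mul.inv_tendsto_atTop).add ((l1.sub_const (f x * ∫ t, φ t)).pow 2)
    simpa using this
  refine squeeze_zero' (Eventually.of_forall fun n => integral_nonneg fun ω => sq_nonneg _) ?_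
    hbound
  filter_upwards [hV, hZ, hb.eventually_pos, i2] with n hn hZn hn0 hi2
  set c := f x * ∫ t, φ t
  set Z : Ω → ℝ := fun ω => localMean n (n * h n) (scaledDesign X x (h n) ω) φ with hZdef
  have e1 := variance_eq_sub (hZn.sub (memLp_const c))
  have e2 : Var[Z - fun _ : Ω => c; P] = Var[Z; P] :=
    variance_sub_const hZn.aestronglyMeasurable c
  have e3 : ∫ ω, (Z - fun _ : Ω => c) ω ∂P = (∫ ω, Z ω ∂P) - c := by
    simp only [Pi.sub_apply]
    rw [integral_sub (hZn.integrable one_le_two) (integrable_const c)]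
    simp
  rw [e2, e3] at e1
  have e4 : Var[Z; P] ≤
      (∫ ω, localMean n (n * h n) (scaledDesign X x (h n) ω) (fun t => φ t ^ 2) ∂P)
          * ((n : ℝ) * h n)⁻¹ := by
    have hsum : Z = fun ω => ((n : ℝ) * h n)⁻¹ *
        (∑ i ∈ Finset.range n, fun ω => φ (scaledDesign X x (h n) ω i)) ω := by
      funext ω
      simp only [hZdef, localMean, div_eq_inv_mul, Finset.sum_apply]
    rw [hsum, variance_const_mul, IndepFun.variance_sum (fun i _ => hn i) fun i _ j _ hij =>
      ((hs.iIndepFun_scaledDesign x (h n)).indepFun hij).comp hφm hφm]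
    simp only [localMean]
    rw [integral_div, integral_finsetSum _ fun i _ => hi2 i]
    calc _ ≤ (((n : ℝ) * h n)⁻¹) ^ 2 * ∑ i ∈ Finset.range n,
          ∫ ω, φ (scaledDesign X x (h n) ω i) ^ 2 ∂P := by
          gcongr with i _
          exact variance_le_expectation_sq (hn i).aestronglyMeasurable
      _ = _ := by ring
  have e5 : ∫ ω, (Z ω - c) ^ 2 ∂P = ∫ ω, ((Z - fun _ : Ω => c) ^ 2) ω ∂P := by simp
  change ∫ ω, (Z ω - c) ^ 2 ∂P ≤ _
  rw [e5]
  linarith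

lemma eventually_integrable_localMean (hs : IsSample P X ε f) [IsProbabilityMeasure P]
    (hb : IsBandwidth h) (hf : ContinuousAt f x) {φ : ℝ → ℝ} (hφm : Measurable φ)
    (hφ : Integrable φ) (hc : HasCompactSupport φ) :
    ∀ᶠ n : ℕ in atTop,
      Integrable (fun ω => localMean n (n * h n) (scaledDesign X x (h n) ω) φ) P := by
  filter_upwards [(hs.tendsto_integral_localMean hb hf hφm hφ hc).1] with n hn
  exact (integrable_finsetSum _ fun i _ => hn i).div_const _

/-- The `L¹` law of large numbers for localised means, by approximation of `φ` in `L¹`. It is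
applied to `K²`, which need not be square integrable. -/
lemma IsSample.tendsto_abs_localMean_sub [IsProbabilityMeasure P] (hs : IsSample P X ε f)
    (hb : IsBandwidth h) (hf : ContinuousAt f x) {φ : ℝ → ℝ} (hφm : Measurable φ)
    (hφ : Integrable φ) (hc : HasCompactSupport φ) :
    Tendsto (fun n : ℕ => ∫ ω, |localMean n (n * h n) (scaledDesign X x (h n) ω) φ
      - f x * ∫ t, φ t| ∂P) atTop (𝓝 0) := by
  have hfx := hs.f_nonneg x
  rw [tendsto_order]
  refine ⟨fun a ha => Eventually.of_forall fun n =>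
    ha.trans_le (integral_nonneg fun _ => abs_nonneg _), fun η hη => ?_⟩
  obtain ⟨g, hgc, hgε, hgcont, hgi⟩ := hφ.exists_hasCompactSupport_integral_sub_le
    (ε := η / (8 * (f x + 1))) (by positivity)
  have hdi : Integrable fun t => |φ t - g t| := (hφ.sub hgi).abs
  have hdc : HasCompactSupport fun t => |φ t - g t| := (hc.sub hgc).abs
  have hdm : Measurable fun t => |φ t - g t| := (hφm.sub hgcont.measurable).norm
  have hD := (hs.tendsto_integral_localMean hb hf hdm hdi hdc).2
  have hG := hs.tendsto_sq_localMean_sub hb hf hgcont.measurable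
    (hgcont.memLp_of_hasCompactSupport hgc) hgc
  set D := ∫ t, |φ t - g t| with hDdef
  have hD0 : 0 ≤ D := integral_nonneg fun _ => abs_nonneg _
  have hDle : f x * D ≤ η / 8 := by
    have h1 : D ≤ η / (8 * (f x + 1)) := hgε
    calc f x * D ≤ (f x + 1) * (η / (8 * (f x + 1))) := by gcongr; linarith
      _ = η / 8 := by field_simp
  have hdiff : |f x * (∫ t, g t) - f x * ∫ t, φ t| ≤ η / 8 := by
    rw [← mul_sub, ← integral_sub hgi hφ, abs_mul, abs_of_nonneg hfx]
    refine le_trans (mul_le_mul_of_nonneg_left ?_ hfx) hDle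
    refine (abs_integral_le_integral_abs).trans (le_of_eq ?_)
    simp_rw [abs_sub_comm, hDdef]
  have h8 : (0 : ℝ) < η / 8 := by positivity
  filter_upwards [hD.eventually_lt_const (show f x * D < η / 4 by linarith),
    hG.2.eventually_lt_const (show (0 : ℝ) < (η / 8) * (η / 8) by positivity), hG.1,
    eventually_integrable_localMean hs hb hf hdm hdi hdc,
    eventually_integrable_localMean hs hb hf hφm hφ hc, hb.eventually_pos] with
    n hn1 hn2 hZ hint hintφ hpos
  set Z := fun ω => localMean n (n * h n) (scaledDesign X x (h n) ω) g
  have hsqi : Integrable (fun ω => (Z ω - f x * ∫ t, g t) ^ 2) P :=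
    (hZ.sub (memLp_const _)).integrable_sq
  have hle : ∀ ω, |localMean n (n * h n) (scaledDesign X x (h n) ω) φ - f x * ∫ t, φ t| ≤
      localMean n (n * h n) (scaledDesign X x (h n) ω) (fun t => |φ t - g t|)
        + (η / 4 + (Z ω - f x * ∫ t, g t) ^ 2 / (η / 8)) := fun ω => by
    have t1 : |localMean n (n * h n) (scaledDesign X x (h n) ω) φ - Z ω| ≤
        localMean n (n * h n) (scaledDesign X x (h n) ω) (fun t => |φ t - g t|) := by
      rw [← localMean_sub, localMean, localMean, abs_div, abs_of_pos hpos.2]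
      exact div_le_div_of_nonneg_right (Finset.abs_sum_le_sum_abs _ _) hpos.2.le
    have t2 := abs_le_add_sq_div h8 (Z ω - f x * ∫ t, g t)
    calc _ = |(localMean n (n * h n) (scaledDesign X x (h n) ω) φ - Z ω)
          + (Z ω - f x * ∫ t, g t) + (f x * (∫ t, g t) - f x * ∫ t, φ t)| := by ring_nf
      _ ≤ _ := abs_add_three _ _ _
      _ ≤ _ := by linarith
  have hri : Integrable (fun ω => η / 4 + (Z ω - f x * ∫ t, g t) ^ 2 / (η / 8)) P :=
    (integrable_const _).add (hsqi.div_const _)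
  refine (integral_mono (hintφ.sub (integrable_const _)).abs (hint.add hri) hle).trans_lt ?_
  have hval : ∫ ω, (η / 4 + (Z ω - f x * ∫ t, g t) ^ 2 / (η / 8)) ∂P =
      η / 4 + (∫ ω, (Z ω - f x * ∫ t, g t) ^ 2 ∂P) / (η / 8) := by
    rw [integral_add (integrable_const _) (hsqi.div_const _)]
    simp [integral_div]
  rw [integral_add' hint hri, hval]
  have hn3 : (∫ ω, (Z ω - f x * ∫ t, g t) ^ 2 ∂P) / (η / 8) < η / 8 := by
    rw [div_lt_iff₀ h8]; exact hn2
  linarith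

/-- Multiplying a localised mean by a bounded factor that tends to zero in mean makes its
expectation vanish, although the two need not be independent. -/
lemma IsSample.tendsto_integral_localMean_mul [IsProbabilityMeasure P] (hs : IsSample P X ε f)
    (hb : IsBandwidth h) (hf : ContinuousAt f x) {φ : ℝ → ℝ} (hφm : Measurable φ)
    (hφ : Integrable φ) (hc : HasCompactSupport φ) {Ψ : ℕ → Ω → ℝ} {C : ℝ}
    (hΨm : ∀ n, Measurable (Ψ n)) (hΨ0 : ∀ n ω, 0 ≤ Ψ n ω) (hΨC : ∀ n ω, Ψ n ω ≤ C)
    (hΨ : Tendsto (fun n => ∫ ω, Ψ n ω ∂P) atTop (𝓝 0)) :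
    (∀ᶠ n : ℕ in atTop, Integrable
      (fun ω => localMean n (n * h n) (scaledDesign X x (h n) ω) φ * Ψ n ω) P) ∧
    Tendsto (fun n : ℕ =>
      ∫ ω, localMean n (n * h n) (scaledDesign X x (h n) ω) φ * Ψ n ω ∂P) atTop (𝓝 0) := by
  have hI := eventually_integrable_localMean hs hb hf hφm hφ hc
  have hΨi : ∀ n, Integrable (Ψ n) P := fun n =>
    Integrable.of_bound (hΨm n).aestronglyMeasurable C (ae_of_all _ fun ω => by
      rw [Real.norm_of_nonneg (hΨ0 n ω)]; exact hΨC n ω)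
  have hI2 : ∀ᶠ n : ℕ in atTop, Integrable
      (fun ω => localMean n (n * h n) (scaledDesign X x (h n) ω) φ * Ψ n ω) P := by
    filter_upwards [hI] with n hn
    exact hn.mul_bdd (c := C) (hΨm n).aestronglyMeasurable (ae_of_all _ fun ω => by
      rw [Real.norm_of_nonneg (hΨ0 n ω)]; exact hΨC n ω)
  refine ⟨hI2, ?_⟩
  set c := f x * ∫ t, φ t
  have hlim : Tendsto (fun n : ℕ =>
      C * (∫ ω, |localMean n (n * h n) (scaledDesign X x (h n) ω) φ - c| ∂P)
        + |c| * ∫ ω, Ψ n ω ∂P) atTop (𝓝 0) := by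
    simpa using ((hs.tendsto_abs_localMean_sub hb hf hφm hφ hc).const_mul C).add
      (hΨ.const_mul |c|)
  refine squeeze_zero_norm' ?_ hlim
  filter_upwards [hI, hI2] with n hn hn2
  have hai : Integrable
      (fun ω => |localMean n (n * h n) (scaledDesign X x (h n) ω) φ - c|) P :=
    (hn.sub (integrable_const c)).abs
  rw [← integral_const_mul, ← integral_const_mul,
    ← integral_add (hai.const_mul C) ((hΨi n).const_mul |c|)]
  refine norm_integral_le_of_norm_le ((hai.const_mul C).add ((hΨi n).const_mul |c|))
    (ae_of_all _ fun ω => ?_)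
  have e : localMean n (n * h n) (scaledDesign X x (h n) ω) φ * Ψ n ω =
      (localMean n (n * h n) (scaledDesign X x (h n) ω) φ - c) * Ψ n ω + c * Ψ n ω := by ring
  rw [e]
  refine (norm_add_le _ _).trans ?_
  simp only [norm_mul, Real.norm_eq_abs, abs_of_nonneg (hΨ0 n ω)]
  have := mul_le_mul_of_nonneg_left (hΨC n ω)
    (abs_nonneg (localMean n (n * h n) (scaledDesign X x (h n) ω) φ - c))
  linarith

end Limits

/-! ### Lower tails of localised means -/

/-- Exponential tilting decouples from at most two factors at a time: removing from the exponent
the (nonnegative) terms with index `i`, `j` leaves a variable independent of `φ(Zᵢ) φ(Zⱼ)`. This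
needs no moments of `φ(Zᵢ)` beyond the second. -/
lemma integral_sq_sum_mul_exp_le {Ω : Type*} [MeasurableSpace Ω] {P : Measure Ω}
    [IsProbabilityMeasure P] {Z : ℕ → Ω → ℝ}
    (hZ : iIndepFun Z P) (hZm : ∀ i, Measurable (Z i)) {φ ψ : ℝ → ℝ} (hφm : Measurable φ)
    (hψm : Measurable ψ) (hφ0 : ∀ u, 0 ≤ φ u) (hψ0 : ∀ u, 0 ≤ ψ u)
    (hφ : ∀ i, MemLp (fun ω => φ (Z i ω)) 2 P) {ρ : ℝ}
    (hρ : ∀ i, ∫ ω, Real.exp (-ψ (Z i ω)) ∂P ≤ ρ) (hρ1 : ρ ≤ 1) (n : ℕ) :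
    ∫ ω, (∑ i ∈ Finset.range n, φ (Z i ω)) ^ 2 *
        Real.exp (-∑ i ∈ Finset.range n, ψ (Z i ω)) ∂P ≤
      (∫ ω, (∑ i ∈ Finset.range n, φ (Z i ω)) ^ 2 ∂P) * ρ ^ (n - 2) := by
  have hρ0 : 0 ≤ ρ := (integral_nonneg fun _ => (Real.exp_pos _).le).trans (hρ 0)
  have hφφ : ∀ i j, Integrable (fun ω => φ (Z i ω) * φ (Z j ω)) P := fun i j =>
    (hφ i).integrable_mul (hφ j)
  have hexpm : ∀ s : Finset ℕ, Measurable fun ω => Real.exp (-∑ i ∈ s, ψ (Z i ω)) := fun s =>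
    (Finset.measurable_fun_sum _ fun i _ => hψm.comp (hZm i)).neg.exp
  have hexp1 : ∀ (s : Finset ℕ) ω, Real.exp (-∑ i ∈ s, ψ (Z i ω)) ≤ 1 := fun s ω =>
    Real.exp_le_one_iff.2 (neg_nonpos.2 (Finset.sum_nonneg fun _ _ => hψ0 _))
  have hint : ∀ (s : Finset ℕ) i j, Integrable (fun ω => φ (Z i ω) * φ (Z j ω) *
      Real.exp (-∑ i ∈ s, ψ (Z i ω))) P := fun s i j =>
    (hφφ i j).mul_bdd (c := 1) (hexpm s).aestronglyMeasurable (ae_of_all _ fun ω => by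
      rw [Real.norm_of_nonneg (Real.exp_pos _).le]; exact hexp1 s ω)
  have hprod : ∀ s : Finset ℕ, ∫ ω, Real.exp (-∑ i ∈ s, ψ (Z i ω)) ∂P ≤ ρ ^ s.card := by
    intro s
    have h1 := (hZ.comp (fun _ => ψ) fun _ => hψm).mgf_sum (t := -1)
      (fun i => hψm.comp (hZm i)) s
    simp only [mgf, Function.comp_def, Finset.sum_apply, neg_one_mul] at h1
    rw [h1, ← Finset.prod_const]
    exact Finset.prod_le_prod (fun i _ => integral_nonneg fun _ => (Real.exp_pos _).le)
      fun i _ => hρ i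
  have hterm : ∀ i j, ∫ ω, φ (Z i ω) * φ (Z j ω) *
      Real.exp (-∑ i ∈ Finset.range n, ψ (Z i ω)) ∂P ≤
      (∫ ω, φ (Z i ω) * φ (Z j ω) ∂P) * ρ ^ (n - 2) := by
    intro i j
    set s := Finset.range n \ {i, j} with hs
    have hcard : n - 2 ≤ s.card := by
      have h1 := Finset.le_card_sdiff ({i, j} : Finset ℕ) (Finset.range n)
      have h2 : ({i, j} : Finset ℕ).card ≤ 2 := Finset.card_le_two
      rw [Finset.card_range, ← hs] at h1
      omega
    have hind : IndepFun (fun ω => φ (Z i ω) * φ (Z j ω))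
        (fun ω => Real.exp (-∑ k ∈ s, ψ (Z k ω))) P := by
      have h0 := hZ.indepFun_finset {i, j} s (by
        rw [hs]; exact Finset.disjoint_sdiff) hZm
      have h1 := h0.comp
        (φ := fun v : ({i, j} : Finset ℕ) → ℝ => φ (v ⟨i, by simp⟩) * φ (v ⟨j, by simp⟩))
        (ψ := fun v : s → ℝ => Real.exp (-∑ k, ψ (v k)))
        ((hφm.comp (measurable_pi_apply _)).mul (hφm.comp (measurable_pi_apply _)))
        (Finset.measurable_fun_sum _ fun k _ => hψm.comp (measurable_pi_apply k)).neg.exp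
      refine h1.congr (ae_of_all _ fun ω => rfl) (ae_of_all _ fun ω => ?_)
      simp only [Function.comp_apply]
      rw [Finset.sum_coe_sort s fun k => ψ (Z k ω)]
    calc _ ≤ ∫ ω, φ (Z i ω) * φ (Z j ω) * Real.exp (-∑ k ∈ s, ψ (Z k ω)) ∂P := by
          refine integral_mono (hint _ i j) (hint s i j) fun ω => ?_
          refine mul_le_mul_of_nonneg_left (Real.exp_le_exp.2 (neg_le_neg ?_))
            (mul_nonneg (hφ0 _) (hφ0 _))
          exact Finset.sum_le_sum_of_subset_of_nonneg Finset.sdiff_subset fun _ _ _ => hψ0 _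
      _ = (∫ ω, φ (Z i ω) * φ (Z j ω) ∂P) * ∫ ω, Real.exp (-∑ k ∈ s, ψ (Z k ω)) ∂P :=
          hind.integral_fun_mul_eq_mul_integral (hφφ i j).aestronglyMeasurable
            (hexpm s).aestronglyMeasurable
      _ ≤ _ := by
          refine mul_le_mul_of_nonneg_left ((hprod s).trans ?_)
            (integral_nonneg fun ω => mul_nonneg (hφ0 _) (hφ0 _))
          exact pow_le_pow_of_le_one hρ0 hρ1 hcard
  have hsq : ∀ ω, (∑ i ∈ Finset.range n, φ (Z i ω)) ^ 2 =
      ∑ i ∈ Finset.range n, ∑ j ∈ Finset.range n, φ (Z i ω) * φ (Z j ω) := fun ω => by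
    rw [sq, Finset.sum_mul_sum]
  simp only [hsq, Finset.sum_mul]
  rw [integral_finsetSum _ fun i _ => integrable_finsetSum _ fun j _ => hint _ i j,
    integral_finsetSum _ fun i _ => integrable_finsetSum _ fun j _ => hφφ i j, Finset.sum_mul]
  refine Finset.sum_le_sum fun i _ => ?_
  rw [integral_finsetSum _ fun j _ => hint _ i j, integral_finsetSum _ fun j _ => hφφ i j,
    Finset.sum_mul]
  exact Finset.sum_le_sum fun j _ => hterm i j

lemma exp_neg_le_one_sub_add_sq {y : ℝ} (hy : 0 ≤ y) : Real.exp (-y) ≤ 1 - y + y ^ 2 := by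
  have h1 := Real.add_one_le_exp y
  rw [Real.exp_neg]
  calc (Real.exp y)⁻¹ ≤ (y + 1)⁻¹ := inv_anti₀ (by positivity) h1
    _ ≤ 1 - y + y ^ 2 := by
      rw [inv_le_iff_one_le_mul₀ (by positivity)]
      nlinarith [pow_nonneg hy 3]

section LowerTail

variable {Ω : Type*} [MeasurableSpace Ω] {P : Measure Ω} [IsProbabilityMeasure P]
  {X ε : ℕ → Ω → ℝ} {f : ℝ → ℝ} {x : ℝ} {h : ℕ → ℝ}

lemma IsSample.exists_integral_sq_localMean_le (hs : IsSample P X ε f)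
    (hb : IsBandwidth h) (hf : ContinuousAt f x) {φ : ℝ → ℝ} (hφm : Measurable φ)
    (hφ : MemLp φ 2) (hc : HasCompactSupport φ) :
    ∃ M, 0 ≤ M ∧ ∀ᶠ n : ℕ in atTop,
      ∫ ω, localMean n (n * h n) (scaledDesign X x (h n) ω) φ ^ 2 ∂P ≤ M := by
  obtain ⟨h1, h2⟩ := hs.tendsto_sq_localMean_sub hb hf hφm hφ hc
  set c := f x * ∫ t, φ t
  refine ⟨2 + 2 * c ^ 2, by positivity, ?_⟩
  filter_upwards [h1, h2.eventually_lt_const one_pos] with n hn1 hn2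
  have hi : Integrable (fun ω =>
      (localMean n (n * h n) (scaledDesign X x (h n) ω) φ - c) ^ 2) P :=
    (hn1.sub (memLp_const c)).integrable_sq
  calc _ ≤ ∫ ω, (2 * (localMean n (n * h n) (scaledDesign X x (h n) ω) φ - c) ^ 2
        + 2 * c ^ 2) ∂P := by
        refine integral_mono hn1.integrable_sq ((hi.const_mul 2).add (integrable_const _))
          fun ω => ?_
        simp only
        nlinarith [sq_nonneg (localMean n (n * h n) (scaledDesign X x (h n) ω) φ - 2 * c)]
    _ ≤ _ := by
        rw [integral_add (hi.const_mul 2) (integrable_const _), integral_const_mul]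
        simp
        linarith

lemma tendsto_pow_mul_exp_neg (p : ℕ) {c : ℝ} (hc : 0 < c) :
    Tendsto (fun y : ℝ => y ^ p * Real.exp (-(c * y))) atTop (𝓝 0) := by
  refine (isLittleO_pow_exp_pos_mul_atTop p hc).tendsto_div_nhds_zero.congr fun y => ?_
  rw [Real.exp_neg, div_eq_mul_inv]

/-- The lower tail of a localised mean of a nonnegative function decays faster than every power
of `n h`, even after multiplication by the square of another localised mean. -/
lemma IsSample.tendsto_pow_mul_lowerTail (hs : IsSample P X ε f)
    (hb : IsBandwidth h) (hf : ContinuousAt f x) (hfx : 0 < f x) {φ ψ : ℝ → ℝ}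
    (hφm : Measurable φ) (hφ : MemLp φ 2) (hφc : HasCompactSupport φ) (hφ0 : ∀ u, 0 ≤ φ u)
    (hψm : Measurable ψ) (hψ : MemLp ψ 2) (hψc : HasCompactSupport ψ) (hψ0 : ∀ u, 0 ≤ ψ u)
    (hμ : 0 < ∫ t, ψ t) (p : ℕ) :
    Tendsto (fun n : ℕ => ((n : ℝ) * h n) ^ p * ∫ ω, Set.indicator
      {ω | localMean n (n * h n) (scaledDesign X x (h n) ω) ψ < f x * (∫ t, ψ t) / 2}
      (fun ω => 1 + localMean n (n * h n) (scaledDesign X x (h n) ω) φ ^ 2) ω ∂P)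
      atTop (𝓝 0) := by
  have hψc2 : HasCompactSupport (fun t => ψ t ^ 2) :=
    hψc.comp_left (g := fun y : ℝ => y ^ 2) (by simp)
  have hψ1 := integrable_of_memLp_two_of_hasCompactSupport hψ hψc
  obtain ⟨i1, l1⟩ := hs.tendsto_integral_localMean hb hf hψm hψ1 hψc
  obtain ⟨i2, l2⟩ := hs.tendsto_integral_localMean hb hf (hψm.pow_const 2) hψ.integrable_sq hψc2
  obtain ⟨M, hM0, hM⟩ := hs.exists_integral_sq_localMean_le hb hf hφm hφ hφc
  have hφL := (hs.tendsto_sq_localMean_sub hb hf hφm hφ hφc).1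
  have hφi := (hs.tendsto_integral_localMean hb hf (hφm.pow_const 2) hφ.integrable_sq
    (hφc.comp_left (g := fun y : ℝ => y ^ 2) (by simp))).1
  set μ := ∫ t, ψ t with hμdef
  set μ2 := ∫ t, ψ t ^ 2 with hμ2def
  have hμ2 : 0 ≤ μ2 := integral_nonneg fun _ => sq_nonneg _
  set θ := f x * μ / 2 with hθ
  set c := f x * μ / 8 with hc
  have hθ0 : 0 < θ := by positivity
  have hc0 : 0 < c := by positivity
  -- The tilting parameter is so small that the quadratic term costs at most a quarter of the mean.
  set l := μ / (4 * (μ2 + 1)) with hl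
  have hl0 : 0 < l := by positivity
  have hlim : Tendsto (fun n : ℕ =>
      (∫ ω, localMean n (n * h n) (scaledDesign X x (h n) ω) ψ ∂P)
      - l * ∫ ω, localMean n (n * h n) (scaledDesign X x (h n) ω) (fun t => ψ t ^ 2) ∂P)
      atTop (𝓝 (f x * μ - l * (f x * μ2))) := l1.sub (l2.const_mul l)
  have hlt : θ + c < f x * μ - l * (f x * μ2) := by
    have h1 : l * μ2 ≤ μ / 4 := by
      rw [hl, div_mul_eq_mul_div, div_le_div_iff₀ (by positivity) (by positivity)]
      nlinarith
    have h2 : l * (f x * μ2) ≤ f x * (μ / 4) := by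
      calc _ = f x * (l * μ2) := by ring
        _ ≤ _ := mul_le_mul_of_nonneg_left h1 hfx.le
    have : 0 < f x * μ := by positivity
    rw [hθ, hc]; linarith
  have hfinal : Tendsto (fun n : ℕ => Real.exp (2 * l * (θ + c)) * (1 + M) *
      (((n : ℝ) * h n) ^ p * Real.exp (-(l * c * (n * h n))))) atTop (𝓝 0) := by
    simpa using ((tendsto_pow_mul_exp_neg p (mul_pos hl0 hc0)).comp hb.tendsto_mul).const_mul
      (Real.exp (2 * l * (θ + c)) * (1 + M))
  refine squeeze_zero' ?_ ?_ hfinal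
  · filter_upwards [hb.eventually_pos] with n hn
    have := hn.2
    refine mul_nonneg (by positivity) (integral_nonneg fun ω => ?_)
    exact Set.indicator_nonneg (fun _ _ => by positivity) _
  filter_upwards [i1, i2, hM, hφL, hφi, hb.eventually_pos, hlim.eventually_const_lt hlt,
    hb.tendsto_zero.eventually_le_const (zero_lt_one' ℝ)] with
    n hi1 hi2 hMn hφn hφin hpos hltn hh1
  have hh := hb.pos n
  have hn0 : (0 : ℝ) < n := by exact_mod_cast hpos.1
  have hNpos := hpos.2
  -- `ρ` bounds the Laplace transform of a single summand.
  set ρ := Real.exp (-(l * (θ + c) * h n)) with hρ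
  have hρ1 : ρ ≤ 1 := Real.exp_le_one_iff.2 (neg_nonpos.2 (by positivity))
  have hlap : ∀ i, ∫ ω, Real.exp (-(l * ψ (scaledDesign X x (h n) ω i))) ∂P ≤ ρ := by
    intro i
    have hexpi : Integrable (fun ω => Real.exp (-(l * ψ (scaledDesign X x (h n) ω i)))) P := by
      refine Integrable.of_bound
        ((hψm.comp (hs.measurable_scaledDesign x (h n) i)).const_mul l).neg.exp.aestronglyMeasurable
        1 (ae_of_all _ fun ω => ?_)
      rw [Real.norm_of_nonneg (Real.exp_pos _).le]
      exact Real.exp_le_one_iff.2 (neg_nonpos.2 (mul_nonneg hl0.le (hψ0 _)))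
    have hm : ∀ g : ℝ → ℝ, Measurable g →
        (∀ i, Integrable (fun ω => g (scaledDesign X x (h n) ω i)) P) →
        ∫ ω, g (scaledDesign X x (h n) ω i) ∂P =
        h n * ∫ ω, localMean n (n * h n) (scaledDesign X x (h n) ω) g ∂P := by
      intro g hg hgi
      simp only [localMean]
      rw [integral_div, integral_finsetSum _ fun j _ => hgi j]
      simp only [hs.integral_scaledDesign _ x hh hg, Finset.sum_const, Finset.card_range,
        nsmul_eq_mul]
      field_simp
    have h1 := hm ψ hψm hi1
    have h2 := hm _ (hψm.pow_const 2) hi2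
    have hA : Integrable (fun ω => 1 - l * ψ (scaledDesign X x (h n) ω i)) P :=
      (integrable_const _).sub ((hi1 i).const_mul l)
    calc _ ≤ ∫ ω, (1 - l * ψ (scaledDesign X x (h n) ω i)
          + l ^ 2 * ψ (scaledDesign X x (h n) ω i) ^ 2) ∂P := by
          refine integral_mono hexpi (hA.add ((hi2 i).const_mul (l ^ 2))) fun ω => ?_
          have := exp_neg_le_one_sub_add_sq
            (mul_nonneg hl0.le (hψ0 (scaledDesign X x (h n) ω i)))
          rwa [mul_pow] at this
      _ = 1 - l * ((∫ ω, localMean n (n * h n) (scaledDesign X x (h n) ω) ψ ∂P)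
            - l * ∫ ω, localMean n (n * h n) (scaledDesign X x (h n) ω)
              (fun t => ψ t ^ 2) ∂P) * h n := by
          rw [integral_add hA ((hi2 i).const_mul (l ^ 2)), integral_sub (integrable_const _)
            ((hi1 i).const_mul l), integral_const_mul, integral_const_mul, h1, h2]
          simp
          ring
      _ ≤ 1 - l * (θ + c) * h n := by
          gcongr
      _ ≤ ρ := by
          have := Real.add_one_le_exp (-(l * (θ + c) * h n))
          rw [hρ]; linarith
  have hindep := hs.iIndepFun_scaledDesign x (h n)
  have hmZ := fun i => hs.measurable_scaledDesign x (h n) i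
  have hlψ0 : ∀ u, 0 ≤ l * ψ u := fun u => mul_nonneg hl0.le (hψ0 u)
  have hE1 := integral_sq_sum_mul_exp_le hindep hmZ hφm (hψm.const_mul l) hφ0 hlψ0
    (fun i => memLp_two_scaledDesign hs hφm (hφin i)) hlap hρ1 n
  have hE0 : ∫ ω, Real.exp (-∑ i ∈ Finset.range n, l * ψ (scaledDesign X x (h n) ω i)) ∂P ≤
      ρ ^ (n - 2) := by
    have h1 := (hindep.comp (fun _ u => l * ψ u) fun _ => hψm.const_mul l).mgf_sum (t := -1)
      (fun i => (hψm.const_mul l).comp (hmZ i)) (Finset.range n)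
    simp only [mgf, Function.comp_def, Finset.sum_apply, neg_one_mul] at h1
    rw [h1]
    calc _ ≤ ∏ i ∈ Finset.range n, ρ :=
          Finset.prod_le_prod (fun i _ => integral_nonneg fun _ => (Real.exp_pos _).le)
            fun i _ => hlap i
      _ = ρ ^ n := by simp
      _ ≤ _ := pow_le_pow_of_le_one (Real.exp_pos _).le hρ1 (Nat.sub_le _ _)
  -- The factor `exp (l θ n h)` of the Chernoff bound is beaten by `ρ ^ (n - 2)`.
  have hρpow : Real.exp (l * θ * (n * h n)) * ρ ^ (n - 2) ≤
      Real.exp (2 * l * (θ + c)) * Real.exp (-(l * c * (n * h n))) := by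
    rw [hρ, ← Real.exp_nat_mul, ← Real.exp_add, ← Real.exp_add]
    refine Real.exp_le_exp.2 ?_
    have hsub : (n : ℝ) - 2 ≤ ((n - 2 : ℕ) : ℝ) := by
      have : n ≤ (n - 2) + 2 := by omega
      have : (n : ℝ) ≤ ((n - 2 : ℕ) : ℝ) + 2 := by exact_mod_cast this
      linarith
    have h3 : ((n : ℝ) - 2) * (l * (θ + c) * h n) ≤ ((n - 2 : ℕ) : ℝ) * (l * (θ + c) * h n) :=
      mul_le_mul_of_nonneg_right hsub (by positivity)
    have h4 : l * (θ + c) * h n ≤ l * (θ + c) * 1 := by gcongr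
    linarith
  set E := fun ω => Real.exp (-∑ i ∈ Finset.range n, l * ψ (scaledDesign X x (h n) ω i))
    with hEdef
  have hEm : Measurable E :=
    (Finset.measurable_fun_sum _ fun i _ => (hψm.const_mul l).comp (hmZ i)).neg.exp
  have hEle : ∀ ω, E ω ≤ 1 := fun ω =>
    Real.exp_le_one_iff.2 (neg_nonpos.2 (Finset.sum_nonneg fun _ _ => hlψ0 _))
  have hEi : Integrable E P := Integrable.of_bound hEm.aestronglyMeasurable 1
    (ae_of_all _ fun ω => by rw [Real.norm_of_nonneg (Real.exp_pos _).le]; exact hEle ω)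
  set W := fun ω => localMean n (n * h n) (scaledDesign X x (h n) ω) φ with hW
  have hWE : Integrable (fun ω => W ω ^ 2 * E ω) P :=
    hφn.integrable_sq.mul_bdd (c := 1) hEm.aestronglyMeasurable
      (ae_of_all _ fun ω => by rw [Real.norm_of_nonneg (Real.exp_pos _).le]; exact hEle ω)
  have hWE' : ∫ ω, W ω ^ 2 * E ω ∂P ≤ M * ρ ^ (n - 2) := by
    have e1 : ∀ ω, W ω ^ 2 * E ω = (((n : ℝ) * h n) ^ 2)⁻¹ *
        ((∑ i ∈ Finset.range n, φ (scaledDesign X x (h n) ω i)) ^ 2 * E ω) := fun ω => by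
      rw [hW]; simp only [localMean]; rw [div_pow]; ring
    have e2 : ∀ ω, W ω ^ 2 = (((n : ℝ) * h n) ^ 2)⁻¹ *
        (∑ i ∈ Finset.range n, φ (scaledDesign X x (h n) ω i)) ^ 2 := fun ω => by
      rw [hW]; simp only [localMean]; rw [div_pow]; ring
    calc _ = (((n : ℝ) * h n) ^ 2)⁻¹ *
          ∫ ω, (∑ i ∈ Finset.range n, φ (scaledDesign X x (h n) ω i)) ^ 2 * E ω ∂P := by
          rw [← integral_const_mul]; simp only [e1]
      _ ≤ (((n : ℝ) * h n) ^ 2)⁻¹ * ((∫ ω, (∑ i ∈ Finset.range n,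
          φ (scaledDesign X x (h n) ω i)) ^ 2 ∂P) * ρ ^ (n - 2)) := by gcongr
      _ = (∫ ω, W ω ^ 2 ∂P) * ρ ^ (n - 2) := by
          simp only [e2]; rw [integral_const_mul]; ring
      _ ≤ _ := by gcongr
  have hkey : ∫ ω, Set.indicator {ω | localMean n (n * h n) (scaledDesign X x (h n) ω) ψ < θ}
      (fun ω => 1 + W ω ^ 2) ω ∂P ≤ Real.exp (l * θ * (n * h n)) * ((1 + M) * ρ ^ (n - 2)) := by
    calc _ ≤ ∫ ω, Real.exp (l * θ * (n * h n)) * (E ω + W ω ^ 2 * E ω) ∂P := by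
          refine integral_mono_of_nonneg (ae_of_all _ fun ω => ?_)
            ((hEi.add hWE).const_mul _) (ae_of_all _ fun ω => ?_)
          · exact Set.indicator_nonneg (fun _ _ => by positivity) _
          · have hE0' : 0 < E ω := Real.exp_pos _
            by_cases hω : ω ∈ {ω | localMean n (n * h n) (scaledDesign X x (h n) ω) ψ < θ}
            · rw [Set.indicator_of_mem hω]
              have h1 : 1 ≤ Real.exp (l * θ * (n * h n)) * E ω := by
                rw [hEdef, ← Real.exp_add]
                refine Real.one_le_exp ?_
                rw [Set.mem_ofPred_eq, localMean, div_lt_iff₀ hNpos] at hω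
                rw [← Finset.mul_sum]
                nlinarith
              have h3 : 0 ≤ 1 + W ω ^ 2 := by positivity
              calc 1 + W ω ^ 2 = 1 * (1 + W ω ^ 2) := by ring
                _ ≤ (Real.exp (l * θ * (n * h n)) * E ω) * (1 + W ω ^ 2) := by gcongr
                _ = _ := by ring
            · rw [Set.indicator_of_notMem hω]
              positivity
      _ ≤ _ := by
          rw [integral_const_mul, integral_add hEi hWE]
          gcongr
          linarith
  calc _ ≤ ((n : ℝ) * h n) ^ p * (Real.exp (l * θ * (n * h n)) * ((1 + M) * ρ ^ (n - 2))) := by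
        gcongr
    _ = (1 + M) * ((n : ℝ) * h n) ^ p * (Real.exp (l * θ * (n * h n)) * ρ ^ (n - 2)) := by ring
    _ ≤ (1 + M) * ((n : ℝ) * h n) ^ p *
        (Real.exp (2 * l * (θ + c)) * Real.exp (-(l * c * (n * h n)))) := by gcongr
    _ = _ := by ring

end LowerTail

/-! ### Kernel moments, Taylor expansion and unbalanced designs -/

section Kernel

variable {K : ℝ → ℝ}

lemma KernelCondition.exists_bound (hK : KernelCondition K) :
    ∃ B, 0 ≤ B ∧ ∀ u, K u ≠ 0 → |u| ≤ B := by
  obtain ⟨B, hB⟩ := hK.compactSupport.isCompact.isBounded.exists_norm_le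
  exact ⟨|B|, abs_nonneg B, fun u hu => (hB u (subset_tsupport _ hu)).trans (le_abs_self B)⟩

lemma KernelCondition.integrable (hK : KernelCondition K) : Integrable K :=
  integrable_of_memLp_two_of_hasCompactSupport hK.memLp_two hK.compactSupport

lemma KernelCondition.memLp_pow_mul (hK : KernelCondition K) (l : ℕ) :
    MemLp (fun u => u ^ l * K u) 2 := by
  obtain ⟨B, hB0, hB⟩ := hK.exists_bound
  refine (hK.memLp_two.const_mul (B ^ l)).mono
    ((measurable_id.pow_const l).mul hK.measurable).aestronglyMeasurable
    (ae_of_all _ fun u => ?_)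
  by_cases h0 : K u = 0
  · simp [h0]
  · simp only [norm_mul, norm_pow, Real.norm_eq_abs, abs_of_nonneg hB0]
    gcongr
    exact hB u h0

lemma KernelCondition.hasCompactSupport_pow_mul (hK : KernelCondition K) (l : ℕ) :
    HasCompactSupport (fun u => u ^ l * K u) :=
  hK.compactSupport.mul_left

lemma KernelCondition.nu_zero_one (hK : KernelCondition K) : nu K 0 1 = 1 := by
  simpa [nu] using hK.integral_eq_one

lemma KernelCondition.nu_one_one (hK : KernelCondition K) : nu K 1 1 = 0 := by
  have h := integral_neg_eq_self (fun s => s ^ 1 * K s ^ 1) volume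
  simp only [pow_one, hK.symm, neg_mul, integral_neg] at h
  simp only [nu, pow_one]
  linarith

/-- A symmetric kernel puts mass on both sides of the origin, away from it. -/
lemma KernelCondition.exists_pos_tails (hK : KernelCondition K) :
    ∃ a, 0 < a ∧ 0 < (∫ u, (Set.Ici a).indicator K u) ∧
      (∫ u, (Set.Iic (-a)).indicator K u) = ∫ u, (Set.Ici a).indicator K u := by
  have hsymm : ∀ a, (∫ u, (Set.Iic (-a)).indicator K u) = ∫ u, (Set.Ici a).indicator K u := by
    intro a
    rw [← integral_neg_eq_self]
    refine integral_congr_ae (ae_of_all _ fun u => ?_)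
    simp only [Set.indicator, Set.mem_Iic, Set.mem_Ici, neg_le_neg_iff, hK.symm]
  have hnn : ∀ a, 0 ≤ ∫ u, (Set.Ici a).indicator K u := fun a =>
    integral_nonneg fun u => Set.indicator_nonneg (fun u _ => hK.nonneg u) u
  by_contra! hcon
  have hzero : ∀ a, 0 < a → ∫ u, (Set.Ici a).indicator K u = 0 := fun a ha => by
    by_contra h0
    exact hcon a ha (lt_of_le_of_ne (hnn a) (Ne.symm h0)) (hsymm a)
  have hi : ∀ s : Set ℝ, MeasurableSet s → Integrable (s.indicator K) := fun s hs =>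
    hK.integrable.indicator hs
  have hae : ∀ᵐ u : ℝ, ∀ n : ℕ, (Set.Ici (1 / ((n : ℝ) + 1))).indicator K u = 0 ∧
      (Set.Iic (-(1 / ((n : ℝ) + 1)))).indicator K u = 0 := by
    rw [ae_all_iff]
    intro n
    have hpos : (0 : ℝ) < 1 / ((n : ℝ) + 1) := by positivity
    have h1 := (integral_eq_zero_iff_of_nonneg
      (fun u => Set.indicator_nonneg (fun u _ => hK.nonneg u) u)
      (hi _ measurableSet_Ici)).1 (hzero _ hpos)
    have h2 := (integral_eq_zero_iff_of_nonneg
      (fun u => Set.indicator_nonneg (fun u _ => hK.nonneg u) u)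
      (hi _ measurableSet_Iic)).1 ((hsymm _).trans (hzero _ hpos))
    filter_upwards [h1, h2] with u hu1 hu2
    exact ⟨hu1, hu2⟩
  have hK0 : ∀ᵐ u : ℝ, K u = 0 := by
    have hne : ∀ᵐ u : ℝ, u ≠ 0 := by simp [ae_iff]
    filter_upwards [hae, hne] with u hu hu0
    obtain ⟨n, hn⟩ := exists_nat_one_div_lt (abs_pos.2 hu0)
    rcases lt_or_gt_of_ne hu0 with hlt | hgt
    · rw [abs_of_neg hlt] at hn
      have := (hu n).2
      rwa [Set.indicator_of_mem (show u ∈ Set.Iic (-(1 / ((n : ℝ) + 1))) by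
        rw [Set.mem_Iic]; linarith)] at this
    · rw [abs_of_pos hgt] at hn
      have := (hu n).1
      rwa [Set.indicator_of_mem (show u ∈ Set.Ici (1 / ((n : ℝ) + 1)) from hn.le)] at this
  have := hK.integral_eq_one
  rw [integral_congr_ae hK0] at this
  simp at this

end Kernel

lemma memLp_two_comp_add {φ : ℝ → ℝ} (hφ : MemLp φ 2) (s : ℝ) :
    MemLp (fun u => φ (u + s)) 2 :=
  hφ.comp_measurePreserving (measurePreserving_add_right volume s)

lemma hasCompactSupport_comp_add {φ : ℝ → ℝ} (hφ : HasCompactSupport φ) (s : ℝ) :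
    HasCompactSupport (fun u => φ (u + s)) :=
  hφ.comp_homeomorph (Homeomorph.addRight s)

/-- Taylor's formula with Peano's remainder, in `ε`-form. -/
lemma eventually_abs_sub_taylor_le {m : ℝ → ℝ} {x : ℝ}
    (hm : ∀ᶠ y in 𝓝 x, DifferentiableAt ℝ m y ∧ DifferentiableAt ℝ (deriv m) y) {η : ℝ}
    (hη : 0 < η) :
    ∀ᶠ y in 𝓝 x, |m y - (m x + deriv m x * (y - x)
      + 1 / 2 * deriv (deriv m) x * (y - x) ^ 2)| ≤ η * (y - x) ^ 2 := by
  have hd := (hm.self_of_nhds).2.hasDerivAt.isLittleO.def hη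
  obtain ⟨r, hr, hball⟩ := Metric.eventually_nhds_iff.1 (hd.and hm)
  refine Metric.eventually_nhds_iff.2 ⟨r, hr, fun y hy => ?_⟩
  set R : ℝ → ℝ := fun v => m v - (m x + deriv m x * (v - x)
      + 1 / 2 * deriv (deriv m) x * (v - x) ^ 2) with hR
  have hRd : ∀ v ∈ Metric.closedBall x (dist y x), HasDerivWithinAt R
      (deriv m v - deriv m x - deriv (deriv m) x * (v - x))
      (Metric.closedBall x (dist y x)) v := by
    intro v hv
    have hv' := (hball ((Metric.mem_closedBall.1 hv).trans_lt hy)).2.1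
    have h1 : HasDerivAt (fun v : ℝ => v - x) 1 v := (hasDerivAt_id v).sub_const x
    have h2 := hv'.hasDerivAt.sub ((h1.const_mul (deriv m x)).const_add (m x) |>.add
      ((h1.pow 2).const_mul (1 / 2 * deriv (deriv m) x)))
    refine (h2.congr_deriv ?_).hasDerivWithinAt
    simp
    ring
  have hbd : ∀ v ∈ Metric.closedBall x (dist y x),
      ‖deriv m v - deriv m x - deriv (deriv m) x * (v - x)‖ ≤ η * |y - x| := by
    intro v hv
    have h1 := (hball ((Metric.mem_closedBall.1 hv).trans_lt hy)).1
    have h2 : |v - x| ≤ |y - x| := by simpa [Real.dist_eq] using hv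
    calc _ = ‖deriv m v - deriv m x - (v - x) • deriv (deriv m) x‖ := by
          rw [smul_eq_mul, mul_comm (v - x)]
      _ ≤ η * ‖v - x‖ := h1
      _ ≤ _ := by rw [Real.norm_eq_abs]; gcongr
  have := (convex_closedBall x (dist y x)).norm_image_sub_le_of_norm_hasDerivWithin_le hRd hbd
    (Metric.mem_closedBall_self dist_nonneg) (Metric.mem_closedBall.2 le_rfl : y ∈ _)
  have hR0 : R x = 0 := by simp [hR]
  rw [hR0, sub_zero, Real.norm_eq_abs, Real.norm_eq_abs, mul_assoc, ← sq, sq_abs] at this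
  exact this

lemma measurable_moment {K : ℝ → ℝ} (hK : Measurable K) (n : ℕ) (N : ℝ) (l : ℕ) :
    Measurable fun t : ℕ → ℝ => moment K n N t l :=
  (Finset.measurable_fun_sum _ fun i _ =>
    ((measurable_pi_apply i).pow_const l).mul (hK.comp (measurable_pi_apply i))).div_const N

lemma measurable_localMean {φ : ℝ → ℝ} (hφ : Measurable φ) (n : ℕ) (N : ℝ) :
    Measurable fun t : ℕ → ℝ => localMean n N t φ :=
  (Finset.measurable_fun_sum _ fun i _ => hφ.comp (measurable_pi_apply i)).div_const N

lemma measurable_weight {K : ℝ → ℝ} (hK : Measurable K) (n : ℕ) (N : ℝ) (i : ℕ) :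
    Measurable fun t : ℕ → ℝ => weight K n N t i := by
  have h := measurable_moment hK n N
  exact ((hK.comp (measurable_pi_apply i)).mul
    ((h 2).sub ((measurable_pi_apply i).mul (h 1)))).div
    ((((h 0).mul (h 2)).sub ((h 1).pow_const 2)).add_const _)

lemma measurableSet_balanced {K : ℝ → ℝ} (hK : Measurable K) (a θ : ℝ) (n : ℕ) (N : ℝ) :
    MeasurableSet {t : ℕ → ℝ | Balanced K a θ n N t} :=
  (measurableSet_le measurable_const
      (measurable_localMean (hK.indicator measurableSet_Ici) n N)).inter
    (measurableSet_le measurable_const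
      (measurable_localMean (hK.indicator measurableSet_Iic) n N))

/-- The design points seen from `x + s h`, in units of the bandwidth. -/
noncomputable def shiftedDesign {Ω : Type*} (X : ℕ → Ω → ℝ) (x s h : ℝ) (ω : Ω) (i : ℕ) : ℝ :=
  scaledDesign X x h ω i + s

section Point

variable {Ω : Type*} [MeasurableSpace Ω] {P : Measure Ω}
  {X ε : ℕ → Ω → ℝ} {f K : ℝ → ℝ} {x : ℝ} {h : ℕ → ℝ}

lemma IsSample.measurable_shiftedDesign (hs : IsSample P X ε f) (x s h : ℝ) :
    Measurable (shiftedDesign X x s h) :=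
  measurable_pi_iff.2 fun i => (hs.measurable_scaledDesign x h i).add_const s

variable [IsProbabilityMeasure P]

lemma IsSample.tendsto_sq_moment_sub (hs : IsSample P X ε f) (hb : IsBandwidth h)
    (hf : ContinuousAt f x) (hK : KernelCondition K) (s : ℝ) (l : ℕ) :
    (∀ᶠ n : ℕ in atTop,
      MemLp (fun ω => moment K n (n * h n) (shiftedDesign X x s (h n) ω) l) 2 P) ∧
    Tendsto (fun n : ℕ => ∫ ω, (moment K n (n * h n) (shiftedDesign X x s (h n) ω) l
      - f x * nu K l 1) ^ 2 ∂P) atTop (𝓝 0) := by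
  have e : (∫ u, (u + s) ^ l * K (u + s)) = nu K l 1 := by
    rw [integral_add_right_eq_self (fun u => u ^ l * K u) s]
    simp [nu]
  have := hs.tendsto_sq_localMean_sub hb hf (φ := fun u => (u + s) ^ l * K (u + s))
    (((measurable_id.add_const s).pow_const l).mul (hK.measurable.comp (measurable_id.add_const s)))
    (memLp_two_comp_add (hK.memLp_pow_mul l) s)
    (hasCompactSupport_comp_add (hK.hasCompactSupport_pow_mul l) s)
  rwa [e] at this

/-- The second moment, minus its limiting multiple of the zeroth one, vanishes in `L²`. -/
lemma IsSample.tendsto_sq_moment_two_sub (hs : IsSample P X ε f) (hb : IsBandwidth h)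
    (hf : ContinuousAt f x) (hK : KernelCondition K) (s : ℝ) :
    Tendsto (fun n : ℕ => ∫ ω, (moment K n (n * h n) (shiftedDesign X x s (h n) ω) 2
      - nu K 2 1 * moment K n (n * h n) (shiftedDesign X x s (h n) ω) 0) ^ 2 ∂P)
      atTop (𝓝 0) := by
  obtain ⟨i2, l2⟩ := hs.tendsto_sq_moment_sub hb hf hK s 2
  obtain ⟨i0, l0⟩ := hs.tendsto_sq_moment_sub hb hf hK s 0
  have hlim := (l2.const_mul 2).add (l0.const_mul (2 * nu K 2 1 ^ 2))
  simp only [mul_zero, add_zero] at hlim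
  refine squeeze_zero' (Eventually.of_forall fun n => integral_nonneg fun _ => sq_nonneg _) ?_ hlim
  filter_upwards [i2, i0] with n h2 h0
  have j2 := (h2.sub (memLp_const (f x * nu K 2 1))).integrable_sq.const_mul 2
  have j0 := (h0.sub (memLp_const (f x * nu K 0 1))).integrable_sq.const_mul (2 * nu K 2 1 ^ 2)
  simp only [Pi.sub_apply] at j2 j0
  rw [← integral_const_mul, ← integral_const_mul, ← integral_add j2 j0]
  refine integral_mono_of_nonneg (ae_of_all _ fun _ => sq_nonneg _) (j2.add j0)
    (ae_of_all _ fun ω => ?_)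
  simp only [hK.nu_zero_one, mul_one]
  set p2 := moment K n (n * h n) (shiftedDesign X x s (h n) ω) 2
  set p0 := moment K n (n * h n) (shiftedDesign X x s (h n) ω) 0
  nlinarith [sq_nonneg ((p2 - f x * nu K 2 1) + nu K 2 1 * (p0 - f x))]

/-- Unbalanced designs are negligible to every polynomial order. -/
lemma IsSample.tendsto_pow_mul_unbalanced (hs : IsSample P X ε f) (hb : IsBandwidth h)
    (hf : ContinuousAt f x) (hfx : 0 < f x) (hK : KernelCondition K) (s : ℝ) {a : ℝ}
    (ha : 0 < ∫ u, (Set.Ici a).indicator K u)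
    (ha' : (∫ u, (Set.Iic (-a)).indicator K u) = ∫ u, (Set.Ici a).indicator K u) (p : ℕ) :
    (∀ᶠ n : ℕ in atTop, Integrable (Set.indicator
      {ω | ¬ Balanced K a (f x * (∫ u, (Set.Ici a).indicator K u) / 2) n (n * h n)
        (shiftedDesign X x s (h n) ω)}
      (fun ω => 1 + moment K n (n * h n) (shiftedDesign X x s (h n) ω) 0 ^ 2)) P) ∧
    Tendsto (fun n : ℕ => ((n : ℝ) * h n) ^ p * ∫ ω, Set.indicator
      {ω | ¬ Balanced K a (f x * (∫ u, (Set.Ici a).indicator K u) / 2) n (n * h n)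
        (shiftedDesign X x s (h n) ω)}
      (fun ω => 1 + moment K n (n * h n) (shiftedDesign X x s (h n) ω) 0 ^ 2) ω ∂P)
      atTop (𝓝 0) := by
  have hm0 : ∀ n ω, moment K n (n * h n) (shiftedDesign X x s (h n) ω) 0 =
      localMean n (n * h n) (scaledDesign X x (h n) ω) (fun u => K (u + s)) :=
    fun n ω => by rw [moment_zero]; rfl
  set θ := f x * (∫ u, (Set.Ici a).indicator K u) / 2
  have tail : ∀ A : Set ℝ, MeasurableSet A →
      (∫ u, A.indicator K u) = ∫ u, (Set.Ici a).indicator K u →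
      Tendsto (fun n : ℕ => ((n : ℝ) * h n) ^ p * ∫ ω, Set.indicator
        {ω | localMean n (n * h n) (shiftedDesign X x s (h n) ω) (A.indicator K) < θ}
        (fun ω => 1 + moment K n (n * h n) (shiftedDesign X x s (h n) ω) 0 ^ 2) ω ∂P)
        atTop (𝓝 0) := by
    intro A hA hAint
    have hint : (∫ u, A.indicator K (u + s)) = ∫ u, (Set.Ici a).indicator K u := by
      rw [integral_add_right_eq_self (A.indicator K) s, hAint]
    have hcA : HasCompactSupport (A.indicator K) :=
      hK.compactSupport.mono (by rw [Set.support_indicator]; exact Set.inter_subset_right)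
    have := hs.tendsto_pow_mul_lowerTail hb hf hfx
      (φ := fun u => K (u + s)) (ψ := fun u => A.indicator K (u + s))
      (hK.measurable.comp (measurable_id.add_const s))
      (memLp_two_comp_add hK.memLp_two s) (hasCompactSupport_comp_add hK.compactSupport s)
      (fun u => hK.nonneg _) ((hK.measurable.indicator hA).comp (measurable_id.add_const s))
      (memLp_two_comp_add (hK.memLp_two.indicator hA) s) (hasCompactSupport_comp_add hcA s)
      (fun u => Set.indicator_nonneg (fun u _ => hK.nonneg u) _) (by rw [hint]; exact ha) p
    rw [hint] at this
    refine this.congr fun n => ?_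
    simp only [hm0]
    rfl
  have h1 := tail _ measurableSet_Ici rfl
  have h2 := tail _ measurableSet_Iic ha'
  have hM := (hs.tendsto_sq_moment_sub hb hf hK s 0).1
  have hdm : ∀ n, Measurable (shiftedDesign X x s (h n)) := fun n =>
    hs.measurable_shiftedDesign x s (h n)
  have hbase : ∀ᶠ n : ℕ in atTop, Integrable
      (fun ω => 1 + moment K n (n * h n) (shiftedDesign X x s (h n) ω) 0 ^ 2) P :=
    hM.mono fun n hn => (integrable_const _).add hn.integrable_sq
  have hbad : ∀ n : ℕ, MeasurableSet {ω | ¬ Balanced K a θ n (n * h n)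
      (shiftedDesign X x s (h n) ω)} := fun n =>
    ((hdm n) (measurableSet_balanced hK.measurable a θ n (n * h n))).compl
  refine ⟨hbase.mono fun n hn => hn.indicator (hbad n), ?_⟩
  have hlim := h1.add h2
  rw [add_zero] at hlim
  refine squeeze_zero' ?_ ?_ hlim
  · filter_upwards [hb.eventually_pos] with n hn
    have := hn.2
    exact mul_nonneg (by positivity)
      (integral_nonneg fun ω => Set.indicator_nonneg (fun _ _ => by positivity) _)
  filter_upwards [hb.eventually_pos, hbase] with n hn hi
  have hN := hn.2
  have hmA : ∀ A : Set ℝ, MeasurableSet A → MeasurableSet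
      {ω | localMean n (n * h n) (shiftedDesign X x s (h n) ω) (A.indicator K) < θ} := fun A hA =>
    measurableSet_lt ((measurable_localMean (hK.measurable.indicator hA) n _).comp (hdm n))
      measurable_const
  rw [← mul_add, ← integral_add (hi.indicator (hmA _ measurableSet_Ici))
    (hi.indicator (hmA _ measurableSet_Iic))]
  refine mul_le_mul_of_nonneg_left (integral_mono (hi.indicator (hbad n))
    ((hi.indicator (hmA _ measurableSet_Ici)).add (hi.indicator (hmA _ measurableSet_Iic)))
    fun ω => ?_) (by positivity)
  have hpos : 0 ≤ 1 + moment K n (n * h n) (shiftedDesign X x s (h n) ω) 0 ^ 2 := by positivity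
  simp only [Set.indicator, Set.mem_ofPred_eq, Balanced, not_and_or, not_le]
  split_ifs <;> first | linarith | tauto

end Point

/-! ### Conditional bias -/

/-- The local linear estimator in normalised form: the weighted mean of the responses `y`. -/
noncomputable def weightedMean (K : ℝ → ℝ) (n : ℕ) (N : ℝ) (t y : ℕ → ℝ) : ℝ :=
  (∑ i ∈ Finset.range n, weight K n N t i * y i) / N

lemma PointCondition.continuousAt_f {m σ f : ℝ → ℝ} {x : ℝ} (hp : PointCondition m σ f x) :
    ContinuousAt f x := by
  obtain ⟨c, α, hα, -, hc⟩ := hp.f_holder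
  rw [ContinuousAt, tendsto_iff_norm_sub_tendsto_zero]
  have hlim : Tendsto (fun y => c * |x - y| ^ α) (𝓝 x) (𝓝 0) := by
    have h1 : ContinuousAt (fun y => c * |x - y| ^ α) x :=
      continuousAt_const.mul
        (((continuousAt_const.sub continuousAt_id).abs).rpow_const (Or.inr hα.le))
    have h2 := h1.tendsto
    simpa [Real.zero_rpow hα.ne'] using h2
  exact squeeze_zero (fun _ => norm_nonneg _)
    (fun y => by rw [Real.norm_eq_abs, abs_sub_comm]; exact hc y) hlim

lemma PointCondition.continuousAt_m {m σ f : ℝ → ℝ} {x : ℝ} (hp : PointCondition m σ f x) :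
    ContinuousAt m x :=
  hp.twice_diff.self_of_nhds.1.continuousAt

/-- The bound of `exists_sq_bias_le` together with the crude bound for unbalanced designs: `F` is
any number that exceeds `1 + p₀²` when the design is unbalanced. -/
lemma exists_sq_bias_le_add {K : ℝ → ℝ} {a θ B : ℝ} (hK : ∀ u, 0 ≤ K u)
    (hB : ∀ u, K u ≠ 0 → |u| ≤ B) (ha : 0 < a) (hθ : 0 < θ) (hB0 : 0 ≤ B) (ν : ℝ) :
    ∃ C, 0 ≤ C ∧ ∀ (n : ℕ) (N : ℝ) (t y : ℕ → ℝ) (s b₀ b₁ b₂ ω M S₀ F : ℝ), 1 ≤ N → 0 ≤ ω →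
      0 ≤ M → (∀ i, K (t i) ≠ 0 → |y i| ≤ M) →
      (∀ i, K (t i) ≠ 0 → |y i - (b₀ + b₁ * (s - t i) + b₂ * (s - t i) ^ 2)| ≤ ω) →
      |b₀ + b₁ * s + b₂ * s ^ 2| + |b₂ * ν| ≤ S₀ → 0 ≤ F →
      (¬ Balanced K a θ n N t → 1 + moment K n N t 0 ^ 2 ≤ F) →
      (weightedMean K n N t y - (b₀ + b₁ * s + b₂ * s ^ 2) - b₂ * ν) ^ 2 ≤
        C * (S₀ ^ 2 + b₂ ^ 2) * (N⁻¹) ^ 8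
          + C * b₂ ^ 2 * (moment K n N t 2 - ν * moment K n N t 0) ^ 2
          + C * b₂ ^ 2 * moment K n N t 1 ^ 2 + C * ω ^ 2 * moment K n N t 0 ^ 2
          + 2 * (B ^ 2 * M ^ 2 + S₀ ^ 2) * N ^ 4 * F := by
  obtain ⟨C, hC0, hC⟩ := exists_sq_bias_le (K := K) hK hB ha hθ hB0 ν
  refine ⟨C, hC0, fun n N t y s b₀ b₁ b₂ ω M S₀ F hN1 hω hM hyM hy hS hF0 hF => ?_⟩
  have hN : 0 < N := one_pos.trans_le hN1
  have hκ : ((N ^ 4)⁻¹) ^ 2 = (N⁻¹) ^ 8 := by rw [inv_pow, inv_pow, ← pow_mul]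
  have hb : |b₀ + b₁ * s + b₂ * s ^ 2| ≤ S₀ := by linarith [abs_nonneg (b₂ * ν)]
  have hS2 : (b₀ + b₁ * s + b₂ * s ^ 2) ^ 2 ≤ S₀ ^ 2 :=
    sq_le_sq' (abs_le.1 hb).1 (abs_le.1 hb).2
  by_cases hG : Balanced K a θ n N t
  · have h1 := hC n N t y s b₀ b₁ b₂ ω hN hG hω hy
    have h2 : 0 ≤ 2 * (B ^ 2 * M ^ 2 + S₀ ^ 2) * N ^ 4 * F := by positivity
    rw [weightedMean]
    refine h1.trans ?_
    rw [hκ]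
    have h3 : C * ((b₀ + b₁ * s + b₂ * s ^ 2) ^ 2 * (N⁻¹) ^ 8) ≤ C * (S₀ ^ 2 * (N⁻¹) ^ 8) := by
      gcongr
    linarith
  · have h1 : weightedMean K n N t y ^ 2 ≤ N ^ 4 * B ^ 2 * M ^ 2 * moment K n N t 0 ^ 2 :=
      sq_sum_weight_mul_le hK hN hB hyM
    have hF' := hF hG
    set V := weightedMean K n N t y
    set q := moment K n N t 0 ^ 2 with hq
    have hq0 : 0 ≤ q := sq_nonneg _
    have hU : |(b₀ + b₁ * s + b₂ * s ^ 2) + b₂ * ν| ≤ S₀ := (abs_add_le _ _).trans hS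
    have h4 : V - (b₀ + b₁ * s + b₂ * s ^ 2) - b₂ * ν =
      V - ((b₀ + b₁ * s + b₂ * s ^ 2) + b₂ * ν) := by ring
    rw [h4]
    set U := (b₀ + b₁ * s + b₂ * s ^ 2) + b₂ * ν
    have hU2 : U ^ 2 ≤ S₀ ^ 2 := sq_le_sq' (abs_le.1 hU).1 (abs_le.1 hU).2
    have h2 : (V - U) ^ 2 ≤ 2 * V ^ 2 + 2 * U ^ 2 := by
      have : 2 * V ^ 2 + 2 * U ^ 2 - (V - U) ^ 2 = (V + U) ^ 2 := by ring
      linarith [sq_nonneg (V + U)]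
    have hN4 : 1 ≤ N ^ 4 := one_le_pow₀ hN1
    have e1 : S₀ ^ 2 * 1 ≤ S₀ ^ 2 * N ^ 4 := by gcongr
    have e2 : 0 ≤ S₀ ^ 2 * N ^ 4 * q := by positivity
    have e3 : 0 ≤ B ^ 2 * M ^ 2 * N ^ 4 := by positivity
    have e4 : 2 * (B ^ 2 * M ^ 2 + S₀ ^ 2) * N ^ 4 * (1 + q) ≤
        2 * (B ^ 2 * M ^ 2 + S₀ ^ 2) * N ^ 4 * F := by gcongr
    have e5 : 0 ≤ C * (S₀ ^ 2 + b₂ ^ 2) * (N⁻¹) ^ 8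
          + C * b₂ ^ 2 * (moment K n N t 2 - ν * moment K n N t 0) ^ 2
          + C * b₂ ^ 2 * moment K n N t 1 ^ 2 + C * ω ^ 2 * q := by positivity
    linarith

lemma integral_affine_comb {Ω : Type*} [MeasurableSpace Ω] {P : Measure Ω}
    [IsProbabilityMeasure P] {g₁ g₂ g₃ g₄ : Ω → ℝ} (h₁ : Integrable g₁ P) (h₂ : Integrable g₂ P)
    (h₃ : Integrable g₃ P) (h₄ : Integrable g₄ P) (c₀ c₁ c₂ c₃ c₄ : ℝ) :
    Integrable (fun ω => c₀ + c₁ * g₁ ω + c₂ * g₂ ω + c₃ * g₃ ω + c₄ * g₄ ω) P ∧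
    ∫ ω, (c₀ + c₁ * g₁ ω + c₂ * g₂ ω + c₃ * g₃ ω + c₄ * g₄ ω) ∂P =
      c₀ + c₁ * ∫ ω, g₁ ω ∂P + c₂ * ∫ ω, g₂ ω ∂P + c₃ * ∫ ω, g₃ ω ∂P + c₄ * ∫ ω, g₄ ω ∂P := by
  have i1 : Integrable (fun ω => c₀ + c₁ * g₁ ω) P := (integrable_const _).add (h₁.const_mul _)
  have i2 : Integrable (fun ω => c₀ + c₁ * g₁ ω + c₂ * g₂ ω) P := i1.add (h₂.const_mul _)
  have i3 : Integrable (fun ω => c₀ + c₁ * g₁ ω + c₂ * g₂ ω + c₃ * g₃ ω) P :=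
    i2.add (h₃.const_mul _)
  refine ⟨i3.add (h₄.const_mul _), ?_⟩
  rw [integral_add i3 (h₄.const_mul _), integral_add i2 (h₃.const_mul _),
    integral_add i1 (h₂.const_mul _), integral_add (integrable_const _) (h₁.const_mul _)]
  simp [integral_const_mul]

section Point

variable {Ω : Type*} [MeasurableSpace Ω] {P : Measure Ω}
  {X ε : ℕ → Ω → ℝ} {m σ f K : ℝ → ℝ} {x : ℝ} {h : ℕ → ℝ}

lemma sub_eq_mul_shiftedDesign {Ω : Type*} {X : ℕ → Ω → ℝ} {x h : ℝ} (hh : h ≠ 0) (s : ℝ) (ω : Ω)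
    (i : ℕ) : X i ω - x = h * (s - shiftedDesign X x s h ω i) := by
  rw [← sub_mul_scaledDesign (X := X) (x := x) hh ω i, shiftedDesign]; ring

/-- The kernel only sees design points that are eventually in any given neighbourhood of `x`. -/
lemma eventually_of_kernel_ne_zero {Ω : Type*} {X : ℕ → Ω → ℝ} (hb : IsBandwidth h) {B : ℝ}
    (hB : ∀ u, K u ≠ 0 → |u| ≤ B)
    {Q : ℝ → Prop} (hQ : ∀ᶠ y in 𝓝 x, Q y) (s : ℝ) :
    ∀ᶠ n in atTop, ∀ ω i, K (shiftedDesign X x s (h n) ω i) ≠ 0 → Q (X i ω) := by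
  obtain ⟨r, hr, hball⟩ := Metric.eventually_nhds_iff.1 hQ
  have hlim : Tendsto (fun n => h n * (|s| + |B|)) atTop (𝓝 0) := by
    simpa using hb.tendsto_zero.mul_const (|s| + |B|)
  filter_upwards [hlim.eventually_lt_const hr] with n hn ω i hi
  refine hball ?_
  rw [Real.dist_eq, sub_eq_mul_shiftedDesign (hb.pos n).ne' s, abs_mul, abs_of_pos (hb.pos n)]
  refine lt_of_le_of_lt (mul_le_mul_of_nonneg_left ((abs_sub _ _).trans ?_) (hb.pos n).le) hn
  have := (hB _ hi).trans (le_abs_self B)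
  linarith

lemma measurable_weightedMean (hs : IsSample P X ε f) (hK : Measurable K) {g : ℝ → ℝ}
    (hg : Measurable g) (n : ℕ) (N s h : ℝ) :
    Measurable fun ω => weightedMean K n N (shiftedDesign X x s h ω) (fun i => g (X i ω)) :=
  (Finset.measurable_fun_sum _ fun i _ =>
    ((measurable_weight hK n N i).comp (hs.measurable_shiftedDesign x s h)).mul
      (hg.comp (hs.measurable_X i))).div_const N

variable [IsProbabilityMeasure P]

lemma IsSample.memLp_weightedMean (hs : IsSample P X ε f) (hb : IsBandwidth h)
    (hp : PointCondition m σ f x) (hK : KernelCondition K) (s : ℝ) :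
    ∀ᶠ n : ℕ in atTop, MemLp (fun ω => weightedMean K n (n * h n)
      (shiftedDesign X x s (h n) ω) (fun i => m (X i ω))) 2 P := by
  obtain ⟨B, hB0, hB⟩ := hK.exists_bound
  filter_upwards [hb.eventually_pos, (hs.tendsto_sq_moment_sub hb hp.continuousAt_f hK s 0).1,
    eventually_of_kernel_ne_zero (X := X) hb hB
      (hp.continuousAt_m.abs.eventually_lt continuousAt_const (lt_add_one _)) s] with n hn h0 hmb
  have hms := (measurable_weightedMean (x := x) hs hK.measurable hp.measurable_m n (n * h n) s
    (h n)).aestronglyMeasurable (μ := P)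
  refine (memLp_two_iff_integrable_sq hms).2 ((h0.integrable_sq.const_mul
    ((n * h n) ^ 4 * B ^ 2 * (|m x| + 1) ^ 2)).mono' (hms.pow 2) (ae_of_all _ fun ω => ?_))
  rw [Real.norm_of_nonneg (sq_nonneg _)]
  exact sq_sum_weight_mul_le hK.nonneg hn.2 hB (fun i hi => (hmb ω i hi).le)

/-- Conditional bias of the estimator at `x + s h`: up to an error whose second moment is
`o(h⁴ + (n h)⁻¹)`, it is the quadratic Taylor polynomial of `m` at `x`, evaluated there, plus the
curvature term `m''(x) ν₂₀ h² / 2`. -/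
lemma IsSample.bias_isLittleO (hs : IsSample P X ε f) (hb : IsBandwidth h)
    (hp : PointCondition m σ f x) (hK : KernelCondition K) (s : ℝ) :
    (fun n : ℕ => ∫ ω, (weightedMean K n (n * h n)
        (shiftedDesign X x s (h n) ω) (fun i => m (X i ω))
      - (m x + deriv m x * h n * s + 1 / 2 * deriv (deriv m) x * h n ^ 2 * s ^ 2)
      - 1 / 2 * deriv (deriv m) x * h n ^ 2 * nu K 2 1) ^ 2 ∂P) =o[atTop]
      (fun n : ℕ => h n ^ 4 + ((n : ℝ) * h n)⁻¹) := by
  obtain ⟨B, hB0, hB⟩ := hK.exists_bound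
  obtain ⟨a, ha, hμ, hμ'⟩ := hK.exists_pos_tails
  have hf := hp.continuousAt_f
  have hfx := hp.f_pos
  set θ := f x * (∫ u, (Set.Ici a).indicator K u) / 2 with hθdef
  have hθ : 0 < θ := by positivity
  set ν := nu K 2 1
  set b1 := deriv m x
  set b2 := 1 / 2 * deriv (deriv m) x with hb2
  obtain ⟨C, hC0, hC⟩ := exists_sq_bias_le_add (K := K) hK.nonneg hB ha hθ hB0 ν
  set S0 := |m x| + |b1| * |s| + |b2| * s ^ 2 + |b2| * |ν| with hS0
  have hS00 : 0 ≤ S0 := by positivity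
  have i0 := (hs.tendsto_sq_moment_sub hb hf hK s 0).1
  obtain ⟨i1, l1⟩ := hs.tendsto_sq_moment_sub hb hf hK s 1
  have i2 := (hs.tendsto_sq_moment_sub hb hf hK s 2).1
  have l20 := hs.tendsto_sq_moment_two_sub hb hf hK s
  obtain ⟨ibad, lbad⟩ := hs.tendsto_pow_mul_unbalanced hb hf hfx hK s hμ hμ' 5
  rw [hK.nu_one_one, mul_zero] at l1
  simp only [sub_zero] at l1
  -- The zeroth moment is bounded in `L²`.
  obtain ⟨M, hM0, hM⟩ := hs.exists_integral_sq_localMean_le hb hf (φ := fun u => K (u + s))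
    (hK.measurable.comp (measurable_id.add_const s))
    (memLp_two_comp_add hK.memLp_two s) (hasCompactSupport_comp_add hK.compactSupport s)
  have hm0 : ∀ n ω, moment K n (n * h n) (shiftedDesign X x s (h n) ω) 0 =
      localMean n (n * h n) (scaledDesign X x (h n) ω) (fun u => K (u + s)) :=
    fun n ω => by rw [moment_zero]; rfl
  simp only [← hm0] at hM
  rw [isLittleO_iff]
  intro c hc
  -- `η` is the accuracy asked of Taylor's formula.
  set L := (|s| + B) ^ 2 with hL
  obtain ⟨η, hη, hηc⟩ : ∃ η : ℝ, 0 < η ∧ C * (η * L) ^ 2 * M ≤ c / 2 := by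
    have hlim : Tendsto (fun η : ℝ => C * (η * L) ^ 2 * M) (𝓝[>] 0) (𝓝 0) := by
      have : Continuous fun η : ℝ => C * (η * L) ^ 2 * M := by fun_prop
      have h0 := (this.tendsto 0).mono_left (nhdsWithin_le_nhds (s := Set.Ioi 0))
      simpa using h0
    obtain ⟨η, h1, h2⟩ := ((hlim.eventually_le_const (half_pos hc)).and
      self_mem_nhdsWithin).exists
    exact ⟨η, h2, h1⟩
  set C2 := 2 * (B ^ 2 * (|m x| + 1) ^ 2 + S0 ^ 2) with hC2
  have hNinv : Tendsto (fun n : ℕ => ((n : ℝ) * h n)⁻¹) atTop (𝓝 0) :=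
    hb.tendsto_mul.inv_tendsto_atTop
  have hA : Tendsto (fun n : ℕ => C * b2 ^ 2 *
      ((∫ ω, (moment K n (n * h n) (shiftedDesign X x s (h n) ω) 2
          - ν * moment K n (n * h n) (shiftedDesign X x s (h n) ω) 0) ^ 2 ∂P)
        + ∫ ω, moment K n (n * h n) (shiftedDesign X x s (h n) ω) 1 ^ 2 ∂P)) atTop (𝓝 0) := by
    simpa using (l20.add l1).const_mul (C * b2 ^ 2)
  have hBd : Tendsto (fun n : ℕ => C * (S0 ^ 2 + b2 ^ 2) * (((n : ℝ) * h n)⁻¹) ^ 7 +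
      C2 * (((n : ℝ) * h n) ^ 5 * ∫ ω, Set.indicator
        {ω | ¬ Balanced K a θ n (n * h n) (shiftedDesign X x s (h n) ω)}
        (fun ω => 1 + moment K n (n * h n) (shiftedDesign X x s (h n) ω) 0 ^ 2) ω ∂P))
      atTop (𝓝 0) := by
    simpa using ((hNinv.pow 7).const_mul (C * (S0 ^ 2 + b2 ^ 2))).add (lbad.const_mul C2)
  filter_upwards [hb.eventually_pos, i0, i1, i2, ibad, hM,
    hA.eventually_le_const (half_pos hc), hBd.eventually_le_const hc,
    hb.tendsto_zero.eventually_le_const one_pos, hb.tendsto_mul.eventually_ge_atTop 1,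
    eventually_of_kernel_ne_zero (X := X) hb hB
      (hp.continuousAt_m.abs.eventually_lt continuousAt_const (lt_add_one _)) s,
    eventually_of_kernel_ne_zero (X := X) hb hB
      (eventually_abs_sub_taylor_le hp.twice_diff hη) s] with
    n hn j0 j1 j2 jbad hMn hAn hBn hh1 hN1 hmb htay
  have hh := hb.pos n
  have hN := hn.2
  set N := (n : ℝ) * h n with hNdef
  set t := fun ω => shiftedDesign X x s (h n) ω
  set bad : Set Ω := {ω | ¬ Balanced K a θ n N (t ω)} with hbad
  set F : Ω → ℝ := bad.indicator (fun ω => 1 + moment K n N (t ω) 0 ^ 2)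
  have hS : |m x + b1 * h n * s + b2 * h n ^ 2 * s ^ 2| + |b2 * h n ^ 2 * ν| ≤ S0 := by
    have e1 : |b1 * h n * s| ≤ |b1| * |s| := by
      rw [abs_mul, abs_mul, abs_of_pos hh]
      calc |b1| * h n * |s| ≤ |b1| * 1 * |s| := by gcongr
        _ = _ := by ring
    have hh2 : h n ^ 2 ≤ 1 := pow_le_one₀ hh.le hh1
    have e2 : |b2 * h n ^ 2 * s ^ 2| ≤ |b2| * s ^ 2 := by
      rw [abs_mul, abs_mul, abs_of_nonneg (sq_nonneg s), abs_of_nonneg (sq_nonneg (h n))]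
      calc |b2| * h n ^ 2 * s ^ 2 ≤ |b2| * 1 * s ^ 2 := by gcongr
        _ = _ := by ring
    have e3 : |b2 * h n ^ 2 * ν| ≤ |b2| * |ν| := by
      rw [abs_mul, abs_mul, abs_of_nonneg (sq_nonneg (h n))]
      calc |b2| * h n ^ 2 * |ν| ≤ |b2| * 1 * |ν| := by gcongr
        _ = _ := by ring
    have e4 := abs_add_three (m x) (b1 * h n * s) (b2 * h n ^ 2 * s ^ 2)
    rw [hS0]; linarith
  have hh4 : (b2 * h n ^ 2) ^ 2 ≤ b2 ^ 2 := by
    rw [mul_pow, ← pow_mul]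
    exact mul_le_of_le_one_right (sq_nonneg _) (pow_le_one₀ hh.le hh1)
  have hpt : ∀ ω, (weightedMean K n N (t ω) (fun i => m (X i ω))
      - (m x + b1 * h n * s + b2 * h n ^ 2 * s ^ 2) - b2 * h n ^ 2 * ν) ^ 2 ≤
      C * (S0 ^ 2 + (b2 * h n ^ 2) ^ 2) * (N⁻¹) ^ 8
        + C * (b2 * h n ^ 2) ^ 2 * (moment K n N (t ω) 2 - ν * moment K n N (t ω) 0) ^ 2
        + C * (b2 * h n ^ 2) ^ 2 * moment K n N (t ω) 1 ^ 2
        + C * (η * L * h n ^ 2) ^ 2 * moment K n N (t ω) 0 ^ 2 + C2 * N ^ 4 * F ω := by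
    intro ω
    refine hC n N (t ω) (fun i => m (X i ω)) s (m x) (b1 * h n) (b2 * h n ^ 2) (η * L * h n ^ 2)
      (|m x| + 1) S0 (F ω) hN1 (by positivity) (by positivity) (fun i hi => (hmb ω i hi).le)
      (fun i hi => ?_) hS (Set.indicator_nonneg (fun _ _ => by positivity) _)
      (fun hG => (Set.indicator_of_mem (s := bad) hG
        (fun ω => 1 + moment K n N (t ω) 0 ^ 2)).ge)
    have h2 := htay ω i hi
    rw [sub_eq_mul_shiftedDesign hh.ne' s] at h2
    refine le_trans (le_of_eq ?_) (h2.trans ?_)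
    · congr 1
      simp only [t]; ring
    · have h3 : |s - t ω i| ≤ |s| + B := (abs_sub _ _).trans (by gcongr; exact hB _ hi)
      have h4 : (s - t ω i) ^ 2 ≤ L := by
        rw [← sq_abs, hL]; gcongr
      calc _ = η * h n ^ 2 * (s - t ω i) ^ 2 := by rw [mul_pow]; ring
        _ ≤ η * h n ^ 2 * L := by gcongr
        _ = _ := by ring
  have k2 : Integrable (fun ω => (moment K n N (t ω) 2 - ν * moment K n N (t ω) 0) ^ 2) P :=
    (j2.sub (j0.const_mul ν)).integrable_sq
  obtain ⟨k3, hval⟩ := integral_affine_comb k2 j1.integrable_sq j0.integrable_sq jbad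
    (C * (S0 ^ 2 + (b2 * h n ^ 2) ^ 2) * (N⁻¹) ^ 8) (C * (b2 * h n ^ 2) ^ 2)
    (C * (b2 * h n ^ 2) ^ 2) (C * (η * L * h n ^ 2) ^ 2) (C2 * N ^ 4)
  rw [Real.norm_of_nonneg (integral_nonneg fun _ => sq_nonneg _),
    Real.norm_of_nonneg (by positivity)]
  refine (integral_mono_of_nonneg (ae_of_all _ fun _ => sq_nonneg _) k3
    (ae_of_all _ hpt)).trans ?_
  rw [hval]
  have g1 : C * (S0 ^ 2 + (b2 * h n ^ 2) ^ 2) * (N⁻¹) ^ 8 ≤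
      C * (S0 ^ 2 + b2 ^ 2) * (N⁻¹) ^ 7 * N⁻¹ := by
    rw [mul_assoc _ ((N⁻¹) ^ 7), ← pow_succ]
    gcongr
  have g2 : C * (η * L * h n ^ 2) ^ 2 * ∫ ω, moment K n N (t ω) 0 ^ 2 ∂P ≤
      c / 2 * h n ^ 4 := by
    calc _ ≤ C * (η * L * h n ^ 2) ^ 2 * M := by gcongr
      _ = C * (η * L) ^ 2 * M * h n ^ 4 := by ring
      _ ≤ _ := by gcongr
  have g3 : C2 * N ^ 4 * ∫ ω, F ω ∂P = C2 * (N ^ 5 * ∫ ω, F ω ∂P) * N⁻¹ := by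
    field_simp
  have g4 := mul_le_mul_of_nonneg_right hAn (by positivity : 0 ≤ h n ^ 4)
  have g5 := mul_le_mul_of_nonneg_right hBn (by positivity : 0 ≤ N⁻¹)
  rw [mul_pow, ← pow_mul]
  norm_num only
  linarith

end Point

/-! ### Mean square convergence of the weights -/

/-- The squared distance between the weights and their limits, for all designs: on balanced designs
it is controlled by the factor `min C _`, on the others by `F ≥ p₀²`. -/
lemma exists_sum_sq_weight_sub_le {K : ℝ → ℝ} {a θ f B : ℝ} (hK : ∀ u, 0 ≤ K u)
    (hB : ∀ u, K u ≠ 0 → |u| ≤ B) (ha : 0 < a) (hθ : 0 < θ) (hB0 : 0 ≤ B) (hf : 0 < f) :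
    ∃ C, 0 ≤ C ∧ ∀ (n : ℕ) (N : ℝ) (t v : ℕ → ℝ) (M b F : ℝ), 0 < N → 0 ≤ M →
      (∀ i, K (t i) ≠ 0 → v i ≤ M) → (∀ i, 0 ≤ v i) → 0 ≤ b → 0 ≤ F →
      (¬ Balanced K a θ n N t → 1 ≤ b) → (¬ Balanced K a θ n N t → moment K n N t 0 ^ 2 ≤ F) →
      (∑ i ∈ Finset.range n, (weight K n N t i - K (t i) / f) ^ 2 * v i) / N ≤
        M * (localMean n N t (fun u => K u ^ 2) *
          min C (C * ((moment K n N t 0 - f) ^ 2 + moment K n N t 1 ^ 2 + (N⁻¹) ^ 8 + b)))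
        + 2 * M * B ^ 2 * (N ^ 5 * F) := by
  obtain ⟨C, hC0, hC⟩ := exists_sq_weight_sub_le (K := K) hK hB ha hθ hB0 hf
  refine ⟨max C (2 / f ^ 2), hC0.trans (le_max_left _ _),
    fun n N t v M b F hN hM hvM hv0 hb0 hF0 hb hF => ?_⟩
  set C' := max C (2 / f ^ 2) with hC'
  have hCC' : C ≤ C' := le_max_left _ _
  have hfC' : 2 / f ^ 2 ≤ C' := le_max_right _ _
  have hC'0 : 0 ≤ C' := hC0.trans hCC'
  have hκ : ((N ^ 4)⁻¹) ^ 2 = (N⁻¹) ^ 8 := by rw [inv_pow, inv_pow, ← pow_mul]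
  set e := (moment K n N t 0 - f) ^ 2 + moment K n N t 1 ^ 2 + (N⁻¹) ^ 8 with he
  have he0 : 0 ≤ e := by positivity
  set Ψ := min C' (C' * (e + b)) with hΨ
  have hp0 := moment_zero_nonneg (n := n) (t := t) hK hN.le
  have hterm : ∀ i ∈ Finset.range n, (weight K n N t i - K (t i) / f) ^ 2 * v i ≤
      M * (K (t i) ^ 2 * Ψ) + 2 * M * B ^ 2 * (N ^ 5 * (moment K n N t 0)⁻¹ * F) * K (t i) := by
    intro i hi
    by_cases h0 : K (t i) = 0
    · simp [weight, h0]
    have hKi := hK (t i)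
    have hv := hvM i h0
    have hr0 : 0 ≤ 2 * M * B ^ 2 * (N ^ 5 * (moment K n N t 0)⁻¹ * F) * K (t i) := by positivity
    by_cases hG : Balanced K a θ n N t
    · have h1 := hC n N t hN hG i
      rw [hκ] at h1
      have h2 : min C (C * e) ≤ Ψ := by
        refine min_le_min hCC' ?_
        calc C * e ≤ C' * e := by gcongr
          _ ≤ _ := by gcongr; linarith
      have h3 : (weight K n N t i - K (t i) / f) ^ 2 ≤ K (t i) ^ 2 * Ψ :=
        h1.trans (mul_le_mul_of_nonneg_left h2 (sq_nonneg _))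
      calc _ ≤ (K (t i) ^ 2 * Ψ) * M :=
            mul_le_mul h3 hv (hv0 i) ((sq_nonneg _).trans h3)
        _ ≤ _ := by linarith
    · have h1 := weight_sq_le (n := n) (t := t) hK hN hB hi
      have h2 : C' ≤ Ψ := le_min le_rfl (le_mul_of_one_le_right hC'0 (by linarith [hb hG]))
      have h3 : (weight K n N t i - K (t i) / f) ^ 2 ≤
          2 * weight K n N t i ^ 2 + 2 * (K (t i) / f) ^ 2 := by
        have : 2 * weight K n N t i ^ 2 + 2 * (K (t i) / f) ^ 2
          - (weight K n N t i - K (t i) / f) ^ 2 = (weight K n N t i + K (t i) / f) ^ 2 := by ring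
        linarith [sq_nonneg (weight K n N t i + K (t i) / f)]
      have h4 : 2 * (K (t i) / f) ^ 2 ≤ K (t i) ^ 2 * Ψ := by
        calc _ = K (t i) ^ 2 * (2 / f ^ 2) := by rw [div_pow]; ring
          _ ≤ _ := mul_le_mul_of_nonneg_left (hfC'.trans h2) (sq_nonneg _)
      have hp : 0 < moment K n N t 0 := by
        have hle : K (t i) ≤ N * moment K n N t 0 := by
          rw [← sum_pow_mul hN.ne']
          simp only [pow_zero, one_mul]
          exact Finset.single_le_sum (f := fun j => K (t j)) (fun j _ => hK _) hi
        exact pos_of_mul_pos_right ((lt_of_le_of_ne hKi (Ne.symm h0)).trans_le hle) hN.le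
      have h5 : moment K n N t 0 ≤ (moment K n N t 0)⁻¹ * F := by
        rw [inv_mul_eq_div, le_div_iff₀ hp, ← sq]; exact hF hG
      have h6 : 2 * weight K n N t i ^ 2 ≤
          2 * B ^ 2 * (N ^ 5 * ((moment K n N t 0)⁻¹ * F)) * K (t i) := by
        calc _ ≤ 2 * (N ^ 5 * B ^ 2 * moment K n N t 0 * K (t i)) := by gcongr
          _ ≤ 2 * (N ^ 5 * B ^ 2 * ((moment K n N t 0)⁻¹ * F) * K (t i)) := by gcongr
          _ = _ := by ring
      have h7 := h3.trans (add_le_add h6 h4)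
      calc _ ≤ (2 * B ^ 2 * (N ^ 5 * ((moment K n N t 0)⁻¹ * F)) * K (t i)
            + K (t i) ^ 2 * Ψ) * M := mul_le_mul h7 hv (hv0 i) ((sq_nonneg _).trans h7)
        _ = _ := by ring
  rw [div_le_iff₀ hN]
  refine (Finset.sum_le_sum hterm).trans ?_
  have hsum := sum_pow_mul (K := K) (n := n) (t := t) hN.ne' 0
  simp only [pow_zero, one_mul] at hsum
  rw [Finset.sum_add_distrib, ← Finset.mul_sum, ← Finset.sum_mul, ← Finset.mul_sum, hsum]
  have h8 : ∑ i ∈ Finset.range n, K (t i) ^ 2 = N * localMean n N t (fun u => K u ^ 2) := by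
    rw [localMean]; field_simp
  rw [h8]
  have h9 : (moment K n N t 0)⁻¹ * moment K n N t 0 ≤ 1 := by
    rcases eq_or_lt_of_le hp0 with h | h
    · rw [← h]; simp
    · rw [inv_mul_cancel₀ h.ne']
  have h10 : 2 * M * B ^ 2 * (N ^ 5 * (moment K n N t 0)⁻¹ * F) * (N * moment K n N t 0) ≤
      2 * M * B ^ 2 * (N ^ 5 * F) * N := by
    calc _ = 2 * M * B ^ 2 * (N ^ 5 * F) * N * ((moment K n N t 0)⁻¹ * moment K n N t 0) := by ring
      _ ≤ 2 * M * B ^ 2 * (N ^ 5 * F) * N * 1 := by gcongr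
      _ = _ := by ring
  linarith

section Point

variable {Ω : Type*} [MeasurableSpace Ω] {P : Measure Ω} [IsProbabilityMeasure P]
  {X ε : ℕ → Ω → ℝ} {m σ f K : ℝ → ℝ} {x : ℝ} {h : ℕ → ℝ}

/-- The weights converge to `K / f(x)` in the mean square sense that governs the variance. -/
lemma IsSample.tendsto_sq_weight_sub (hs : IsSample P X ε f) (hb : IsBandwidth h)
    (hp : PointCondition m σ f x) (hK : KernelCondition K) (s : ℝ) :
    (∀ᶠ n : ℕ in atTop, Integrable (fun ω => (∑ i ∈ Finset.range n,
      (weight K n (n * h n) (shiftedDesign X x s (h n) ω) i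
        - K (shiftedDesign X x s (h n) ω i) / f x) ^ 2 * σ (X i ω) ^ 2) / (n * h n)) P) ∧
    Tendsto (fun n : ℕ => ∫ ω, (∑ i ∈ Finset.range n,
      (weight K n (n * h n) (shiftedDesign X x s (h n) ω) i
        - K (shiftedDesign X x s (h n) ω i) / f x) ^ 2 * σ (X i ω) ^ 2) / (n * h n) ∂P)
      atTop (𝓝 0) := by
  obtain ⟨B, hB0, hB⟩ := hK.exists_bound
  obtain ⟨a, ha, hμ, hμ'⟩ := hK.exists_pos_tails
  have hf := hp.continuousAt_f
  have hfx := hp.f_pos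
  set θ := f x * (∫ u, (Set.Ici a).indicator K u) / 2 with hθdef
  have hθ : 0 < θ := by positivity
  obtain ⟨C, hC0, hC⟩ := exists_sum_sq_weight_sub_le (K := K) hK.nonneg hB ha hθ hB0 hfx
  obtain ⟨i0, l0⟩ := hs.tendsto_sq_moment_sub hb hf hK s 0
  obtain ⟨i1, l1⟩ := hs.tendsto_sq_moment_sub hb hf hK s 1
  rw [hK.nu_one_one, mul_zero] at l1
  rw [hK.nu_zero_one, mul_one] at l0
  simp only [sub_zero] at l1
  obtain ⟨ibad, lbad⟩ := hs.tendsto_pow_mul_unbalanced hb hf hfx hK s hμ hμ' 5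
  obtain ⟨-, lbad0⟩ := hs.tendsto_pow_mul_unbalanced hb hf hfx hK s hμ hμ' 0
  simp only [pow_zero, one_mul] at lbad0
  set p : ℕ → ℕ → Ω → ℝ := fun l n ω => moment K n (n * h n) (shiftedDesign X x s (h n) ω) l
    with hpdef
  set F : ℕ → Ω → ℝ := fun n => Set.indicator
    {ω | ¬ Balanced K a θ n (n * h n) (shiftedDesign X x s (h n) ω)} (fun ω => 1 + p 0 n ω ^ 2)
    with hF
  have hF0 : ∀ n ω, 0 ≤ F n ω := fun n ω => Set.indicator_nonneg (fun _ _ => by positivity) ω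
  have hdm : ∀ n, Measurable (shiftedDesign X x s (h n)) := fun n =>
    hs.measurable_shiftedDesign x s (h n)
  have hpm : ∀ l n, Measurable (p l n) := fun l n =>
    (measurable_moment hK.measurable n _ l).comp (hdm n)
  have hFm : ∀ n, Measurable (F n) := fun n =>
    (((hpm 0 n).pow_const 2).const_add 1).indicator
      ((hdm n) (measurableSet_balanced hK.measurable a θ n (n * h n))).compl
  set Ψ : ℕ → Ω → ℝ := fun n ω => min C (C * ((p 0 n ω - f x) ^ 2 + p 1 n ω ^ 2
    + (((n : ℝ) * h n)⁻¹) ^ 8 + F n ω)) with hΨ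
  have hΨm : ∀ n, Measurable (Ψ n) := fun n =>
    measurable_const.min ((((((hpm 0 n).sub_const _).pow_const 2).add
      ((hpm 1 n).pow_const 2)).add_const _).add (hFm n) |>.const_mul C)
  have hΨ0 : ∀ n ω, 0 ≤ Ψ n ω := fun n ω => by
    have := hF0 n ω
    have h8 : 0 ≤ (((n : ℝ) * h n)⁻¹) ^ 8 := Even.pow_nonneg (by decide) _
    exact le_min hC0 (by positivity)
  have hNinv : Tendsto (fun n : ℕ => (((n : ℝ) * h n)⁻¹) ^ 8) atTop (𝓝 0) := by
    simpa using hb.tendsto_mul.inv_tendsto_atTop.pow 8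
  have hΨlim : Tendsto (fun n => ∫ ω, Ψ n ω ∂P) atTop (𝓝 0) := by
    have hlim := (((hNinv.add l0).add l1).add lbad0).const_mul C
    simp only [add_zero, mul_zero] at hlim
    refine squeeze_zero' (Eventually.of_forall fun n => integral_nonneg (hΨ0 n)) ?_ hlim
    filter_upwards [i0, i1, ibad] with n j0 j1 jb
    have k0 : Integrable (fun ω => (p 0 n ω - f x) ^ 2) P :=
      (j0.sub (memLp_const (f x))).integrable_sq
    obtain ⟨q1, q2⟩ := integral_affine_comb k0 j1.integrable_sq jb jb
      (C * (((n : ℝ) * h n)⁻¹) ^ 8) C C C 0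
    refine (integral_mono_of_nonneg (ae_of_all _ (hΨ0 n)) q1
      (ae_of_all _ fun ω => (min_le_right _ _).trans (le_of_eq ?_))).trans
      (le_of_eq (q2.trans ?_))
    · simp only [hF, hpdef]; ring
    · ring
  obtain ⟨iV, lV⟩ := hs.tendsto_integral_localMean_mul hb hf
    (φ := fun u => K (u + s) ^ 2) ((hK.measurable.comp (measurable_id.add_const s)).pow_const 2)
    (memLp_two_comp_add hK.memLp_two s).integrable_sq
    ((hasCompactSupport_comp_add hK.compactSupport s).comp_left (g := fun y : ℝ => y ^ 2) (by simp))
    hΨm hΨ0 (fun n ω => min_le_left _ _) hΨlim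
  set M := σ x ^ 2 + 1 with hM
  have hM0 : 0 ≤ M := by positivity
  have hσ := eventually_of_kernel_ne_zero (X := X) hb hB
      (hp.continuousAt_σ_sq.eventually_lt continuousAt_const (lt_add_one _)) s
  have hbound : ∀ᶠ n : ℕ in atTop, ∀ ω, (∑ i ∈ Finset.range n,
      (weight K n (n * h n) (shiftedDesign X x s (h n) ω) i
        - K (shiftedDesign X x s (h n) ω i) / f x) ^ 2 * σ (X i ω) ^ 2) / (n * h n) ≤
      M * (localMean n (n * h n) (scaledDesign X x (h n) ω) (fun u => K (u + s) ^ 2) * Ψ n ω)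
        + 2 * M * B ^ 2 * ((n * h n) ^ 5 * F n ω) := by
    filter_upwards [hσ, hb.eventually_pos] with n hn hpos ω
    have hFbad : ¬ Balanced K a θ n (n * h n) (shiftedDesign X x s (h n) ω) →
        F n ω = 1 + p 0 n ω ^ 2 := fun hG => Set.indicator_of_mem (s := {ω | ¬ Balanced K a θ n
          (n * h n) (shiftedDesign X x s (h n) ω)}) hG _
    exact hC n (n * h n) (shiftedDesign X x s (h n) ω) (fun i => σ (X i ω) ^ 2) M (F n ω) (F n ω)
      hpos.2 hM0 (fun i hi => (hn ω i hi).le) (fun i => sq_nonneg _) (hF0 n ω) (hF0 n ω)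
      (fun hG => by rw [hFbad hG]; linarith [sq_nonneg (p 0 n ω)])
      (fun hG => by rw [hFbad hG]; simp only [hpdef]; linarith)
  have hnn : ∀ᶠ n : ℕ in atTop, ∀ ω, 0 ≤ (∑ i ∈ Finset.range n,
      (weight K n (n * h n) (shiftedDesign X x s (h n) ω) i
        - K (shiftedDesign X x s (h n) ω i) / f x) ^ 2 * σ (X i ω) ^ 2) / (n * h n) := by
    filter_upwards [hb.eventually_pos] with n hpos ω
    exact div_nonneg (Finset.sum_nonneg fun i _ => by positivity) hpos.2.le
  have hmaj : ∀ᶠ n : ℕ in atTop, Integrable (fun ω =>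
      M * (localMean n (n * h n) (scaledDesign X x (h n) ω) (fun u => K (u + s) ^ 2) * Ψ n ω)
        + 2 * M * B ^ 2 * ((n * h n) ^ 5 * F n ω)) P := by
    filter_upwards [iV, ibad] with n h1 h2
    exact (h1.const_mul M).add ((h2.const_mul _).const_mul _)
  refine ⟨?_, ?_⟩
  · filter_upwards [hbound, hnn, hmaj] with n h1 h2 h3
    refine h3.mono' ?_ (ae_of_all _ fun ω => ?_)
    · refine ((Finset.measurable_fun_sum _ fun i _ => ?_).div_const _).aestronglyMeasurable
      exact ((((measurable_weight hK.measurable n _ i).comp (hdm n)).sub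
        ((hK.measurable.comp ((measurable_pi_apply i).comp (hdm n))).div_const _)).pow_const 2).mul
        ((hp.measurable_σ.comp (hs.measurable_X i)).pow_const 2)
    · rw [Real.norm_of_nonneg (h2 ω)]; exact h1 ω
  · have hlim := (lV.const_mul M).add (lbad.const_mul (2 * M * B ^ 2))
    simp only [mul_zero, add_zero] at hlim
    refine squeeze_zero' (hnn.mono fun n hn => integral_nonneg hn) ?_ hlim
    filter_upwards [hbound, hnn, hmaj, iV, ibad] with n h1 h2 h3 h4 h5
    refine (integral_mono_of_nonneg (ae_of_all _ h2) h3 (ae_of_all _ h1)).trans (le_of_eq ?_)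
    rw [integral_add (h4.const_mul M) ((h5.const_mul _).const_mul _), integral_const_mul,
      integral_const_mul, integral_const_mul]

end Point

/-! ### Conditional mean and noise of a linear combination -/

section Noise

variable {Ω : Type*} [MeasurableSpace Ω] {P : Measure Ω} {X ε : ℕ → Ω → ℝ} {f : ℝ → ℝ}

lemma IsSample.measurable_design (hs : IsSample P X ε f) : Measurable fun ω i => X i ω :=
  measurable_pi_iff.2 hs.measurable_X

variable [IsProbabilityMeasure P]

lemma IsSample.integral_noise_mul (hs : IsSample P X ε f) (i j : ℕ) :
    ∫ ω, ε i ω * ε j ω ∂P = if i = j then 1 else 0 := by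
  split_ifs with hij
  · subst hij
    simpa [sq] using hs.integral_noise_sq i
  · rw [(hs.iIndepFun_noise.indepFun hij).integral_fun_mul_eq_mul_integral
      (hs.measurable_ε i).aestronglyMeasurable (hs.measurable_ε j).aestronglyMeasurable,
      hs.integral_noise, zero_mul]

lemma IsSample.memLp_mul_noise (hs : IsSample P X ε f) {U : (ℕ → ℝ) → ℝ} (hU : Measurable U)
    (hU2 : MemLp (fun ω => U fun i => X i ω) 2 P) (i : ℕ) :
    MemLp (fun ω => U (fun i => X i ω) * ε i ω) 2 P := by
  have hm := (hU.comp hs.measurable_design).aestronglyMeasurable (μ := P)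
  refine (memLp_two_iff_integrable_sq
    (hm.mul (hs.measurable_ε i).aestronglyMeasurable)).2 ?_
  have hind := hs.indepFun_design_noise.comp (φ := fun y => U y ^ 2) (ψ := fun e => e i ^ 2)
    (hU.pow_const 2) ((measurable_pi_apply i).pow_const 2)
  refine (hind.integrable_mul hU2.integrable_sq (hs.memLp_noise i).integrable_sq).congr
    (ae_of_all _ fun ω => ?_)
  simp only [Pi.mul_apply, Function.comp_apply, mul_pow]

lemma IsSample.integral_mul_noise (hs : IsSample P X ε f) {U : (ℕ → ℝ) → ℝ} (hU : Measurable U)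
    {g : (ℕ → ℝ) → ℝ} (hg : Measurable g) :
    ∫ ω, U (fun i => X i ω) * g (fun i => ε i ω) ∂P =
      (∫ ω, U (fun i => X i ω) ∂P) * ∫ ω, g (fun i => ε i ω) ∂P :=
  (hs.indepFun_design_noise.comp hU hg).integral_fun_mul_eq_mul_integral
    (hU.comp hs.measurable_design).aestronglyMeasurable
    (hg.comp (measurable_pi_iff.2 hs.measurable_ε)).aestronglyMeasurable

/-- A weighted sum of errors, with weights depending on the design only: it is centred,
uncorrelated with functions of the design, and its variance is the sum of the mean squared
weights. -/
lemma IsSample.noise_sum (hs : IsSample P X ε f) (n : ℕ) {U : ℕ → (ℕ → ℝ) → ℝ}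
    (hU : ∀ i, Measurable (U i))
    (hU2 : ∀ i ∈ Finset.range n, MemLp (fun ω => U i fun i => X i ω) 2 P) :
    MemLp (fun ω => ∑ i ∈ Finset.range n, U i (fun i => X i ω) * ε i ω) 2 P ∧
    ∫ ω, (∑ i ∈ Finset.range n, U i (fun i => X i ω) * ε i ω) ∂P = 0 ∧
    ∫ ω, (∑ i ∈ Finset.range n, U i (fun i => X i ω) * ε i ω) ^ 2 ∂P =
      ∑ i ∈ Finset.range n, ∫ ω, U i (fun i => X i ω) ^ 2 ∂P ∧
    ∀ V : (ℕ → ℝ) → ℝ, Measurable V → MemLp (fun ω => V fun i => X i ω) 2 P →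
      ∫ ω, V (fun i => X i ω) * (∑ i ∈ Finset.range n, U i (fun i => X i ω) * ε i ω) ∂P = 0 := by
  have hL : ∀ i ∈ Finset.range n, MemLp (fun ω => U i (fun i => X i ω) * ε i ω) 2 P :=
    fun i hi => hs.memLp_mul_noise (hU i) (hU2 i hi) i
  have h0 : ∀ V : (ℕ → ℝ) → ℝ, Measurable V → ∀ i, ∫ ω, V (fun i => X i ω) * ε i ω ∂P = 0 := by
    intro V hV i
    have := hs.integral_mul_noise hV (measurable_pi_apply i)
    rw [this, hs.integral_noise, mul_zero]
  refine ⟨memLp_finsetSum _ hL, ?_, ?_, ?_⟩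
  · rw [integral_finsetSum _ fun i hi => (hL i hi).integrable one_le_two]
    exact Finset.sum_eq_zero fun i _ => h0 _ (hU i) i
  · have hsq : ∀ ω, (∑ i ∈ Finset.range n, U i (fun i => X i ω) * ε i ω) ^ 2 =
        ∑ i ∈ Finset.range n, ∑ j ∈ Finset.range n,
          (U i (fun i => X i ω) * ε i ω) * (U j (fun i => X i ω) * ε j ω) := fun ω => by
      rw [sq, Finset.sum_mul_sum]
    have hLL : ∀ i ∈ Finset.range n, ∀ j ∈ Finset.range n, Integrable (fun ω =>
        (U i (fun i => X i ω) * ε i ω) * (U j (fun i => X i ω) * ε j ω)) P :=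
      fun i hi j hj => (hL i hi).integrable_mul (hL j hj)
    simp only [hsq]
    rw [integral_finsetSum _ fun i hi => integrable_finsetSum _ fun j hj => hLL i hi j hj]
    refine Finset.sum_congr rfl fun i hi => ?_
    rw [integral_finsetSum _ fun j hj => hLL i hi j hj]
    have hij : ∀ j, ∫ ω, (U i (fun i => X i ω) * ε i ω) * (U j (fun i => X i ω) * ε j ω) ∂P =
        (∫ ω, U i (fun i => X i ω) * U j (fun i => X i ω) ∂P) * if i = j then 1 else 0 := by
      intro j
      have := hs.integral_mul_noise (U := fun y => U i y * U j y) (g := fun e => e i * e j)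
        ((hU i).mul (hU j)) ((measurable_pi_apply i).mul (measurable_pi_apply j))
      rw [hs.integral_noise_mul] at this
      rw [← this]
      refine integral_congr_ae (ae_of_all _ fun ω => ?_)
      simp only; ring
    simp only [hij, mul_ite, mul_one, mul_zero]
    rw [Finset.sum_ite_eq, if_pos hi]
    simp only [sq]
  · intro V hV hV2
    have hVL : ∀ i ∈ Finset.range n, Integrable (fun ω =>
        V (fun i => X i ω) * (U i (fun i => X i ω) * ε i ω)) P :=
      fun i hi => hV2.integrable_mul (hL i hi)
    simp only [Finset.mul_sum]
    rw [integral_finsetSum _ hVL]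
    refine Finset.sum_eq_zero fun i _ => ?_
    rw [← h0 _ (hV.mul (hU i)) i]
    refine integral_congr_ae (ae_of_all _ fun ω => ?_)
    simp only [Pi.mul_apply]; ring

end Noise

/-- Perturbation of a limit of mean squares: `W² - k²` is controlled by `(W - k)²` and a small
multiple of `k²`. -/
lemma tendsto_of_sq_perturbation {a b e : ℕ → ℝ} {L : ℝ} (hb : Tendsto b atTop (𝓝 L))
    (he : Tendsto e atTop (𝓝 0))
    (h : ∀ η : ℝ, 0 < η → ∀ᶠ n in atTop, |a n - b n| ≤ (1 + 1 / η) * e n + η * b n) :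
    Tendsto a atTop (𝓝 L) := by
  have hab : Tendsto (fun n => a n - b n) atTop (𝓝 0) := by
    rw [Metric.tendsto_nhds]
    intro δ hδ
    have hL : 0 < |L| + 1 := by positivity
    set η := δ / (2 * (|L| + 1)) with hη
    have hη0 : 0 < η := by positivity
    have hlim : Tendsto (fun n => (1 + 1 / η) * e n + η * b n) atTop (𝓝 (η * L)) := by
      simpa using (he.const_mul (1 + 1 / η)).add (hb.const_mul η)
    have hlt : η * L < δ := by
      calc η * L ≤ η * (|L| + 1) := by
            have := le_abs_self L
            gcongr; linarith
        _ = δ / 2 := by rw [hη]; field_simp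
        _ < δ := half_lt_self hδ
    filter_upwards [h η hη0, hlim.eventually_lt_const hlt] with n h1 h2
    rw [Real.dist_eq, sub_zero]
    exact h1.trans_lt h2
  simpa using hab.add hb

lemma abs_sq_sub_sq_le {η : ℝ} (hη : 0 < η) (W k : ℝ) :
    |W ^ 2 - k ^ 2| ≤ (1 + 1 / η) * (W - k) ^ 2 + η * k ^ 2 := by
  have h1 : (1 + 1 / η) * (W - k) ^ 2 + η * k ^ 2 - (W ^ 2 - k ^ 2) =
      ((W - k) - η * k) ^ 2 / η := by field_simp; ring
  have h2 : (1 + 1 / η) * (W - k) ^ 2 + η * k ^ 2 + (W ^ 2 - k ^ 2) =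
      2 * (W - k) ^ 2 + ((W - k) + η * k) ^ 2 / η := by field_simp; ring
  have h3 : 0 ≤ ((W - k) - η * k) ^ 2 / η := by positivity
  have h4 : 0 ≤ 2 * (W - k) ^ 2 + ((W - k) + η * k) ^ 2 / η := by positivity
  rw [abs_le]
  constructor <;> linarith

lemma sq_sum_mul_le {ι : Type*} [Fintype ι] (α y : ι → ℝ) :
    (∑ q, α q * y q) ^ 2 ≤ (∑ q, α q ^ 2) * ∑ q, y q ^ 2 :=
  Finset.sum_mul_sq_le_sq_mul_sq _ _ _

lemma measurable_weight_shiftedDesign {Ω : Type*} [MeasurableSpace Ω] {P : Measure Ω}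
    {X ε : ℕ → Ω → ℝ} {f K : ℝ → ℝ} {x : ℝ} (hs : IsSample P X ε f) (hK : KernelCondition K)
    (n i : ℕ) (N s h : ℝ) : Measurable fun ω => weight K n N (shiftedDesign X x s h ω) i :=
  (measurable_weight hK.measurable n N i).comp (hs.measurable_shiftedDesign x s h)

section Combination

variable {Ω : Type*} [MeasurableSpace Ω] {P : Measure Ω} [IsProbabilityMeasure P]
  {X ε : ℕ → Ω → ℝ} {m σ f K : ℝ → ℝ} {x : ℝ} {h : ℕ → ℝ} {ι : Type*} [Fintype ι]

/-- The weights vanish where the kernel does, so for large `n` only values of `σ` near `x` enter;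
`σ` itself need not be locally bounded elsewhere. -/
lemma IsSample.memLp_weight_mul (hs : IsSample P X ε f) (hb : IsBandwidth h)
    (hp : PointCondition m σ f x) (hK : KernelCondition K) (s : ℝ) :
    ∀ᶠ n : ℕ in atTop, ∀ i ∈ Finset.range n, MemLp (fun ω => weight K n (n * h n)
      (shiftedDesign X x s (h n) ω) i * σ (X i ω)) 2 P := by
  obtain ⟨B, hB0, hB⟩ := hK.exists_bound
  filter_upwards [hb.eventually_pos, (hs.tendsto_sq_moment_sub hb hp.continuousAt_f hK s 0).1,
    eventually_of_kernel_ne_zero (X := X) hb hB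
      (hp.continuousAt_σ_sq.eventually_lt continuousAt_const (lt_add_one _)) s] with n hn h0 hσ i hi
  have hms := ((measurable_weight_shiftedDesign (x := x) hs hK n i (n * h n) s (h n)).mul
    (hp.measurable_σ.comp (hs.measurable_X i))).aestronglyMeasurable (μ := P)
  refine (memLp_two_iff_integrable_sq hms).2 ((h0.integrable_sq.const_mul
    ((n * h n) ^ 6 * B ^ 2 * (σ x ^ 2 + 1))).mono' (hms.pow 2) (ae_of_all _ fun ω => ?_))
  rw [Real.norm_of_nonneg (sq_nonneg _)]
  have hN := hn.2
  simp only [Pi.mul_apply, Function.comp_apply]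
  set t := shiftedDesign X x s (h n) ω
  by_cases hz : K (t i) = 0
  · have : weight K n (n * h n) t i = 0 := by simp [weight, hz]
    rw [this, zero_mul, zero_pow two_ne_zero]
    positivity
  · have h1 := weight_sq_le (n := n) (t := t) hK.nonneg hN hB hi
    have h2 : K (t i) ≤ n * h n * moment K n (n * h n) t 0 := by
      rw [← sum_pow_mul hN.ne']
      simp only [pow_zero, one_mul]
      exact Finset.single_le_sum (f := fun j => K (t j)) (fun j _ => hK.nonneg _) hi
    have h3 := moment_zero_nonneg (n := n) (t := t) hK.nonneg hN.le
    rw [mul_pow]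
    calc _ ≤ ((n * h n) ^ 5 * B ^ 2 * moment K n (n * h n) t 0 *
          (n * h n * moment K n (n * h n) t 0)) * (σ x ^ 2 + 1) := by
          refine mul_le_mul (h1.trans (by gcongr)) (hσ ω i hz).le (sq_nonneg _) (by positivity)
      _ = _ := by ring

/-- The part of the linear combination that depends on the design only. -/
lemma IsSample.conditionalMean_asymptotics (hs : IsSample P X ε f) (hb : IsBandwidth h)
    (hp : PointCondition m σ f x) (hK : KernelCondition K) (α s : ι → ℝ)
    (h0 : ∑ q, α q = 1) (h1 : ∑ q, α q * s q = 0) (h2 : ∑ q, α q * s q ^ 2 = 0) :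
    (∀ᶠ n : ℕ in atTop, MemLp (fun ω => ∑ q, α q * weightedMean K n (n * h n)
      (shiftedDesign X x (s q) (h n) ω) (fun i => m (X i ω))) 2 P) ∧
    (fun n : ℕ => ∫ ω, ((∑ q, α q * weightedMean K n (n * h n)
        (shiftedDesign X x (s q) (h n) ω) (fun i => m (X i ω)))
      - (m x + 1 / 2 * deriv (deriv m) x * nu K 2 1 * h n ^ 2)) ^ 2 ∂P) =o[atTop]
      (fun n : ℕ => h n ^ 4 + ((n : ℝ) * h n)⁻¹) := by
  have hmem : ∀ᶠ n : ℕ in atTop, ∀ q, MemLp (fun ω => weightedMean K n (n * h n)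
      (shiftedDesign X x (s q) (h n) ω) (fun i => m (X i ω))) 2 P :=
    eventually_all.2 fun q => hs.memLp_weightedMean hb hp hK (s q)
  refine ⟨hmem.mono fun n hn => memLp_finsetSum _ fun q _ => (hn q).const_mul (α q), ?_⟩
  set β : ι → ℕ → Ω → ℝ := fun q n ω => weightedMean K n (n * h n)
        (shiftedDesign X x (s q) (h n) ω) (fun i => m (X i ω))
      - (m x + deriv m x * h n * s q + 1 / 2 * deriv (deriv m) x * h n ^ 2 * s q ^ 2)
      - 1 / 2 * deriv (deriv m) x * h n ^ 2 * nu K 2 1 with hβ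
  have hβo : (fun n => (∑ q, α q ^ 2) * ∑ q, ∫ ω, β q n ω ^ 2 ∂P) =o[atTop]
      (fun n : ℕ => h n ^ 4 + ((n : ℝ) * h n)⁻¹) :=
    (IsLittleO.fun_sum fun q _ => hs.bias_isLittleO hb hp hK (s q)).const_mul_left _
  refine IsBigO.trans_isLittleO (IsBigO.of_bound 1 ?_) hβo
  filter_upwards [hmem] with n hn
  have hβi : ∀ q, Integrable (fun ω => β q n ω ^ 2) P := fun q =>
    (((hn q).sub (memLp_const _)).sub (memLp_const _)).integrable_sq
  rw [one_mul, Real.norm_of_nonneg (integral_nonneg fun _ => sq_nonneg _),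
    Real.norm_of_nonneg (mul_nonneg (Finset.sum_nonneg fun q _ => sq_nonneg _)
      (Finset.sum_nonneg fun q _ => integral_nonneg fun _ => sq_nonneg _)),
    ← integral_finsetSum _ fun q _ => hβi q, ← integral_const_mul]
  refine integral_mono_of_nonneg (ae_of_all _ fun _ => sq_nonneg _)
    ((integrable_finsetSum _ fun q _ => hβi q).const_mul _) (ae_of_all _ fun ω => ?_)
  -- Linear and quadratic terms of the Taylor polynomial cancel in the combination.
  have e : (∑ q, α q * weightedMean K n (n * h n)
        (shiftedDesign X x (s q) (h n) ω) (fun i => m (X i ω)))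
      - (m x + 1 / 2 * deriv (deriv m) x * nu K 2 1 * h n ^ 2) = ∑ q, α q * β q n ω := by
    have e1 : ∀ q, α q * β q n ω = α q * weightedMean K n (n * h n)
        (shiftedDesign X x (s q) (h n) ω) (fun i => m (X i ω))
        - (m x + 1 / 2 * deriv (deriv m) x * nu K 2 1 * h n ^ 2) * α q
        - deriv m x * h n * (α q * s q)
        - 1 / 2 * deriv (deriv m) x * h n ^ 2 * (α q * s q ^ 2) := fun q => by
      simp only [hβ]; ring
    simp only [e1, Finset.sum_sub_distrib, ← Finset.mul_sum, h0, h1, h2]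
    ring
  simp only [e]
  exact sq_sum_mul_le _ _

/-- The noise part: `n h` times the mean squared combined weights converges. -/
lemma IsSample.tendsto_noise_variance (hs : IsSample P X ε f) (hb : IsBandwidth h)
    (hp : PointCondition m σ f x) (hK : KernelCondition K) (α s : ι → ℝ) :
    Tendsto (fun n : ℕ => ∫ ω, (∑ i ∈ Finset.range n, ((∑ q, α q * weight K n (n * h n)
        (shiftedDesign X x (s q) (h n) ω) i) * σ (X i ω)) ^ 2) / (n * h n) ∂P) atTop
      (𝓝 (σ x ^ 2 / f x * ∫ u, (∑ q, α q * K (u + s q)) ^ 2)) := by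
  have hfx := hp.f_pos
  set φ : ℝ → ℝ := fun u => (∑ q, α q * K (u + s q)) / f x with hφ
  have hφm : Measurable φ := (Finset.measurable_fun_sum _ fun q _ =>
    (hK.measurable.comp (measurable_id.add_const (s q))).const_mul (α q)).div_const _
  have hφ2 : MemLp φ 2 := by
    simp only [hφ, div_eq_inv_mul]
    exact (memLp_finsetSum _ fun q _ =>
      (memLp_two_comp_add hK.memLp_two (s q)).const_mul (α q)).const_mul _
  have hφc : HasCompactSupport (fun u => φ u ^ 2) := by
    refine HasCompactSupport.intro (K := ⋃ q, tsupport fun u => K (u + s q))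
      (isCompact_iUnion fun q => (hasCompactSupport_comp_add hK.compactSupport (s q)).isCompact)
      fun u hu => ?_
    rw [Set.mem_iUnion, not_exists] at hu
    have : ∀ q, K (u + s q) = 0 := fun q => by
      by_contra h0
      exact hu q (subset_tsupport (fun u => K (u + s q)) h0)
    simp [hφ, this]
  obtain ⟨ib, lb⟩ := hs.tendsto_integral_weighted (φ := fun u => φ u ^ 2) hb hp.continuousAt_f
    (hφm.pow_const 2) hφ2.integrable_sq hφc (hp.measurable_σ.pow_const 2) hp.continuousAt_σ_sq
  have hval : f x * σ x ^ 2 * ∫ u, φ u ^ 2 =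
      σ x ^ 2 / f x * ∫ u, (∑ q, α q * K (u + s q)) ^ 2 := by
    simp only [hφ, div_pow]
    rw [integral_div]
    field_simp
  rw [hval] at lb
  have he := fun q => hs.tendsto_sq_weight_sub hb hp hK (s q)
  have hei := eventually_all.2 fun q => (he q).1
  have hmem := eventually_all.2 fun q => hs.memLp_weight_mul hb hp hK (s q)
  have hlim : Tendsto (fun n : ℕ => (∑ q, α q ^ 2) * ∑ q, ∫ ω, (∑ i ∈ Finset.range n,
      (weight K n (n * h n) (shiftedDesign X x (s q) (h n) ω) i
        - K (shiftedDesign X x (s q) (h n) ω i) / f x) ^ 2 * σ (X i ω) ^ 2) / (n * h n) ∂P)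
      atTop (𝓝 0) := by
    simpa using (tendsto_finsetSum Finset.univ fun q _ => (he q).2).const_mul (∑ q, α q ^ 2)
  refine tendsto_of_sq_perturbation lb hlim fun η hη => ?_
  filter_upwards [ib, hei, hmem, hb.eventually_pos] with n hbn hen hmn hpos
  have hN := hpos.2
  set N := (n : ℝ) * h n
  have hai : Integrable (fun ω => (∑ i ∈ Finset.range n, ((∑ q, α q * weight K n N
        (shiftedDesign X x (s q) (h n) ω) i) * σ (X i ω)) ^ 2) / N) P := by
    refine (integrable_finsetSum _ fun i hi => ?_).div_const _
    have : MemLp (fun ω => (∑ q, α q * weight K n N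
        (shiftedDesign X x (s q) (h n) ω) i) * σ (X i ω)) 2 P := by
      simp only [Finset.sum_mul, mul_assoc]
      exact memLp_finsetSum _ fun q _ => (hmn q i hi).const_mul (α q)
    exact this.integrable_sq
  have hbi : Integrable (fun ω => (∑ i ∈ Finset.range n,
      φ (scaledDesign X x (h n) ω i) ^ 2 * σ (X i ω) ^ 2) / N) P :=
    (integrable_finsetSum _ fun i _ => hbn i).div_const _
  have hesum : Integrable (fun ω => ∑ q, (∑ i ∈ Finset.range n,
      (weight K n N (shiftedDesign X x (s q) (h n) ω) i
        - K (shiftedDesign X x (s q) (h n) ω i) / f x) ^ 2 * σ (X i ω) ^ 2) / N) P :=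
    integrable_finsetSum _ fun q _ => hen q
  rw [← integral_sub hai hbi, ← integral_finsetSum _ fun q _ => hen q, ← integral_const_mul,
    ← integral_const_mul, ← integral_const_mul,
    ← integral_add ((hesum.const_mul _).const_mul _) (hbi.const_mul _)]
  refine (abs_integral_le_integral_abs).trans (integral_mono (hai.sub hbi).abs
    (((hesum.const_mul _).const_mul _).add (hbi.const_mul _)) fun ω => ?_)
  simp only
  rw [← Finset.sum_div, ← sub_div, ← Finset.sum_sub_distrib, abs_div, abs_of_pos hN,
    ← mul_div_assoc, ← mul_div_assoc, ← mul_div_assoc, ← add_div]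
  refine div_le_div_of_nonneg_right ?_ hN.le
  refine (Finset.abs_sum_le_sum_abs _ _).trans ?_
  rw [Finset.sum_comm, Finset.mul_sum, Finset.mul_sum, Finset.mul_sum, ← Finset.sum_add_distrib]
  refine Finset.sum_le_sum fun i _ => ?_
  set W := ∑ q, α q * weight K n N (shiftedDesign X x (s q) (h n) ω) i
  have hWk : (W - φ (scaledDesign X x (h n) ω i)) ^ 2 ≤ (∑ q, α q ^ 2) *
      ∑ q, (weight K n N (shiftedDesign X x (s q) (h n) ω) i
        - K (shiftedDesign X x (s q) (h n) ω i) / f x) ^ 2 := by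
    have : W - φ (scaledDesign X x (h n) ω i) =
        ∑ q, α q * (weight K n N (shiftedDesign X x (s q) (h n) ω) i
          - K (shiftedDesign X x (s q) (h n) ω i) / f x) := by
      simp only [mul_sub, Finset.sum_sub_distrib, hφ, shiftedDesign, Finset.sum_div,
        mul_div_assoc, W]
    rw [this]
    exact sq_sum_mul_le _ _
  rw [mul_pow, ← sub_mul, abs_mul, abs_of_nonneg (sq_nonneg (σ (X i ω))), ← Finset.sum_mul]
  have h1 := (abs_sq_sub_sq_le hη W (φ (scaledDesign X x (h n) ω i))).trans
    (add_le_add_left (mul_le_mul_of_nonneg_left hWk (by positivity : 0 ≤ 1 + 1 / η)) _)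
  calc _ ≤ _ := mul_le_mul_of_nonneg_right h1 (sq_nonneg (σ (X i ω)))
    _ = _ := by ring

end Combination

/-! ### Asymptotics of linear combinations of local linear estimators -/

/-- A signal plus uncorrelated centred noise: the mean square distance of the signal `B` from the
constant `c` bounds both the squared distance of the mean from `c` and the variance not due to the
noise. -/
lemma mean_variance_add_noise {Ω : Type*} [MeasurableSpace Ω] {P : Measure Ω}
    [IsProbabilityMeasure P] {B Z : Ω → ℝ} (hB : MemLp B 2 P) (hZ : MemLp Z 2 P)
    (hZ0 : ∫ ω, Z ω ∂P = 0) (hBZ : ∫ ω, B ω * Z ω ∂P = 0) (c : ℝ) :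
    ((∫ ω, (B ω + Z ω) ∂P) - c) ^ 2 ≤ ∫ ω, (B ω - c) ^ 2 ∂P ∧
    |Var[fun ω => B ω + Z ω; P] - ∫ ω, Z ω ^ 2 ∂P| ≤ ∫ ω, (B ω - c) ^ 2 ∂P := by
  have hBi := hB.integrable one_le_two
  have hZi := hZ.integrable one_le_two
  have hE : ∫ ω, (B ω + Z ω) ∂P = ∫ ω, B ω ∂P := by
    rw [integral_add hBi hZi, hZ0, add_zero]
  have hsq : ∫ ω, (B ω - c) ^ 2 ∂P = (∫ ω, B ω ^ 2 ∂P) - 2 * c * (∫ ω, B ω ∂P) + c ^ 2 := by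
    have e : ∀ ω, (B ω - c) ^ 2 = B ω ^ 2 - 2 * c * B ω + c ^ 2 := fun ω => by ring
    have i1 : Integrable (fun ω => 2 * c * B ω) P := hBi.const_mul _
    have i2 : Integrable (fun ω => B ω ^ 2 - 2 * c * B ω) P := hB.integrable_sq.sub i1
    simp only [e]
    rw [integral_add i2 (integrable_const _), integral_sub hB.integrable_sq i1,
      integral_const_mul]
    simp
  have hBB : Integrable (fun ω => B ω * Z ω) P := hB.integrable_mul hZ
  have hsum : ∫ ω, (B ω + Z ω) ^ 2 ∂P = (∫ ω, B ω ^ 2 ∂P) + ∫ ω, Z ω ^ 2 ∂P := by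
    have e : ∀ ω, (B ω + Z ω) ^ 2 = B ω ^ 2 + 2 * (B ω * Z ω) + Z ω ^ 2 := fun ω => by ring
    have i2 : Integrable (fun ω => B ω ^ 2 + 2 * (B ω * Z ω)) P :=
      hB.integrable_sq.add (hBB.const_mul 2)
    simp only [e]
    rw [integral_add i2 hZ.integrable_sq, integral_add hB.integrable_sq (hBB.const_mul 2),
      integral_const_mul, hBZ, mul_zero, add_zero]
  have hvB : 0 ≤ (∫ ω, B ω ^ 2 ∂P) - (∫ ω, B ω ∂P) ^ 2 := by
    have := variance_nonneg B P
    rwa [variance_eq_sub hB] at this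
  have hvar : Var[fun ω => B ω + Z ω; P] =
      (∫ ω, B ω ^ 2 ∂P) + (∫ ω, Z ω ^ 2 ∂P) - (∫ ω, B ω ∂P) ^ 2 := by
    have := variance_eq_sub (μ := P) (X := fun ω => B ω + Z ω) (hB.add hZ)
    simp only [Pi.pow_apply] at this
    rw [this, hsum, hE]
  rw [hE, hvar, hsq]
  have h2 := sq_nonneg ((∫ ω, B ω ∂P) - c)
  refine ⟨by linarith [hvB, h2], ?_⟩
  rw [abs_le]
  constructor <;> linarith

section Combination

variable {Ω : Type*} [MeasurableSpace Ω] {P : Measure Ω} [IsProbabilityMeasure P]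
  {X ε : ℕ → Ω → ℝ} {m σ f K : ℝ → ℝ} {x : ℝ} {h : ℕ → ℝ} {ι : Type*} [Fintype ι]

/-- Splitting a combination of local linear estimators into conditional mean and noise. -/
lemma sum_estimator_eq {Ω : Type*} {X ε : ℕ → Ω → ℝ} {m σ K : ℝ → ℝ} {x h : ℝ} (hh : 0 < h)
    {n : ℕ} (hn : 0 < n) (α s : ι → ℝ) (ω : Ω) :
    ∑ q, α q * estimator K h n (fun i => X i ω) (fun i => response m σ X ε i ω) (x + s q * h) =
      (∑ q, α q * weightedMean K n (n * h) (shiftedDesign X x (s q) h ω) (fun i => m (X i ω))) +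
      (∑ i ∈ Finset.range n, ((∑ q, α q * weight K n (n * h) (shiftedDesign X x (s q) h ω) i)
        * σ (X i ω)) * ε i ω) / (n * h) := by
  have ht : ∀ q, (fun i => (x + s q * h - X i ω) / h) = shiftedDesign X x (s q) h ω := fun q => by
    funext i
    simp only [shiftedDesign, scaledDesign]
    field_simp
    ring
  have h1 : ∀ q, estimator K h n (fun i => X i ω) (fun i => response m σ X ε i ω)
      (x + s q * h) = weightedMean K n (n * h) (shiftedDesign X x (s q) h ω) (fun i => m (X i ω))
      + (∑ i ∈ Finset.range n, weight K n (n * h) (shiftedDesign X x (s q) h ω) i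
        * (σ (X i ω) * ε i ω)) / (n * h) := fun q => by
    rw [estimator_eq hh hn, ht q, weightedMean, ← add_div, ← Finset.sum_add_distrib]
    simp only [response, mul_add]
  simp only [h1, mul_add, Finset.sum_add_distrib]
  congr 1
  simp only [Finset.sum_mul, Finset.sum_div, ← mul_div_assoc, Finset.mul_sum]
  rw [Finset.sum_comm]
  refine Finset.sum_congr rfl fun i _ => Finset.sum_congr rfl fun q _ => ?_
  ring

/-- Mean and variance of a linear combination of local linear estimators at the points
`x + s q * h`, whose coefficients reproduce quadratic polynomials at `x`. -/
theorem IsSample.linearCombination_asymptotics (hs : IsSample P X ε f) (hb : IsBandwidth h)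
    (hp : PointCondition m σ f x) (hK : KernelCondition K) (α s : ι → ℝ)
    (h0 : ∑ q, α q = 1) (h1 : ∑ q, α q * s q = 0) (h2 : ∑ q, α q * s q ^ 2 = 0)
    {est : ℕ → Ω → ℝ} (hest : ∀ n ω, est n ω = ∑ q, α q * estimator K (h n) n (fun i => X i ω)
      (fun i => response m σ X ε i ω) (x + s q * h n)) :
    (∀ᶠ n in atTop, MemLp (est n) 2 P) ∧
    (fun n : ℕ => P[est n] - m x - 1 / 2 * deriv (deriv m) x * nu K 2 1 * h n ^ 2)
      =o[atTop] (fun n : ℕ => h n ^ 2 + ((n : ℝ) * h n) ^ (-(1 / 2) : ℝ)) ∧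
    (fun n : ℕ => Var[est n; P] - σ x ^ 2 / ((n : ℝ) * h n * f x) *
        ∫ u, (∑ q, α q * K (u + s q)) ^ 2)
      =o[atTop] (fun n : ℕ => h n ^ 4 + ((n : ℝ) * h n)⁻¹) := by
  obtain ⟨hBm, hBo⟩ := hs.conditionalMean_asymptotics hb hp hK α s h0 h1 h2
  have hV := hs.tendsto_noise_variance hb hp hK α s
  set B : ℕ → Ω → ℝ := fun n ω => ∑ q, α q * weightedMean K n (n * h n)
      (shiftedDesign X x (s q) (h n) ω) (fun i => m (X i ω)) with hBdef
  set c : ℕ → ℝ := fun n => m x + 1 / 2 * deriv (deriv m) x * nu K 2 1 * h n ^ 2 with hcdef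
  set a : ℕ → ℝ := fun n : ℕ => ∫ ω, (∑ i ∈ Finset.range n, ((∑ q, α q * weight K n (n * h n)
        (shiftedDesign X x (s q) (h n) ω) i) * σ (X i ω)) ^ 2) / (n * h n) ∂P with hadef
  set V := ∫ u, (∑ q, α q * K (u + s q)) ^ 2
  have key : ∀ᶠ n : ℕ in atTop, MemLp (est n) 2 P ∧
      (P[est n] - c n) ^ 2 ≤ ∫ ω, (B n ω - c n) ^ 2 ∂P ∧
      |Var[est n; P] - a n / (n * h n)| ≤ ∫ ω, (B n ω - c n) ^ 2 ∂P := by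
    filter_upwards [hBm, hb.eventually_pos,
      eventually_all.2 fun q => hs.memLp_weight_mul hb hp hK (s q)] with n hBn hn hw
    have hN := hn.2
    set N := (n : ℝ) * h n with hNdef
    let U : ℕ → (ℕ → ℝ) → ℝ := fun i y =>
      (∑ q, α q * weight K n N (fun j => (x - y j) / h n + s q) i) * σ (y i)
    have hUm : ∀ i, Measurable (U i) := fun i =>
      (Finset.measurable_fun_sum _ fun q _ => ((measurable_weight hK.measurable n N i).comp
        (measurable_pi_iff.2 fun j => (((measurable_pi_apply j).const_sub x).div_const _).add_const
          (s q))).const_mul (α q)).mul (hp.measurable_σ.comp (measurable_pi_apply i))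
    have hU2 : ∀ i ∈ Finset.range n, MemLp (fun ω => U i fun i => X i ω) 2 P := fun i hi => by
      have : (fun ω => U i fun i => X i ω) = fun ω => ∑ q, α q *
          (weight K n N (shiftedDesign X x (s q) (h n) ω) i * σ (X i ω)) := by
        funext ω
        simp only [U, Finset.sum_mul, mul_assoc]
        rfl
      rw [this]
      exact memLp_finsetSum _ fun q _ => (hw q i hi).const_mul (α q)
    obtain ⟨z1, z2, z3, z4⟩ := hs.noise_sum n hUm hU2
    have hBV := z4 (fun y => ∑ q, α q * weightedMean K n N (fun j => (x - y j) / h n + s q)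
        (fun i => m (y i))) (Finset.measurable_fun_sum _ fun q _ =>
          ((Finset.measurable_fun_sum _ fun i _ => ((measurable_weight hK.measurable n N i).comp
            (measurable_pi_iff.2 fun j => (((measurable_pi_apply j).const_sub x).div_const
              _).add_const (s q))).mul
            (hp.measurable_m.comp (measurable_pi_apply i))).div_const N).const_mul (α q)) hBn
    set Z : Ω → ℝ := fun ω => ∑ i ∈ Finset.range n, U i (fun i => X i ω) * ε i ω with hZdef
    have hen : est n = fun ω => B n ω + Z ω / N := by
      funext ω
      rw [hest, sum_estimator_eq (hb.pos n) hn.1]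
      rfl
    have hZN : MemLp (fun ω => Z ω / N) 2 P := by
      simp only [div_eq_inv_mul]; exact z1.const_mul _
    have hmain := mean_variance_add_noise hBn hZN (by rw [integral_div, z2, zero_div])
      (by
        simp only [← mul_div_assoc]
        rw [integral_div]
        exact div_eq_zero_iff.2 (Or.inl hBV)) (c n)
    have hZsq : ∫ ω, (Z ω / N) ^ 2 ∂P = a n / N := by
      simp only [div_pow]
      rw [integral_div, z3, ← integral_finsetSum _ fun i hi => (hU2 i hi).integrable_sq]
      simp only [hadef]
      rw [integral_div, div_div, ← sq]
      rfl
    rw [hZsq] at hmain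
    rw [hen]
    exact ⟨hBn.add hZN, hmain⟩
  -- The relative error of the noise variance is `o(1)`.
  have hNa : (fun n : ℕ => (a n - σ x ^ 2 / f x * V) * ((n : ℝ) * h n)⁻¹) =o[atTop]
      (fun n : ℕ => h n ^ 4 + ((n : ℝ) * h n)⁻¹) := by
    have : (fun n : ℕ => a n - σ x ^ 2 / f x * V) =o[atTop] (fun _ => (1 : ℝ)) :=
      (isLittleO_one_iff ℝ).2 (tendsto_sub_nhds_zero_iff.2 hV)
    refine (this.mul_isBigO (isBigO_refl (fun n : ℕ => ((n : ℝ) * h n)⁻¹) atTop)).trans_isBigO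
      (IsBigO.of_bound 1 ?_)
    filter_upwards [hb.eventually_pos] with n hn
    have hN := hn.2
    have hh := hb.pos n
    rw [one_mul, one_mul, Real.norm_of_nonneg (by positivity), Real.norm_of_nonneg (by positivity)]
    have : 0 ≤ h n ^ 4 := by positivity
    linarith
  refine ⟨key.mono fun n hn => hn.1, ?_, ?_⟩
  -- The squared error of the mean is `o(h⁴ + N⁻¹)`, hence the error is `o(h² + N^(-1/2))`.
  · refine isLittleO_iff.2 fun C hC => ?_
    filter_upwards [key, isLittleO_iff.1 hBo (by positivity : 0 < C ^ 2), hb.eventually_pos]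
      with n hn ho hpos
    have hN := hpos.2
    have hh := hb.pos n
    set r := ((n : ℝ) * h n) ^ (-(1 / 2) : ℝ) with hr
    have hr0 : 0 < r := Real.rpow_pos_of_pos hN _
    have hr2 : r ^ 2 = ((n : ℝ) * h n)⁻¹ := by
      rw [hr, ← Real.rpow_natCast, ← Real.rpow_mul hN.le, ← Real.rpow_neg_one]
      norm_num
    rw [Real.norm_of_nonneg (integral_nonneg fun _ => sq_nonneg _), ← hr2,
      Real.norm_of_nonneg (by positivity)] at ho
    rw [Real.norm_of_nonneg (by positivity : 0 ≤ h n ^ 2 + r), Real.norm_eq_abs, sub_sub]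
    refine abs_le_of_sq_le_sq ?_ (by positivity)
    have hx : 0 ≤ C ^ 2 * (2 * (h n ^ 2 * r)) := by positivity
    calc _ ≤ _ := hn.2.1
      _ ≤ _ := ho
      _ ≤ _ := by
        have : (C * (h n ^ 2 + r)) ^ 2 = C ^ 2 * (h n ^ 4 + r ^ 2) + C ^ 2 * (2 * (h n ^ 2 * r)) := by
          ring
        linarith
  · have hsplit : (fun n : ℕ => Var[est n; P] - σ x ^ 2 / ((n : ℝ) * h n * f x) * V) =
        fun n : ℕ => (Var[est n; P] - a n / (n * h n)) +
          (a n - σ x ^ 2 / f x * V) * ((n : ℝ) * h n)⁻¹ := by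
      funext n
      rw [mul_comm ((n : ℝ) * h n) (f x), ← div_div]
      ring
    rw [hsplit]
    refine IsLittleO.add (IsBigO.trans_isLittleO (IsBigO.of_bound 1 ?_) hBo) hNa
    filter_upwards [key] with n hn
    rw [one_mul, Real.norm_of_nonneg (integral_nonneg fun _ => sq_nonneg _), Real.norm_eq_abs]
    exact hn.2.2

end Combination

/-! ### The averaged estimator and its kernel constant -/

/-- The autocorrelation `∫ K(u + d) K(u) du` of the kernel. -/
noncomputable def autocorr (K : ℝ → ℝ) (d : ℝ) : ℝ := ∫ u, K (u + d) * K u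

lemma integral_mul_shift (K : ℝ → ℝ) (p q : ℝ) :
    ∫ u, K (u + p) * K (u + q) = autocorr K (p - q) := by
  rw [autocorr, ← integral_add_right_eq_self (fun u => K (u + (p - q)) * K u) q]
  simp only [add_assoc, add_sub_cancel]

lemma autocorr_neg (K : ℝ → ℝ) (d : ℝ) : autocorr K (-d) = autocorr K d := by
  have h1 := integral_mul_shift K 0 d
  have h2 := integral_mul_shift K d 0
  simp only [mul_comm (K (_ + 0))] at h1
  rw [zero_sub] at h1
  rw [← h1, h2, sub_zero]

lemma crossC_eq_autocorr (K : ℝ → ℝ) (a δ : ℝ) : crossC K a δ = autocorr K (2 * a * δ) := by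
  rw [crossC, ← autocorr_neg]
  simp only [sub_eq_add_neg]
  rw [integral_mul_shift]
  congr 1; ring

lemma nu_zero_two_eq_autocorr (K : ℝ → ℝ) : nu K 0 2 = autocorr K 0 := by
  simp [nu, autocorr, sq]

lemma KernelCondition.integral_sq_sum {K : ℝ → ℝ} (hK : KernelCondition K) {ι : Type*} [Fintype ι]
    (α s : ι → ℝ) :
    ∫ u, (∑ q, α q * K (u + s q)) ^ 2 =
      ∑ p, ∑ q, α p * α q * autocorr K (s p - s q) := by
  have hi : ∀ p q, Integrable (fun u => α p * α q * (K (u + s p) * K (u + s q))) := fun p q =>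
    ((memLp_two_comp_add hK.memLp_two (s p)).integrable_mul
      (memLp_two_comp_add hK.memLp_two (s q))).const_mul _
  have e : ∀ u, (∑ q, α q * K (u + s q)) ^ 2 =
      ∑ p, ∑ q, α p * α q * (K (u + s p) * K (u + s q)) := fun u => by
    rw [sq, Finset.sum_mul_sum]
    exact Finset.sum_congr rfl fun p _ => Finset.sum_congr rfl fun q _ => by ring
  simp only [e]
  rw [integral_finsetSum _ fun p _ => integrable_finsetSum _ fun q _ => hi p q]
  refine Finset.sum_congr rfl fun p _ => ?_
  rw [integral_finsetSum _ fun q _ => hi p q]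
  refine Finset.sum_congr rfl fun q _ => ?_
  rw [integral_const_mul, integral_mul_shift]

/-- Together with the next two lemmas: the interpolation at the nodes `-1, 0, 1` is exact on
quadratic polynomials, here on the powers of `y - r` evaluated at `r`. -/
lemma sum_interpCoeff (r : ℝ) : ∑ j, interpCoeff r j = 1 := by
  simp [interpCoeff, Fin.sum_univ_three]; ring

lemma sum_interpCoeff_mul (r : ℝ) : ∑ j : Fin 3, interpCoeff r j * (((j : ℕ) : ℝ) - 1 - r) = 0 := by
  simp [interpCoeff, Fin.sum_univ_three]; ring

lemma sum_interpCoeff_mul_sq (r : ℝ) :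
    ∑ j : Fin 3, interpCoeff r j * (((j : ℕ) : ℝ) - 1 - r) ^ 2 = 0 := by
  simp [interpCoeff, Fin.sum_univ_three]; ring

lemma interpCoeff_inv_sqrt_two :
    interpCoeff (1 / √2) = ![(1 - √2) / 4, 1 / 2, (1 + √2) / 4] := by
  have h : √2 ^ 2 = 2 := Real.sq_sqrt (by norm_num)
  have h' : 1 / √2 = √2 / 2 := by field_simp; linarith
  rw [interpCoeff, h']
  congr 1
  · linear_combination h / 8
  congr 1
  · linear_combination -h / 4
  congr 1
  linear_combination h / 8

lemma interpCoeff_neg_inv_sqrt_two :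
    interpCoeff (-(1 / √2)) = ![(1 + √2) / 4, 1 / 2, (1 - √2) / 4] := by
  have h : √2 ^ 2 = 2 := Real.sq_sqrt (by norm_num)
  have h' : 1 / √2 = √2 / 2 := by field_simp; linarith
  rw [interpCoeff, h']
  congr 1
  · linear_combination h / 8
  congr 1
  · linear_combination -h / 4
  congr 1
  linear_combination h / 8

/-- The shifts `±1/√2` of the two estimators that are averaged. -/
noncomputable def shift (b : Bool) : ℝ := cond b (1 / √2) (-(1 / √2))

/-- The coefficients of the six local linear estimators in the averaged estimator. -/
noncomputable def avgCoeff (q : Bool × Fin 3) : ℝ := interpCoeff (shift q.1) q.2 / 2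

/-- The design points of the averaged estimator, in units of the bandwidth. -/
noncomputable def avgPoint (δ : ℝ) (q : Bool × Fin 3) : ℝ :=
  (((q.2 : ℕ) : ℝ) - 1 - shift q.1) * δ

lemma avgEstimator_eq_sum (K : ℝ → ℝ) (δ h : ℝ) (n : ℕ) (X Y : ℕ → ℝ) (x : ℝ) :
    avgEstimator K δ h n X Y x =
      ∑ q, avgCoeff q * estimator K h n X Y (x + avgPoint δ q * h) := by
  have hz : ∀ b (j : Fin 3), x - (shift b + 1 - ((j : ℕ) : ℝ)) * (δ * h) =
      x + avgPoint δ (b, j) * h := fun b j => by simp only [avgPoint]; ring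
  have h1 : ∀ b, quadEstimator K δ (shift b) h n X Y x =
      ∑ j, 2 * (avgCoeff (b, j) * estimator K h n X Y (x + avgPoint δ (b, j) * h)) := fun b => by
    simp only [quadEstimator, hz, avgCoeff]
    exact Finset.sum_congr rfl fun j _ => by ring
  rw [Fintype.sum_prod_type, Fintype.sum_bool]
  have ht := h1 true
  have hf := h1 false
  rw [← Finset.mul_sum] at ht hf
  simp only [shift, cond_true, cond_false] at ht hf
  rw [avgEstimator, ht, hf]
  ring

lemma sum_avgCoeff : ∑ q, avgCoeff q = 1 := by
  simp only [Fintype.sum_prod_type, avgCoeff, ← Finset.sum_div, sum_interpCoeff]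
  norm_num

lemma sum_avgCoeff_mul (δ : ℝ) : ∑ q, avgCoeff q * avgPoint δ q = 0 := by
  have : ∀ b (j : Fin 3), avgCoeff (b, j) * avgPoint δ (b, j) =
      interpCoeff (shift b) j * (((j : ℕ) : ℝ) - 1 - shift b) * (δ / 2) := fun b j => by
    simp only [avgCoeff, avgPoint]; ring
  simp only [Fintype.sum_prod_type, this, ← Finset.sum_mul, sum_interpCoeff_mul]
  norm_num

lemma sum_avgCoeff_mul_sq (δ : ℝ) : ∑ q, avgCoeff q * avgPoint δ q ^ 2 = 0 := by
  have : ∀ b (j : Fin 3), avgCoeff (b, j) * avgPoint δ (b, j) ^ 2 =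
      interpCoeff (shift b) j * (((j : ℕ) : ℝ) - 1 - shift b) ^ 2 * (δ ^ 2 / 2) := fun b j => by
    simp only [avgCoeff, avgPoint]; ring
  simp only [Fintype.sum_prod_type, this, ← Finset.sum_mul, sum_interpCoeff_mul_sq]
  norm_num

/-- The autocorrelations between two shifted interpolations, collected by the difference of
their nodes. -/
lemma sum_mul_autocorr (K : ℝ → ℝ) (δ e : ℝ) (A A' : Fin 3 → ℝ) :
    ∑ j : Fin 3, ∑ k : Fin 3, A j * A' k *
        autocorr K (((((j : ℕ) : ℝ) - ((k : ℕ) : ℝ)) + e) * δ) =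
      A 2 * A' 0 * autocorr K ((2 + e) * δ)
      + (A 2 * A' 1 + A 1 * A' 0) * autocorr K ((1 + e) * δ)
      + (A 0 * A' 0 + A 1 * A' 1 + A 2 * A' 2) * autocorr K (e * δ)
      + (A 0 * A' 1 + A 1 * A' 2) * autocorr K ((1 - e) * δ)
      + A 0 * A' 2 * autocorr K ((2 - e) * δ) := by
  have e1 : autocorr K ((-1 + e) * δ) = autocorr K ((1 - e) * δ) := by
    rw [← autocorr_neg]; congr 1; ring
  have e2 : autocorr K ((-2 + e) * δ) = autocorr K ((2 - e) * δ) := by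
    rw [← autocorr_neg]; congr 1; ring
  simp only [Fin.sum_univ_three, Fin.val_zero, Fin.val_one, Fin.val_two]
  norm_num [e1, e2]
  ring

/-- The kernel constant of the averaged estimator. -/
lemma KernelCondition.integral_sq_avgCoeff {K : ℝ → ℝ} (hK : KernelCondition K) (δ : ℝ) :
    ∫ u, (∑ q, avgCoeff q * K (u + avgPoint δ q)) ^ 2 =
      nu K 0 2 - constC K δ / 4 - constD K δ / 2 := by
  have hs : ∀ b b' (j k : Fin 3), avgPoint δ (b, j) - avgPoint δ (b', k) =
      ((((j : ℕ) : ℝ) - ((k : ℕ) : ℝ)) + (shift b' - shift b)) * δ := fun b b' j k => by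
    simp only [avgPoint]; ring
  have hsum : ∀ b b', ∑ j, ∑ k, avgCoeff (b, j) * avgCoeff (b', k) *
      autocorr K (avgPoint δ (b, j) - avgPoint δ (b', k)) =
      _ := fun b b' => by
    simp only [hs]
    exact sum_mul_autocorr K δ _ (fun j => avgCoeff (b, j)) (fun j => avgCoeff (b', j))
  have hpm : shift false - shift true = -√2 := by
    have h : √2 ^ 2 = 2 := Real.sq_sqrt (by norm_num)
    simp only [shift, cond_true, cond_false]; field_simp; linarith
  have hmp : shift true - shift false = √2 := by linarith
  have hr : ∫ u, (∑ q, avgCoeff q * K (u + avgPoint δ q)) ^ 2 =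
      (∑ j, ∑ k, avgCoeff (true, j) * avgCoeff (true, k) *
          autocorr K (avgPoint δ (true, j) - avgPoint δ (true, k))) +
        (∑ j, ∑ k, avgCoeff (true, j) * avgCoeff (false, k) *
          autocorr K (avgPoint δ (true, j) - avgPoint δ (false, k))) +
        ((∑ j, ∑ k, avgCoeff (false, j) * avgCoeff (true, k) *
          autocorr K (avgPoint δ (false, j) - avgPoint δ (true, k))) +
        (∑ j, ∑ k, avgCoeff (false, j) * avgCoeff (false, k) *
          autocorr K (avgPoint δ (false, j) - avgPoint δ (false, k)))) := by
    rw [hK.integral_sq_sum]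
    simp only [Fintype.sum_prod_type, Fintype.sum_bool, Finset.sum_add_distrib]
    ring
  have ht : ∀ j, avgCoeff (true, j) = ![(1 - √2) / 4, 1 / 2, (1 + √2) / 4] j / 2 := fun j => by
    rw [← interpCoeff_inv_sqrt_two]; rfl
  have hf : ∀ j, avgCoeff (false, j) = ![(1 + √2) / 4, 1 / 2, (1 - √2) / 4] j / 2 := fun j => by
    rw [← interpCoeff_neg_inv_sqrt_two]; rfl
  rw [hr, hsum, hsum, hsum, hsum, hpm, hmp, sub_self, sub_self]
  simp only [ht, hf, constC, constD, crossC_eq_autocorr, nu_zero_two_eq_autocorr]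
  -- All arguments are brought to a common form.
  have a0 : autocorr K (-√2 * δ) = autocorr K (√2 * δ) := by rw [neg_mul, autocorr_neg]
  have a1 : autocorr K ((1 - √2) * δ) = autocorr K ((√2 - 1) * δ) := by
    rw [← autocorr_neg]; congr 1; ring
  have b0 : ∀ a, 2 * a * (δ / 2) = a * δ := fun a => by ring
  have b1 : 2 * (1 / 2 : ℝ) * δ = 1 * δ := by ring
  have b2 : 2 * (1 : ℝ) * δ = 2 * δ := by ring
  simp only [b0, b1, b2, a0, ← sub_eq_add_neg, a1, sub_neg_eq_add, add_zero, sub_zero, mul_zero,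
    zero_mul, Matrix.cons_val_zero, Matrix.cons_val_one, Matrix.cons_val_two, Matrix.head_cons,
    Matrix.tail_cons,
    add_comm (1 : ℝ) (√2), add_comm (2 : ℝ) (√2)]
  have h : √2 ^ 2 = 2 := Real.sq_sqrt (by norm_num)
  ring_nf
  simp only [h]
  ring

end LocalLinear

theorem theorem2 {Ω : Type*} [MeasurableSpace Ω] (P : Measure Ω) [IsProbabilityMeasure P]
    (X ε : ℕ → Ω → ℝ) (m σ f K : ℝ → ℝ) (x δ : ℝ) (h : ℕ → ℝ)
    (hsample : LocalLinear.IsSample P X ε f)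
    (hpoint : LocalLinear.PointCondition m σ f x)
    (hK : LocalLinear.KernelCondition K)
    (hδ : 0 < δ)
    (hh_pos : ∀ n, 0 < h n)
    (hh_zero : Tendsto h atTop (𝓝 0))
    (hnh : Tendsto (fun n : ℕ => (n : ℝ) * h n) atTop atTop) :
    (∀ᶠ n in atTop, MemLp (LocalLinear.avgEstimatorRV K m σ X ε δ (h n) n x) 2 P) ∧
    (fun n : ℕ => P[LocalLinear.avgEstimatorRV K m σ X ε δ (h n) n x] - m x
        - 1 / 2 * deriv (deriv m) x * LocalLinear.nu K 2 1 * h n ^ 2)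
      =o[atTop] (fun n : ℕ => h n ^ 2 + ((n : ℝ) * h n) ^ (-(1 / 2) : ℝ)) ∧
    (fun n : ℕ => Var[LocalLinear.avgEstimatorRV K m σ X ε δ (h n) n x; P]
        - σ x ^ 2 / ((n : ℝ) * h n * f x) *
          (LocalLinear.nu K 0 2 - LocalLinear.constC K δ / 4 - LocalLinear.constD K δ / 2))
      =o[atTop] (fun n : ℕ => h n ^ 4 + ((n : ℝ) * h n)⁻¹) := by
  have hb : LocalLinear.IsBandwidth h := ⟨hh_pos, hh_zero, hnh⟩
  have hmain := hsample.linearCombination_asymptotics hb hpoint hK LocalLinear.avgCoeff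
    (LocalLinear.avgPoint δ) LocalLinear.sum_avgCoeff (LocalLinear.sum_avgCoeff_mul δ)
    (LocalLinear.sum_avgCoeff_mul_sq δ)
    (est := fun n => LocalLinear.avgEstimatorRV K m σ X ε δ (h n) n x)
    fun n ω => LocalLinear.avgEstimator_eq_sum K δ (h n) n _ _ x
  rwa [hK.integral_sq_avgCoeff] at hmain
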